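/- Let $\Bbbk$ be an algebraically closed field of characteristic zero. Let $\mathfrak g$ be a root-reductive Lie algebra over $\Bbbk$ with Cartan subalgebra $\mathfrak h$: that is, $\mathfrak g=\bigcup_{n\in\mathbb N}\mathfrak g_n$ and $\mathfrak h=\bigcup_{n\in\mathbb N}\mathfrak h_n$, where $\mathfrak g_0\subset\mathfrak g_1\subset\cdots$ are finite dimensional reductive Lie subalgebras, the adjoint action of $\mathfrak g_n$ on $\mathfrak g_{n+1}$ is semisimple, $\mathfrak h_n\subset\mathfrak g_n$ are Cartan subalgebras with $\mathfrak h_n\subset\mathfrak h_{n+1}$, and each root vector of $(\mathfrak g_n,\mathfrak h_n)$ is a root vector of $(\mathfrak g_{n+1},\mathfrak h_{n+1})$. Let $\Phi\subset\mathfrak h^*$ be the set of roots and $\mathfrak g^\alpha$ the root spaces. Let $\Phi=\Phi^+\amalg(-\Phi^+)$ be a decomposition such that $\alpha+\beta\in\Phi^+$ whenever $\alpha,\beta\in\Phi^+$ and $\alpha+\beta\in\Phi$; put $\mathfrak n^+=\bigoplus_{\alpha\in\Phi^+}\mathfrak g^\alpha$ and $\mathfrak b=\mathfrak h\oplus\mathfrak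 n^+$. Let $\Gamma^+\subset\mathfrak h^*$ be the set of finite (possibly empty) sums of elements of $\Phi^+$, and write $\mu\le\lambda$ if $\lambda-\mu\in\Gamma^+$. Assume that $\mathfrak b$ is a Dynkin Borel subalgebra: every element of $\Gamma^+$ is a finite sum of simple roots, i.e. of elements of $\Phi^+$ which are not a sum of two elements of $\Phi^+$. Let $\mathbf C$ be the category of $\mathfrak g$-modules $M$ which are semisimple over $\mathfrak h$, i.e. $M=\bigoplus_{\mu\in\mathfrak h^*}M_\mu$ with $M_\mu$ the $\mu$-weight space, and let $\mathbf O$ be the full subcategory of those $M\in\mathbf C$ on which $\mathfrak b$ acts locally finitely. Let $\mathsf K\subset\mathfrak h^*$ be an upper finite ideal: if $\lambda\in\mathsf K$ and $\mu\le\lambda$ then $\mu\in\mathsf K$, and for each $\mu\in\mathsf K$ there are only finitely many $\lambda\in\mathsf K$ with $\lambda\ge\mu$. Let ${}^{\mathsf K}\mathbf O$ be the full subcategory of those $M\in\mathbf O$ with $M_\mu=0$ for all $\mu\notin\mathsf K$, and ${}^{\mathsf K}\bar{\mathcal O}$ its full subcategory of modules with finite dimensional weight spaces. All these categories are abelian,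 and the inclusion functors between them are exact. For $\lambda\in\mathfrak h^*$ let $\Delta(\lambda)=U(\mathfrak g)\otimes_{U(\mathfrak b)}\Bbbk_\lambda$ be the Verma module, and $\nabla(\lambda)=\Delta(\lambda)^\vee$ the dual Verma module. Here, for $M\in\mathbf C$ with finite dimensional weight spaces, $M^\vee$ is the maximal $\mathfrak h$-semisimple submodule of $M^*=\operatorname{Hom}_{\Bbbk}(M,\Bbbk)$ with the action $(xf)(m)=f(\tau(x)m)$, for an anti-involution $\tau$ of $\mathfrak g$ with $\tau(\mathfrak g^\alpha)=\mathfrak g^{-\alpha}$ for all $\alpha\in\Phi$ and $\tau|_{\mathfrak h}=\mathrm{id}$. Let $\mathcal F^\Delta$ (resp. $\mathcal F^\nabla$) be the class of modules which have a finite filtration with all subquotients isomorphic to Verma modules (resp. dual Verma modules). For an exact full embedding $\iota:\mathcal B\hookrightarrow\mathcal A$ of abelian categories there are induced homomorphisms $$\iota^i_{XY}:\operatorname{Ext}^i_{\mathcal B}(X,Y)\to\operatorname{Ext}^i_{\mathcal A}(X,Y),\qquad i\in\mathbb N,\ X,Y\in\mathcal B,$$ and $\mathcal B$ is called extension full in $\mathcal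 A$ if all of these are isomorphisms. Then: (i) ${}^{\mathsf K}\mathbf O$ is extension full in $\mathbf O$. (ii) ${}^{\mathsf K}\mathbf O$ is extension full in $\mathbf C$. (iii) For the inclusion $\iota:{}^{\mathsf K}\bar{\mathcal O}\hookrightarrow{}^{\mathsf K}\mathbf O$ and $M,N\in{}^{\mathsf K}\bar{\mathcal O}$, the homomorphism $\iota^i_{MN}$ is an isomorphism for all $i\in\mathbb N$ if $M\in\mathcal F^\Delta$ or $N\in\mathcal F^\nabla$. -/

import Mathlib

universe u

open CategoryTheory Limits

namespace RootReductive

/-! ### Extension groups and exact functors -/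

section Ext

variable {C : Type*} [Category* C] [Abelian C] {D : Type*} [Category* D] [Abelian D]

/-- The homomorphism `Ext^i_C(X, Y) → Ext^i_D(F X, F Y)` induced by an exact functor `F` between
abelian categories is an isomorphism. Here `Ext^i(X, Y)` is the group of morphisms from `X` to
`Y[i]` in the derived category. -/
def ExtMapBijective (F : C ⥤ D) [F.Additive] [PreservesFiniteLimits F]
    [PreservesFiniteColimits F] (X Y : C) (i : ℕ) : Prop :=
  letI := HasExt.standard C
  letI := HasExt.standard D
  Function.Bijective (F.mapExtAddHom X Y i)

/-- An exact (inclusion) functor is extension full if it induces isomorphisms on all extension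
groups. -/
def IsExtensionFull (F : C ⥤ D) [F.Additive] [PreservesFiniteLimits F]
    [PreservesFiniteColimits F] : Prop :=
  ∀ (X Y : C) (i : ℕ), ExtMapBijective F X Y i

end Ext

section FullSubcategories

variable {C : Type*} [Category* C] [Abelian C] {P Q : ObjectProperty C}

instance preservesFiniteLimits_ι [P.ContainsZero] [P.IsClosedUnderKernels]
    [P.IsClosedUnderCokernels] [P.IsClosedUnderFiniteProducts] : PreservesFiniteLimits P.ι := by
  have := P.preservesKernels_ι
  exact Functor.preservesFiniteLimits_of_preservesKernels P.ι

instance preservesFiniteColimits_ι [P.ContainsZero] [P.IsClosedUnderKernels]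
    [P.IsClosedUnderCokernels] [P.IsClosedUnderFiniteProducts] : PreservesFiniteColimits P.ι := by
  have := P.preservesCokernels_ι
  exact Functor.preservesFiniteColimits_of_preservesCokernels P.ι

instance additive_ιOfLE (h : P ≤ Q) : (ObjectProperty.ιOfLE h).Additive where

variable [P.ContainsZero] [P.IsClosedUnderKernels] [P.IsClosedUnderCokernels]
  [P.IsClosedUnderFiniteProducts] [Q.ContainsZero] [Q.IsClosedUnderKernels]
  [Q.IsClosedUnderCokernels] [Q.IsClosedUnderFiniteProducts]

instance preservesFiniteLimits_ιOfLE (h : P ≤ Q) :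
    PreservesFiniteLimits (ObjectProperty.ιOfLE h) := by
  have : PreservesFiniteLimits (ObjectProperty.ιOfLE h ⋙ Q.ι) :=
    inferInstanceAs (PreservesFiniteLimits P.ι)
  exact preservesFiniteLimits_of_reflects_of_preserves (ObjectProperty.ιOfLE h) Q.ι

instance preservesFiniteColimits_ιOfLE (h : P ≤ Q) :
    PreservesFiniteColimits (ObjectProperty.ιOfLE h) := by
  have : PreservesFiniteColimits (ObjectProperty.ιOfLE h ⋙ Q.ι) :=
    inferInstanceAs (PreservesFiniteColimits P.ι)
  exact preservesFiniteColimits_of_reflects_of_preserves (ObjectProperty.ιOfLE h) Q.ι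

end FullSubcategories

/-! ### Root-reductive Lie algebras, roots and positive systems -/

section LieAlgebras

variable {k : Type u} [Field k] {g : Type u} [LieRing g] [LieAlgebra k g]

/-- `x` is a root vector of `g` with respect to `h`. -/
def IsRootVector (h : LieSubalgebra k g) (x : g) : Prop :=
  x ≠ 0 ∧ ∃ α : Module.Dual k h, α ≠ 0 ∧ ∀ H : h, ⁅(H : g), x⁆ = α H • x

/-- The subspace `V` of `g`, stable under the adjoint action of the subalgebra `l`, is a semisimple
`l`-module. -/
def AdActsSemisimply (l : LieSubalgebra k g) (V : Submodule k g) : Prop :=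
  ∀ N : Submodule k g, N ≤ V → (∀ x ∈ l, ∀ v ∈ N, ⁅x, v⁆ ∈ N) →
    ∃ N' : Submodule k g, N' ≤ V ∧ (∀ x ∈ l, ∀ v ∈ N', ⁅x, v⁆ ∈ N') ∧ N ⊓ N' = ⊥ ∧ N ⊔ N' = V

/-- An exhaustion `gₙ` of `g` by finite dimensional reductive subalgebras, each reductive in the
next one, together with nested Cartan subalgebras `hₙ ⊆ gₙ` such that root vectors of `gₙ` are root
vectors of `gₙ₊₁`. -/
structure IsRootReductiveExhaustion (gn hn : ℕ → LieSubalgebra k g) : Prop where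
  le_succ : ∀ n, gn n ≤ gn (n + 1)
  exhausts : ∀ x : g, ∃ n, x ∈ gn n
  finiteDimensional : ∀ n, FiniteDimensional k (gn n)
  reductive : ∀ n, LieAlgebra.HasCentralRadical k (gn n)
  reductive_in_succ : ∀ n, AdActsSemisimply (gn n) (gn (n + 1)).toSubmodule
  cartan_le : ∀ n, hn n ≤ gn n
  cartan : ∀ n, ((hn n).comap (gn n).incl).IsCartanSubalgebra
  cartan_le_succ : ∀ n, hn n ≤ hn (n + 1)
  rootVector_succ : ∀ n, ∀ x ∈ gn n, IsRootVector (hn n) x → IsRootVector (hn (n + 1)) x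

/-- `g` is a root-reductive Lie algebra and `h` is a splitting maximal toral subalgebra (called a
Cartan subalgebra) of `g`: the union of the Cartan subalgebras of an exhaustion as above. -/
def IsRootReductive (h : LieSubalgebra k g) : Prop :=
  ∃ gn hn : ℕ → LieSubalgebra k g, IsRootReductiveExhaustion gn hn ∧
    ∀ x : g, x ∈ h ↔ ∃ n, x ∈ hn n

/-- The root space `g^α`. -/
def rootSpace (h : LieSubalgebra k g) (α : Module.Dual k h) : Submodule k g where
  carrier := {x | ∀ H : h, ⁅(H : g), x⁆ = α H • x}
  add_mem' := by
    intro x y hx hy H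
    rw [lie_add, hx H, hy H, smul_add]
  zero_mem' := by simp
  smul_mem' := by
    intro c x hx H
    rw [lie_smul, hx H, smul_comm]

/-- The set `Φ` of roots of `g` with respect to `h`. -/
def roots (h : LieSubalgebra k g) : Set (Module.Dual k h) :=
  {α | α ≠ 0 ∧ rootSpace h α ≠ ⊥}

/-- A choice of positive roots `Φ⁺`: `Φ` is the disjoint union of `Φ⁺` and `-Φ⁺`, and a root which
is a sum of two positive roots is positive. -/
structure IsPositiveSystem (h : LieSubalgebra k g) (Φp : Set (Module.Dual k h)) : Prop where
  mem_roots_iff : ∀ α, α ∈ roots h ↔ α ∈ Φp ∨ -α ∈ Φp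
  not_both : ∀ α ∈ Φp, -α ∉ Φp
  add_mem : ∀ α ∈ Φp, ∀ β ∈ Φp, α + β ∈ roots h → α + β ∈ Φp

variable {h : LieSubalgebra k g}

/-- The simple roots: positive roots which are not a sum of two positive roots. -/
def simpleRoots (Φp : Set (Module.Dual k h)) : Set (Module.Dual k h) :=
  {α | α ∈ Φp ∧ ¬ ∃ β ∈ Φp, ∃ γ ∈ Φp, α = β + γ}

/-- `Γ⁺`: all finite sums (including the empty sum) of positive roots. -/
def posCone (Φp : Set (Module.Dual k h)) : AddSubmonoid (Module.Dual k h) :=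
  AddSubmonoid.closure Φp

/-- The Borel subalgebra defined by `Φ⁺` is a Dynkin Borel subalgebra: every element of `Γ⁺` is a
finite sum of simple roots. -/
def IsDynkin (Φp : Set (Module.Dual k h)) : Prop :=
  ∀ γ ∈ posCone Φp, γ ∈ AddSubmonoid.closure (simpleRoots Φp)

/-- The partial order on weights: `μ ≤ lam` if and only if `lam - μ ∈ Γ⁺`. -/
def WeightLE (Φp : Set (Module.Dual k h)) (μ lam : Module.Dual k h) : Prop :=
  lam - μ ∈ posCone Φp

/-- Ideals of the partially ordered set of weights. -/
def IsWeightIdeal (Φp K : Set (Module.Dual k h)) : Prop :=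
  ∀ lam ∈ K, ∀ μ, WeightLE Φp μ lam → μ ∈ K

/-- Upper finite sets of weights. -/
def IsUpperFinite (Φp K : Set (Module.Dual k h)) : Prop :=
  ∀ μ ∈ K, {lam | lam ∈ K ∧ WeightLE Φp μ lam}.Finite

/-- The nilradical `n⁺`, the sum of the positive root spaces. -/
def nPos (Φp : Set (Module.Dual k h)) : Submodule k g :=
  ⨆ α ∈ Φp, rootSpace h α

/-- The Borel subalgebra `b = h ⊕ n⁺` (as a subspace of `g`). -/
def borel (Φp : Set (Module.Dual k h)) : Submodule k g :=
  h.toSubmodule ⊔ nPos Φp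

end LieAlgebras

/-! ### Weight modules -/

section Modules

variable {k : Type u} [Field k] {g : Type u} [LieRing g] [LieAlgebra k g]

variable (h : LieSubalgebra k g)
variable (M : Type u) [AddCommGroup M] [Module k M] [Module (UniversalEnvelopingAlgebra k g) M] [IsScalarTower k (UniversalEnvelopingAlgebra k g) M]

/-- The weight space `M_μ`. -/
def weightSpace (μ : Module.Dual k h) : Submodule k M where
  carrier := {m | ∀ H : h, UniversalEnvelopingAlgebra.ι k (H : g) • m = μ H • m}
  add_mem' := by
    intro x y hx hy H
    rw [smul_add, hx H, hy H, smul_add]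
  zero_mem' := by simp
  smul_mem' := by
    intro c x hx H
    rw [smul_comm, hx H, smul_comm]

/-- `M` is a weight module (semisimple over `h`): it is the sum of its weight spaces. The sum is
automatically direct. -/
def IsWeightModule : Prop := ⨆ μ, weightSpace h M μ = ⊤

/-- The support of `M`: the set of weights of `M`. -/
def support : Set (Module.Dual k h) := {μ | weightSpace h M μ ≠ ⊥}

/-- All weight spaces are finite dimensional. -/
def HasFiniteWeightSpaces : Prop := ∀ μ, FiniteDimensional k (weightSpace h M μ)

/-- The subspace `b` of `g` acts locally finitely on `M`: every vector lies in a finite dimensional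
`b`-stable subspace. -/
def IsLocallyFinite (b : Submodule k g) : Prop :=
  ∀ m : M, ∃ N : Submodule k M, FiniteDimensional k N ∧ m ∈ N ∧
    ∀ x ∈ b, ∀ v ∈ N, UniversalEnvelopingAlgebra.ι k x • v ∈ N

variable {h M}
variable {N : Type u} [AddCommGroup N] [Module k N] [Module (UniversalEnvelopingAlgebra k g) N] [IsScalarTower k (UniversalEnvelopingAlgebra k g) N]

lemma mem_weightSpace {μ : Module.Dual k h} {m : M} : m ∈ weightSpace h M μ ↔
    ∀ H : h, UniversalEnvelopingAlgebra.ι k (H : g) • m = μ H • m := Iff.rfl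

lemma map_mem_weightSpace (f : M →ₗ[UniversalEnvelopingAlgebra k g] N) {μ : Module.Dual k h} {m : M}
    (hm : m ∈ weightSpace h M μ) : f m ∈ weightSpace h N μ := by
  intro H
  rw [← map_smul, hm H, ← f.restrictScalars_apply k, map_smul]
  rfl

lemma mem_weightSpace_of_map (f : M →ₗ[UniversalEnvelopingAlgebra k g] N) (hf : Function.Injective f) {μ : Module.Dual k h}
    {m : M} (hm : f m ∈ weightSpace h N μ) : m ∈ weightSpace h M μ := by
  intro H
  apply hf
  rw [map_smul, hm H, ← f.restrictScalars_apply k, ← f.restrictScalars_apply k, map_smul]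

/-- If a sum of weight vectors of distinct weights lies in a submodule, so do the summands. -/
lemma mem_of_sum_mem (L : Submodule (UniversalEnvelopingAlgebra k g) M) (v : Module.Dual k h → M) (s : Finset (Module.Dual k h)) :
    (∀ μ ∈ s, v μ ∈ weightSpace h M μ) → ∑ μ ∈ s, v μ ∈ L → ∀ μ ∈ s, v μ ∈ L := by
  classical
  have key : ∀ c : k, ∀ m ∈ L, c • m ∈ L := fun c m hm => (L.restrictScalars k).smul_mem c hm
  suffices H : ∀ s : Finset (Module.Dual k h), ∀ v : Module.Dual k h → M,
      (∀ μ ∈ s, v μ ∈ weightSpace h M μ) → ∑ μ ∈ s, v μ ∈ L → ∀ μ ∈ s, v μ ∈ L from H s v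
  intro s
  induction s using Finset.induction_on with
  | empty => simp
  | insert a s ha ih =>
    intro v hv hsum
    have hs : ∀ μ ∈ s, v μ ∈ L := by
      intro μ hμ
      have hne : μ ≠ a := fun e => ha (e ▸ hμ)
      obtain ⟨H, hH⟩ : ∃ H, μ H ≠ a H := by
        by_contra! hcon
        exact hne (LinearMap.ext hcon)
      have h1 : ∑ ν ∈ s, (ν H - a H) • v ν ∈ L := by
        have h2 : UniversalEnvelopingAlgebra.ι k (H : g) • ∑ ν ∈ insert a s, v ν
            - a H • ∑ ν ∈ insert a s, v ν ∈ L :=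
          L.sub_mem (L.smul_mem _ hsum) (key _ _ hsum)
        have h3 : UniversalEnvelopingAlgebra.ι k (H : g) • ∑ ν ∈ insert a s, v ν
            - a H • ∑ ν ∈ insert a s, v ν = ∑ ν ∈ s, (ν H - a H) • v ν := by
          rw [Finset.smul_sum, Finset.smul_sum, ← Finset.sum_sub_distrib,
            Finset.sum_insert ha, hv a (Finset.mem_insert_self a s) H, sub_self, zero_add]
          refine Finset.sum_congr rfl fun ν hν => ?_
          rw [hv ν (Finset.mem_insert_of_mem hν) H, sub_smul]
        rwa [h3] at h2
      have h4 := ih (fun ν => (ν H - a H) • v ν)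
        (fun ν hν => (weightSpace h M ν).smul_mem _ (hv ν (Finset.mem_insert_of_mem hν))) h1 μ hμ
      have h5 := key (μ H - a H)⁻¹ _ h4
      rwa [smul_smul, inv_mul_cancel₀ (sub_ne_zero.mpr hH), one_smul] at h5
    intro μ hμ
    rcases Finset.mem_insert.mp hμ with rfl | hμ
    · rw [Finset.sum_insert ha] at hsum
      simpa using L.sub_mem hsum (L.sum_mem hs)
    · exact hs μ hμ

lemma IsWeightModule.exists_sum (hM : IsWeightModule h M) (m : M) :
    ∃ (s : Finset (Module.Dual k h)) (v : Module.Dual k h → M),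
      (∀ μ, v μ ∈ weightSpace h M μ) ∧ ∑ μ ∈ s, v μ = m := by
  classical
  have hm : m ∈ ⨆ μ, weightSpace h M μ := by rw [hM]; trivial
  obtain ⟨f, hf⟩ := (Submodule.mem_iSup_iff_exists_dfinsupp' _ m).mp hm
  exact ⟨f.support, fun μ => f μ, fun μ => (f μ).2, hf⟩

lemma IsWeightModule.of_forall
    (H : ∀ m : M, ∃ (s : Finset (Module.Dual k h)) (v : Module.Dual k h → M),
      (∀ μ ∈ s, v μ ∈ weightSpace h M μ) ∧ ∑ μ ∈ s, v μ = m) : IsWeightModule h M := by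
  rw [IsWeightModule, eq_top_iff]
  rintro m -
  obtain ⟨s, v, hv, rfl⟩ := H m
  exact Submodule.sum_mem _ fun μ hμ => Submodule.mem_iSup_of_mem μ (hv μ hμ)

lemma IsWeightModule.of_injective (f : M →ₗ[UniversalEnvelopingAlgebra k g] N) (hf : Function.Injective f)
    (hN : IsWeightModule h N) : IsWeightModule h M := by
  refine .of_forall fun m => ?_
  obtain ⟨s, v, hv, hs⟩ := hN.exists_sum (f m)
  have hmem := mem_of_sum_mem (LinearMap.range f) v s (fun μ _ => hv μ) (hs ▸ ⟨m, rfl⟩)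
  choose! w hw using hmem
  refine ⟨s, w, fun μ hμ => mem_weightSpace_of_map f hf (by rw [hw μ hμ]; exact hv μ), hf ?_⟩
  rw [map_sum, ← hs]
  exact Finset.sum_congr rfl hw

lemma IsWeightModule.of_surjective (f : M →ₗ[UniversalEnvelopingAlgebra k g] N) (hf : Function.Surjective f)
    (hM : IsWeightModule h M) : IsWeightModule h N := by
  refine .of_forall fun n => ?_
  obtain ⟨m, rfl⟩ := hf n
  obtain ⟨s, v, hv, rfl⟩ := hM.exists_sum m
  exact ⟨s, fun μ => f (v μ), fun μ _ => map_mem_weightSpace f (hv μ), (map_sum f _ _).symm⟩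

lemma exists_weight_lift (f : M →ₗ[UniversalEnvelopingAlgebra k g] N) (hf : Function.Surjective f)
    (hM : IsWeightModule h M) {μ : Module.Dual k h} {n : N} (hn : n ∈ weightSpace h N μ) :
    ∃ m ∈ weightSpace h M μ, f m = n := by
  classical
  obtain ⟨m, rfl⟩ := hf n
  obtain ⟨s, v, hv, rfl⟩ := hM.exists_sum m
  set t := insert μ s with ht
  let w : Module.Dual k h → N := fun ν =>
    (if ν ∈ s then f (v ν) else 0) - (if ν = μ then f (∑ ν ∈ s, v ν) else 0)
  have hw : ∀ ν ∈ t, w ν ∈ weightSpace h N ν := by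
    intro ν _
    refine Submodule.sub_mem _ ?_ ?_
    · split_ifs
      · exact map_mem_weightSpace f (hv ν)
      · exact Submodule.zero_mem _
    · split_ifs with e
      · subst e; exact hn
      · exact Submodule.zero_mem _
  have hsum : ∑ ν ∈ t, w ν = 0 := by
    rw [Finset.sum_sub_distrib, Finset.sum_ite_eq' t μ, if_pos (Finset.mem_insert_self μ s),
      Finset.sum_ite_mem, map_sum, sub_eq_zero]
    congr 1
    exact Finset.inter_eq_right.mpr (Finset.subset_insert μ s)
  have h0 := mem_of_sum_mem (⊥ : Submodule (UniversalEnvelopingAlgebra k g) N) w t hw (by rw [hsum]; exact Submodule.zero_mem _)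
    μ (Finset.mem_insert_self μ s)
  have h1 : w μ = 0 := h0
  simp only [w, if_true] at h1
  split_ifs at h1 with e
  · exact ⟨v μ, hv μ, sub_eq_zero.mp h1⟩
  · refine ⟨0, Submodule.zero_mem _, ?_⟩
    rw [map_zero]
    exact sub_eq_zero.mp h1

lemma mem_support_iff {μ : Module.Dual k h} : μ ∈ support h M ↔ ∃ m ∈ weightSpace h M μ, m ≠ 0 :=
  Submodule.ne_bot_iff _

lemma support_subset_of_injective (f : M →ₗ[UniversalEnvelopingAlgebra k g] N) (hf : Function.Injective f) :
    support h M ⊆ support h N := by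
  intro μ hμ
  obtain ⟨m, hm, h0⟩ := mem_support_iff.mp hμ
  exact mem_support_iff.mpr ⟨f m, map_mem_weightSpace f hm, fun e => h0 (hf (by rw [e, map_zero]))⟩

lemma support_subset_of_surjective (f : M →ₗ[UniversalEnvelopingAlgebra k g] N) (hf : Function.Surjective f)
    (hM : IsWeightModule h M) : support h N ⊆ support h M := by
  intro μ hμ
  obtain ⟨n, hn, h0⟩ := mem_support_iff.mp hμ
  obtain ⟨m, hm, rfl⟩ := exists_weight_lift f hf hM hn
  exact mem_support_iff.mpr ⟨m, hm, fun e => h0 (by rw [e, map_zero])⟩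

lemma HasFiniteWeightSpaces.of_injective (f : M →ₗ[UniversalEnvelopingAlgebra k g] N) (hf : Function.Injective f)
    (hN : HasFiniteWeightSpaces h N) : HasFiniteWeightSpaces h M := by
  intro μ
  have := hN μ
  let F : weightSpace h M μ →ₗ[k] weightSpace h N μ :=
    (f.restrictScalars k).restrict fun m hm => map_mem_weightSpace f hm
  refine Module.Finite.of_injective F fun x y hxy => ?_
  exact Subtype.ext (hf (congrArg Subtype.val hxy))

lemma HasFiniteWeightSpaces.of_surjective (f : M →ₗ[UniversalEnvelopingAlgebra k g] N) (hf : Function.Surjective f)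
    (hM : IsWeightModule h M) (hM' : HasFiniteWeightSpaces h M) : HasFiniteWeightSpaces h N := by
  intro μ
  have := hM' μ
  let F : weightSpace h M μ →ₗ[k] weightSpace h N μ :=
    (f.restrictScalars k).restrict fun m hm => map_mem_weightSpace f hm
  refine Module.Finite.of_surjective F fun y => ?_
  obtain ⟨m, hm, e⟩ := exists_weight_lift f hf hM y.2
  exact ⟨⟨m, hm⟩, Subtype.ext e⟩

lemma IsLocallyFinite.of_injective {b : Submodule k g} (f : M →ₗ[UniversalEnvelopingAlgebra k g] N)
    (hf : Function.Injective f) (hN : IsLocallyFinite N b) : IsLocallyFinite M b := by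
  intro m
  obtain ⟨V, hV, hm, hb⟩ := hN (f m)
  refine ⟨V.comap (f.restrictScalars k), ?_, hm, ?_⟩
  · let F : V.comap (f.restrictScalars k) →ₗ[k] V := (f.restrictScalars k).restrict fun m hm => hm
    exact Module.Finite.of_injective F fun x y hxy => Subtype.ext (hf (congrArg Subtype.val hxy))
  · intro x hx v hv
    change f (UniversalEnvelopingAlgebra.ι k x • v) ∈ V
    rw [map_smul]
    exact hb x hx _ hv

lemma IsLocallyFinite.of_surjective {b : Submodule k g} (f : M →ₗ[UniversalEnvelopingAlgebra k g] N)
    (hf : Function.Surjective f) (hM : IsLocallyFinite M b) : IsLocallyFinite N b := by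
  intro n
  obtain ⟨m, rfl⟩ := hf n
  obtain ⟨V, hV, hm, hb⟩ := hM m
  refine ⟨V.map (f.restrictScalars k), inferInstance, ⟨m, hm, rfl⟩, ?_⟩
  rintro x hx _ ⟨v, hv, rfl⟩
  exact ⟨_, hb x hx v hv, map_smul f _ _⟩

variable {P : Type u} [AddCommGroup P] [Module k P] [Module (UniversalEnvelopingAlgebra k g) P] [IsScalarTower k (UniversalEnvelopingAlgebra k g) P]

lemma IsWeightModule.of_add (f : M →ₗ[UniversalEnvelopingAlgebra k g] P) (f' : N →ₗ[UniversalEnvelopingAlgebra k g] P) (hP : ∀ p, ∃ m n, f m + f' n = p)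
    (hM : IsWeightModule h M) (hN : IsWeightModule h N) : IsWeightModule h P := by
  rw [IsWeightModule, eq_top_iff]
  rintro p -
  obtain ⟨m, n, rfl⟩ := hP p
  obtain ⟨s, v, hv, rfl⟩ := hM.exists_sum m
  obtain ⟨t, w, hw, rfl⟩ := hN.exists_sum n
  rw [map_sum, map_sum]
  exact Submodule.add_mem _
    (Submodule.sum_mem _ fun μ _ => Submodule.mem_iSup_of_mem μ (map_mem_weightSpace f (hv μ)))
    (Submodule.sum_mem _ fun μ _ => Submodule.mem_iSup_of_mem μ (map_mem_weightSpace f' (hw μ)))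

lemma IsLocallyFinite.of_add {b : Submodule k g} (f : M →ₗ[UniversalEnvelopingAlgebra k g] P) (f' : N →ₗ[UniversalEnvelopingAlgebra k g] P)
    (hP : ∀ p, ∃ m n, f m + f' n = p) (hM : IsLocallyFinite M b) (hN : IsLocallyFinite N b) :
    IsLocallyFinite P b := by
  intro p
  obtain ⟨m, n, rfl⟩ := hP p
  obtain ⟨V, hV, hm, hb⟩ := hM m
  obtain ⟨W, hW, hn, hb'⟩ := hN n
  refine ⟨V.map (f.restrictScalars k) ⊔ W.map (f'.restrictScalars k), inferInstance,
    Submodule.add_mem_sup ⟨m, hm, rfl⟩ ⟨n, hn, rfl⟩, ?_⟩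
  intro x hx v hv
  obtain ⟨_, ⟨y, hy, rfl⟩, _, ⟨z, hz, rfl⟩, rfl⟩ := Submodule.mem_sup.mp hv
  rw [smul_add]
  exact Submodule.add_mem_sup ⟨_, hb x hx y hy, map_smul f _ _⟩ ⟨_, hb' x hx z hz, map_smul f' _ _⟩

lemma support_subset_of_jointly_injective (f : P →ₗ[UniversalEnvelopingAlgebra k g] M) (f' : P →ₗ[UniversalEnvelopingAlgebra k g] N)
    (hP : ∀ p, f p = 0 → f' p = 0 → p = 0) : support h P ⊆ support h M ∪ support h N := by
  intro μ hμ
  obtain ⟨p, hp, h0⟩ := mem_support_iff.mp hμ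
  by_cases e : f p = 0
  · exact Or.inr (mem_support_iff.mpr ⟨f' p, map_mem_weightSpace f' hp, fun e' => h0 (hP p e e')⟩)
  · exact Or.inl (mem_support_iff.mpr ⟨f p, map_mem_weightSpace f hp, e⟩)

lemma HasFiniteWeightSpaces.of_jointly_injective (f : P →ₗ[UniversalEnvelopingAlgebra k g] M) (f' : P →ₗ[UniversalEnvelopingAlgebra k g] N)
    (hP : ∀ p, f p = 0 → f' p = 0 → p = 0) (hM : HasFiniteWeightSpaces h M)
    (hN : HasFiniteWeightSpaces h N) : HasFiniteWeightSpaces h P := by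
  intro μ
  have := hM μ
  have := hN μ
  let F : weightSpace h P μ →ₗ[k] weightSpace h M μ :=
    (f.restrictScalars k).restrict fun m hm => map_mem_weightSpace f hm
  let F' : weightSpace h P μ →ₗ[k] weightSpace h N μ :=
    (f'.restrictScalars k).restrict fun m hm => map_mem_weightSpace f' hm
  refine Module.Finite.of_injective (F.prod F') ?_
  rw [← LinearMap.ker_eq_bot, LinearMap.ker_eq_bot']
  intro p hp
  have h1 : F p = 0 := congrArg Prod.fst hp
  have h2 : F' p = 0 := congrArg Prod.snd hp
  exact Subtype.ext (hP p (congrArg Subtype.val h1) (congrArg Subtype.val h2))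

lemma IsWeightModule.of_subsingleton [Subsingleton M] : IsWeightModule h M :=
  Subsingleton.elim _ _

lemma IsLocallyFinite.of_subsingleton [Subsingleton M] (b : Submodule k g) : IsLocallyFinite M b :=
  fun _ => ⟨⊤, inferInstance, trivial, fun _ _ _ _ => trivial⟩

lemma support_of_subsingleton [Subsingleton M] : support h M = ∅ := by
  ext μ
  rw [mem_support_iff]
  simp [Subsingleton.elim _ (0 : M)]

lemma HasFiniteWeightSpaces.of_subsingleton [Subsingleton M] : HasFiniteWeightSpaces h M :=
  fun _ => inferInstance

end Modules

/-! ### The categories -/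

section Categories

open scoped ModuleCat

variable {k : Type u} [Field k] {g : Type u} [LieRing g] [LieAlgebra k g]

/-- The category `C` of `g`-modules which are semisimple over `h`. -/
def catC (h : LieSubalgebra k g) : ObjectProperty (ModuleCat.{u} (UniversalEnvelopingAlgebra k g)) :=
  fun M => IsWeightModule h M

variable {h : LieSubalgebra k g}

/-- The category `O` of weight modules on which `b` acts locally finitely. -/
def catO (Φp : Set (Module.Dual k h)) : ObjectProperty (ModuleCat.{u} (UniversalEnvelopingAlgebra k g)) :=
  fun M => IsWeightModule h M ∧ IsLocallyFinite M (borel Φp)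

/-- The truncated category `ᴷO` of modules in `O` with support in `K`. -/
def catKO (Φp K : Set (Module.Dual k h)) : ObjectProperty (ModuleCat.{u} (UniversalEnvelopingAlgebra k g)) :=
  fun M => catO Φp M ∧ support h M ⊆ K

/-- The category of modules in `ᴷO` with finite dimensional weight spaces. -/
def catKObar (Φp K : Set (Module.Dual k h)) : ObjectProperty (ModuleCat.{u} (UniversalEnvelopingAlgebra k g)) :=
  fun M => catKO Φp K M ∧ HasFiniteWeightSpaces h M

lemma catKO_le_catO (Φp K : Set (Module.Dual k h)) : catKO Φp K ≤ catO Φp := fun _ hM => hM.1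

lemma catKO_le_catC (Φp K : Set (Module.Dual k h)) : catKO Φp K ≤ catC h := fun _ hM => hM.1.1

lemma catKObar_le_catKO (Φp K : Set (Module.Dual k h)) : catKObar Φp K ≤ catKO Φp K :=
  fun _ hM => hM.1

lemma isClosedUnderFiniteProducts_of_prod (P : ObjectProperty (ModuleCat.{u} (UniversalEnvelopingAlgebra k g))) [P.ContainsZero]
    [P.IsClosedUnderSubobjects]
    (hP : ∀ M N : ModuleCat.{u} (UniversalEnvelopingAlgebra k g), P M → P N → P (ModuleCat.of (UniversalEnvelopingAlgebra k g) (M × N))) :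
    P.IsClosedUnderFiniteProducts := by
  have : P.IsClosedUnderBinaryProducts := by
    refine ⟨?_⟩
    rintro X ⟨p⟩
    let π₁ := p.π.app ⟨WalkingPair.left⟩
    let π₂ := p.π.app ⟨WalkingPair.right⟩
    let f : X ⟶ ModuleCat.of (UniversalEnvelopingAlgebra k g)
        (p.diag.obj ⟨WalkingPair.left⟩ × p.diag.obj ⟨WalkingPair.right⟩) :=
      ModuleCat.ofHom (π₁.hom.prod π₂.hom)
    have : Mono f := by
      refine ⟨fun a b hab => p.isLimit.hom_ext ?_⟩
      rintro ⟨_ | _⟩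
      · ext z
        exact congrArg Prod.fst (ConcreteCategory.congr_hom hab z)
      · ext z
        exact congrArg Prod.snd (ConcreteCategory.congr_hom hab z)
    exact P.prop_of_mono f (hP _ _ (p.prop_diag_obj _) (p.prop_diag_obj _))
  exact ObjectProperty.IsClosedUnderFiniteProducts.mk'

lemma exists_add_prod (M N : Type u) [AddCommGroup M] [AddCommGroup N] [Module (UniversalEnvelopingAlgebra k g) M] [Module (UniversalEnvelopingAlgebra k g) N]
    (p : M × N) : ∃ m n, LinearMap.inl (UniversalEnvelopingAlgebra k g) M N m + LinearMap.inr (UniversalEnvelopingAlgebra k g) M N n = p :=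
  ⟨p.1, p.2, by simp⟩

lemma jointly_injective_prod (M N : Type u) [AddCommGroup M] [AddCommGroup N] [Module (UniversalEnvelopingAlgebra k g) M]
    [Module (UniversalEnvelopingAlgebra k g) N] (p : M × N) (h₁ : LinearMap.fst (UniversalEnvelopingAlgebra k g) M N p = 0) (h₂ : LinearMap.snd (UniversalEnvelopingAlgebra k g) M N p = 0) :
    p = 0 := Prod.ext h₁ h₂

instance : (catC h).ContainsZero :=
  ⟨ModuleCat.of (UniversalEnvelopingAlgebra k g) PUnit, ModuleCat.isZero_of_subsingleton _, .of_subsingleton⟩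

instance : (catC h).IsClosedUnderSubobjects where
  prop_of_mono f _ hY := .of_injective f.hom ((ModuleCat.mono_iff_injective f).mp ‹_›) hY

instance : (catC h).IsClosedUnderQuotients where
  prop_of_epi f _ hX := .of_surjective f.hom ((ModuleCat.epi_iff_surjective f).mp ‹_›) hX

instance : (catC h).IsClosedUnderFiniteProducts :=
  isClosedUnderFiniteProducts_of_prod _ fun M N hM hN =>
    IsWeightModule.of_add (P := ModuleCat.of (UniversalEnvelopingAlgebra k g) (M × N)) (LinearMap.inl (UniversalEnvelopingAlgebra k g) M N)
      (LinearMap.inr (UniversalEnvelopingAlgebra k g) M N) (exists_add_prod M N) hM hN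

variable (Φp K : Set (Module.Dual k h))

instance : (catO Φp).ContainsZero :=
  ⟨ModuleCat.of (UniversalEnvelopingAlgebra k g) PUnit, ModuleCat.isZero_of_subsingleton _, .of_subsingleton, .of_subsingleton _⟩

instance : (catO Φp).IsClosedUnderSubobjects where
  prop_of_mono f _ hY :=
    have hf := (ModuleCat.mono_iff_injective f).mp ‹_›
    ⟨.of_injective f.hom hf hY.1, .of_injective f.hom hf hY.2⟩

instance : (catO Φp).IsClosedUnderQuotients where
  prop_of_epi f _ hX :=
    have hf := (ModuleCat.epi_iff_surjective f).mp ‹_›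
    ⟨.of_surjective f.hom hf hX.1, .of_surjective f.hom hf hX.2⟩

lemma catO_prod (M N : ModuleCat.{u} (UniversalEnvelopingAlgebra k g)) (hM : catO Φp M) (hN : catO Φp N) :
    catO Φp (ModuleCat.of (UniversalEnvelopingAlgebra k g) (M × N)) :=
  ⟨IsWeightModule.of_add (P := ModuleCat.of (UniversalEnvelopingAlgebra k g) (M × N)) (LinearMap.inl (UniversalEnvelopingAlgebra k g) M N)
      (LinearMap.inr (UniversalEnvelopingAlgebra k g) M N) (exists_add_prod M N) hM.1 hN.1,
    IsLocallyFinite.of_add (P := ModuleCat.of (UniversalEnvelopingAlgebra k g) (M × N)) (LinearMap.inl (UniversalEnvelopingAlgebra k g) M N)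
      (LinearMap.inr (UniversalEnvelopingAlgebra k g) M N) (exists_add_prod M N) hM.2 hN.2⟩

instance : (catO Φp).IsClosedUnderFiniteProducts :=
  isClosedUnderFiniteProducts_of_prod _ (catO_prod Φp)

instance : (catKO Φp K).ContainsZero :=
  ⟨ModuleCat.of (UniversalEnvelopingAlgebra k g) PUnit, ModuleCat.isZero_of_subsingleton _,
    ⟨.of_subsingleton, .of_subsingleton _⟩, by simp [support_of_subsingleton]⟩

instance : (catKO Φp K).IsClosedUnderSubobjects where
  prop_of_mono f _ hY :=
    have hf := (ModuleCat.mono_iff_injective f).mp ‹_›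
    ⟨(catO Φp).prop_of_mono f hY.1, (support_subset_of_injective f.hom hf).trans hY.2⟩

instance : (catKO Φp K).IsClosedUnderQuotients where
  prop_of_epi f _ hX :=
    have hf := (ModuleCat.epi_iff_surjective f).mp ‹_›
    ⟨(catO Φp).prop_of_epi f hX.1, (support_subset_of_surjective f.hom hf hX.1.1).trans hX.2⟩

lemma catKO_prod (M N : ModuleCat.{u} (UniversalEnvelopingAlgebra k g)) (hM : catKO Φp K M) (hN : catKO Φp K N) :
    catKO Φp K (ModuleCat.of (UniversalEnvelopingAlgebra k g) (M × N)) :=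
  ⟨catO_prod Φp M N hM.1 hN.1,
    (support_subset_of_jointly_injective (P := ModuleCat.of (UniversalEnvelopingAlgebra k g) (M × N)) (LinearMap.fst (UniversalEnvelopingAlgebra k g) M N)
      (LinearMap.snd (UniversalEnvelopingAlgebra k g) M N) (jointly_injective_prod M N)).trans (Set.union_subset hM.2 hN.2)⟩

instance : (catKO Φp K).IsClosedUnderFiniteProducts :=
  isClosedUnderFiniteProducts_of_prod _ (catKO_prod Φp K)

instance : (catKObar Φp K).ContainsZero :=
  ⟨ModuleCat.of (UniversalEnvelopingAlgebra k g) PUnit, ModuleCat.isZero_of_subsingleton _,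
    ⟨⟨.of_subsingleton, .of_subsingleton _⟩, by simp [support_of_subsingleton]⟩, .of_subsingleton⟩

instance : (catKObar Φp K).IsClosedUnderSubobjects where
  prop_of_mono f _ hY :=
    have hf := (ModuleCat.mono_iff_injective f).mp ‹_›
    ⟨(catKO Φp K).prop_of_mono f hY.1, .of_injective f.hom hf hY.2⟩

instance : (catKObar Φp K).IsClosedUnderQuotients where
  prop_of_epi f _ hX :=
    have hf := (ModuleCat.epi_iff_surjective f).mp ‹_›
    ⟨(catKO Φp K).prop_of_epi f hX.1, .of_surjective f.hom hf hX.1.1.1 hX.2⟩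

instance : (catKObar Φp K).IsClosedUnderFiniteProducts :=
  isClosedUnderFiniteProducts_of_prod _ fun M N hM hN =>
    ⟨catKO_prod Φp K M N hM.1 hN.1,
      HasFiniteWeightSpaces.of_jointly_injective (P := ModuleCat.of (UniversalEnvelopingAlgebra k g) (M × N))
        (LinearMap.fst (UniversalEnvelopingAlgebra k g) M N) (LinearMap.snd (UniversalEnvelopingAlgebra k g) M N) (jointly_injective_prod M N) hM.2 hN.2⟩

end Categories

/-! ### Verma modules, dual Verma modules and flags -/

section Verma

variable {k : Type u} [Field k] {g : Type u} [LieRing g] [LieAlgebra k g]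
variable {h : LieSubalgebra k g}

/-- The left ideal of `U(g)` generated by `n⁺` and all `H - lam(H)`, for `H` in `h`. -/
def vermaIdeal (Φp : Set (Module.Dual k h)) (lam : Module.Dual k h) : Submodule (UniversalEnvelopingAlgebra k g) (UniversalEnvelopingAlgebra k g) :=
  Submodule.span (UniversalEnvelopingAlgebra k g)
    ({y | ∃ x ∈ nPos Φp, y = UniversalEnvelopingAlgebra.ι k x} ∪
      {y | ∃ H : h, y = UniversalEnvelopingAlgebra.ι k (H : g) - algebraMap k (UniversalEnvelopingAlgebra k g) (lam H)})

/-- The Verma module `Δ(lam) = U(g) ⊗_{U(b)} k_lam`. As `k_lam` is one dimensional, this tensor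
product is the quotient of `U(g)` by the relations `u x = lam(x) u` for `x` in `b`, where `lam` is
extended by zero to `n⁺`. -/
abbrev Verma (Φp : Set (Module.Dual k h)) (lam : Module.Dual k h) : Type u :=
  (UniversalEnvelopingAlgebra k g) ⧸ vermaIdeal Φp lam

/-- An anti-involution `τ` of the Lie algebra `g` which maps `g^α` to `g^{-α}` and fixes `h`
pointwise. (Thus `-τ` is an involutive automorphism which acts by `-1` on `h`.) -/
structure TransposeMap (h : LieSubalgebra k g) where
  /-- The underlying linear map. -/
  toLinearMap : g →ₗ[k] g
  map_lie : ∀ x y, toLinearMap ⁅x, y⁆ = ⁅toLinearMap y, toLinearMap x⁆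
  involutive : ∀ x, toLinearMap (toLinearMap x) = x
  map_cartan : ∀ H : h, toLinearMap (H : g) = H
  map_rootSpace : ∀ α ∈ roots h, ∀ x ∈ rootSpace h α, toLinearMap x ∈ rootSpace h (-α)

variable (τ : TransposeMap h)
variable (M : Type u) [AddCommGroup M] [Module k M] [Module (UniversalEnvelopingAlgebra k g) M] [IsScalarTower k (UniversalEnvelopingAlgebra k g) M]

attribute [local instance 100] LieRing.ofAssociativeRing in
/-- The action of `g` on the full dual `M^*` twisted by `τ`, namely `(x f)(m) = f(τ(x) m)`. For the
automorphism `θ = -τ` this is the usual action on the dual twisted by `θ`, that is,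
`(x f)(m) = -f(θ(x) m)`. -/
noncomputable def twistedDualAction : g →ₗ⁅k⁆ Module.End k (Module.Dual k M) where
  toFun x := Module.Dual.transpose (R := k)
    (Algebra.lsmul k k M (UniversalEnvelopingAlgebra.ι k (τ.toLinearMap x)))
  map_add' x y := by
    ext f m
    simp
  map_smul' c x := by
    ext f m
    simp
  map_lie' := by
    intro x y
    ext f m
    change f (UniversalEnvelopingAlgebra.ι k (τ.toLinearMap ⁅x, y⁆) • m) =
      f (UniversalEnvelopingAlgebra.ι k (τ.toLinearMap y) •
        UniversalEnvelopingAlgebra.ι k (τ.toLinearMap x) • m) -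
      f (UniversalEnvelopingAlgebra.ι k (τ.toLinearMap x) •
        UniversalEnvelopingAlgebra.ι k (τ.toLinearMap y) • m)
    rw [τ.map_lie, LieHom.map_lie, LieRing.of_associative_ring_bracket, sub_smul, mul_smul,
      mul_smul, map_sub]

/-- The full dual `M^*`, with the action of `g` twisted by `τ`. -/
def TwistedDual (_τ : TransposeMap h) (M : Type u) [AddCommGroup M] [Module k M] : Type u :=
  Module.Dual k M

instance : AddCommGroup (TwistedDual τ M) := inferInstanceAs (AddCommGroup (Module.Dual k M))

instance : Module k (TwistedDual τ M) := inferInstanceAs (Module k (Module.Dual k M))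

noncomputable instance : Module (UniversalEnvelopingAlgebra k g) (TwistedDual τ M) :=
  Module.compHom (Module.Dual k M)
    (UniversalEnvelopingAlgebra.lift k (twistedDualAction τ M)).toRingHom

lemma twistedDual_smul_def (a : (UniversalEnvelopingAlgebra k g)) (f : TwistedDual τ M) :
    a • f = (UniversalEnvelopingAlgebra.lift k (twistedDualAction τ M) a) f := rfl

instance : IsScalarTower k (UniversalEnvelopingAlgebra k g) (TwistedDual τ M) where
  smul_assoc c a f := by
    rw [twistedDual_smul_def, twistedDual_smul_def, map_smul]
    rfl

/-- The action of `g` on the twisted dual. -/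
lemma twistedDual_ι_smul (x : g) (f : TwistedDual τ M) (m : M) :
    (show Module.Dual k M from UniversalEnvelopingAlgebra.ι k x • f) m =
      (show Module.Dual k M from f) (UniversalEnvelopingAlgebra.ι k (τ.toLinearMap x) • m) := by
  rw [twistedDual_smul_def, UniversalEnvelopingAlgebra.lift_ι_apply]
  rfl

/-- The dual `M^∨`: the largest `h`-semisimple submodule of the twisted dual. -/
noncomputable def contragredient : Submodule (UniversalEnvelopingAlgebra k g) (TwistedDual τ M) :=
  sSup {N | IsWeightModule h N}

/-- The dual Verma module `∇(lam) = Δ(lam)^∨`. -/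
abbrev DualVerma (Φp : Set (Module.Dual k h)) (lam : Module.Dual k h) : Type u :=
  contragredient τ (Verma Φp lam)

/-- `M` has a finite filtration `M = F 0 ⊇ F 1 ⊇ ⋯ ⊇ F n = 0` by submodules such that each
subquotient `F i / F (i + 1)` is isomorphic to some member of the family `X` of modules. -/
def HasFlag {ι : Type u} (X : ι → Type u) [∀ i, AddCommGroup (X i)] [∀ i, Module (UniversalEnvelopingAlgebra k g) (X i)]
    (M : Type u) [AddCommGroup M] [Module (UniversalEnvelopingAlgebra k g) M] : Prop :=
  ∃ (n : ℕ) (F : ℕ → Submodule (UniversalEnvelopingAlgebra k g) M), F 0 = ⊤ ∧ F n = ⊥ ∧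
    ∀ i < n, F (i + 1) ≤ F i ∧
      ∃ μ : ι, Nonempty ((F i ⧸ (F (i + 1)).submoduleOf (F i)) ≃ₗ[UniversalEnvelopingAlgebra k g] X μ)

/-- `M` has a finite filtration with Verma modules as subquotients. -/
def HasVermaFlag (Φp : Set (Module.Dual k h)) (M : Type u) [AddCommGroup M] [Module (UniversalEnvelopingAlgebra k g) M] : Prop :=
  HasFlag (k := k) (g := g) (fun μ : Module.Dual k h => Verma Φp μ) M

/-- `M` has a finite filtration with dual Verma modules as subquotients. -/
def HasDualVermaFlag (Φp : Set (Module.Dual k h)) (M : Type u) [AddCommGroup M] [Module (UniversalEnvelopingAlgebra k g) M] :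
    Prop :=
  HasFlag (k := k) (g := g) (fun μ : Module.Dual k h => DualVerma τ Φp μ) M

end Verma

end RootReductive

/-! Everything rests on induction Ind V = U(g) ⊗_{U(b)} V from weight modules V over b. Because g =
n⁻ ⊕ b, the space of Ind V is U(n⁻) ⊗ V. Hence Ind is exact, is left adjoint to restriction,
preserves semisimplicity over h, and only adds weights below those of V. No projective or injective
objects are needed. In any abelian category a class of positive degree dies along some epimorphism
onto its source (`Ext.exists_epi_comp_eq_zero`), by calculus of fractions in the derived category.
For a fully faithful exact functor, dimension shifting (`mapExtAddHom_bijective_of_effaceable`) then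
shows that the Ext groups agree as soon as classes of the larger category are killed by epimorphisms
of the smaller one.

For (i) and (ii), let x be a class in Ext^{n+1}(X, N), taken in O or C, with X and N in the
truncation, and let A → X be an epimorphism killing x. The complement of the ideal K is closed under
adding positive roots, so the weight spaces of A outside K form a b-submodule Y, and Z = A/Y has
weights in K. The map A → X kills Y, hence yields an epimorphism Ind Z → X. Upper finiteness of K
puts Ind Z into the truncation. The pullback of x to Ind Z dies on Ind A, so it comes from Ext^n(Ind
Y, N). This group is zero (`ext_eq_zero_of_isInduced`). In degree 0, Hom_g(Ind Y, N) = Hom_b(Y, N) =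
0, as the weights are disjoint. In higher degrees every epimorphism A → Ind Y is dominated by some
Ind W → Ind Y whose kernel is again induced: W is the part with weights outside K of the fibre
product of A and Y over Ind Y (`IsTriangular.exists_cover`).

For (iii), a Verma module is induced from a finite dimensional b-module V. Given an epimorphism A →
Ind V in the truncation, the fibre product of A and V is locally finite over b, so a finite
dimensional submodule W of it already maps onto V. Thus Ind W → Ind V dominates A → Ind V and stays
among modules with finite dimensional weight spaces (`extMapBijective_of_isFinitelyInduced`). Flags
follow by the five lemma. The dual Verma case uses the contragredients of these modules
(`extMapBijective_of_contragredient_ind`).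

The finiteness behind weight spaces and local finiteness is that a weight is a sum of a list of
positive roots in only finitely many ways (`finite_lists_of_sum_eq`). By the Dynkin condition this
reduces to independence of simple roots over ℕ, which follows from the root system geometry of a
sufficiently large finite dimensional piece of g. -/

set_option linter.unusedSectionVars false

namespace CategoryTheory.Abelian.Ext

universe w w' v v₂ u' u₂

/-! ### Effacing extension classes by epimorphisms and monomorphisms. -/

section Effaceability

variable {C : Type u'} [Category.{v} C] [Abelian C]

open _root_.DerivedCategory HomologicalComplex

lemma iCycles_comp_f_eq {X : C} {i : ℤ} {K : CochainComplex C ℤ}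
    (s : K ⟶ (single C (ComplexShape.up ℤ) i).obj X) :
    K.iCycles i ≫ s.f i = (K.homologyπ i ≫ homologyMap s i ≫
      (singleObjHomologySelfIso _ _ _).hom) ≫ (singleObjXSelf (ComplexShape.up ℤ) i X).inv := by
  rw [homologyπ_naturality_assoc, homologyπ_singleObjHomologySelfIso_hom, Category.assoc,
    ← singleObjCyclesSelfIso_inv_iCycles, Iso.hom_inv_id_assoc, cyclesMap_i]

lemma f_comp_pOpcycles_eq {Y : C} {i : ℤ} {L : CochainComplex C ℤ}
    (s : (single C (ComplexShape.up ℤ) i).obj Y ⟶ L) :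
    s.f i ≫ L.pOpcycles i = (singleObjXSelf (ComplexShape.up ℤ) i Y).hom ≫
      (singleObjHomologySelfIso _ _ _).inv ≫ homologyMap s i ≫ L.homologyι i := by
  rw [homologyι_naturality, singleObjHomologySelfIso_inv_homologyι_assoc,
    ← pOpcycles_singleObjOpcyclesSelfIso_inv_assoc, Iso.inv_hom_id_assoc, p_opcyclesMap]

/-- The cycles of `K` in degree `i` map onto the homology there, which `s` identifies with `X`; the
inclusion of the cycles is a chain map because the differential kills them. -/
lemma exists_epi_comp_eq_single_map {K : CochainComplex C ℤ} {X : C} {i : ℤ}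
    (s : K ⟶ (single C (ComplexShape.up ℤ) i).obj X) (hs : QuasiIso s) :
    ∃ (A : C) (p : A ⟶ X) (t : (single C (ComplexShape.up ℤ) i).obj A ⟶ K), Epi p ∧
      t ≫ s = (single C (ComplexShape.up ℤ) i).map p := by
  refine ⟨K.cycles i, K.homologyπ i ≫ homologyMap s i ≫ (singleObjHomologySelfIso _ _ _).hom,
    mkHomFromSingle (K.iCycles i) (by simp), inferInstance, ?_⟩
  apply from_single_hom_ext
  rw [comp_f, mkHomFromSingle_f, single_map_f_self, Category.assoc]
  exact congrArg _ (iCycles_comp_f_eq s)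

/-- Dual argument: the homology, identified with `Y`, embeds in the opcycles. -/
lemma exists_mono_comp_eq_single_map {L : CochainComplex C ℤ} {Y : C} {i : ℤ}
    (s : (single C (ComplexShape.up ℤ) i).obj Y ⟶ L) (hs : QuasiIso s) :
    ∃ (B : C) (j : Y ⟶ B) (t : L ⟶ (single C (ComplexShape.up ℤ) i).obj B), Mono j ∧
      s ≫ t = (single C (ComplexShape.up ℤ) i).map j := by
  refine ⟨L.opcycles i, (singleObjHomologySelfIso _ _ _).inv ≫ homologyMap s i ≫ L.homologyι i,
    mkHomToSingle (L.pOpcycles i) (by simp), inferInstance, ?_⟩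
  apply to_single_hom_ext
  rw [comp_f, mkHomToSingle_f, single_map_f_self, ← Category.assoc]
  exact (congrArg (· ≫ _) (f_comp_pOpcycles_eq s)).trans (Category.assoc _ _ _)

/-- Write `φ` as a right fraction with denominator `s : K ⟶ X`. Lifting an epimorphism through `s`
turns `φ` into an honest chain map from an object in degree `i`, where `L` is zero. -/
lemma exists_epi_map_comp_eq_zero [HasDerivedCategory.{w} C] {X : C} {L : CochainComplex C ℤ}
    {i n : ℤ} (φ : Q.obj ((CochainComplex.singleFunctor C i).obj X) ⟶ Q.obj L) (hn : n < i)
    [L.IsStrictlyLE n] :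
    ∃ (A : C) (p : A ⟶ X), Epi p ∧ Q.map ((CochainComplex.singleFunctor C i).map p) ≫ φ = 0 := by
  obtain ⟨K, s, h, g, rfl⟩ := right_fac φ
  have hs := (isIso_Q_map_iff_quasiIso C s).mp h
  obtain ⟨A, p, t, hp, hts⟩ : ∃ (A : C) (p : A ⟶ X)
      (t : (CochainComplex.singleFunctor C i).obj A ⟶ K), Epi p ∧
      t ≫ s = (CochainComplex.singleFunctor C i).map p := exists_epi_comp_eq_single_map s hs
  have htg : t ≫ g = 0 :=
    from_single_hom_ext ((L.isZero_of_isStrictlyLE n i hn).eq_of_tgt _ _)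
  refine ⟨A, p, hp, ?_⟩
  rw [← hts, Functor.map_comp, Category.assoc, IsIso.hom_inv_id_assoc, ← Functor.map_comp, htg,
    Functor.map_zero]

lemma exists_mono_comp_map_eq_zero [HasDerivedCategory.{w} C] {Y : C} {K : CochainComplex C ℤ}
    {i n : ℤ} (φ : Q.obj K ⟶ Q.obj ((CochainComplex.singleFunctor C i).obj Y)) (hn : i < n)
    [K.IsStrictlyGE n] :
    ∃ (B : C) (j : Y ⟶ B), Mono j ∧ φ ≫ Q.map ((CochainComplex.singleFunctor C i).map j) = 0 := by
  obtain ⟨L, g, s, h, rfl⟩ := left_fac φ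
  have hs := (isIso_Q_map_iff_quasiIso C s).mp h
  obtain ⟨B, j, t, hj, hts⟩ : ∃ (B : C) (j : Y ⟶ B)
      (t : L ⟶ (CochainComplex.singleFunctor C i).obj B), Mono j ∧
      s ≫ t = (CochainComplex.singleFunctor C i).map j := exists_mono_comp_eq_single_map s hs
  have htg : g ≫ t = 0 :=
    to_single_hom_ext ((K.isZero_of_isStrictlyGE n i hn).eq_of_src _ _)
  refine ⟨B, j, hj, ?_⟩
  rw [← hts, Functor.map_comp, Category.assoc, IsIso.inv_hom_id_assoc, ← Functor.map_comp, htg,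
    Functor.map_zero]

/-- This replaces a projective resolution: the epimorphism depends on the class, which is enough for
dimension shifting. -/
lemma exists_epi_comp_eq_zero [HasExt.{w} C] {X Y : C} {n : ℕ} (e : Ext X Y (n + 1)) :
    ∃ (A : C) (p : A ⟶ X), Epi p ∧ (mk₀ p).comp e (zero_add _) = 0 := by
  let := HasDerivedCategory.standard C
  -- The shift `Y[n+1]` is the complex with `Y` in degree `-(n+1)`, strictly below the degree 0 of
  -- `X`.
  obtain ⟨A, p, hp, h⟩ := exists_epi_map_comp_eq_zero
    (L := (CochainComplex.singleFunctor C (-(n + 1))).obj Y) (n := -(n + 1)) (i := 0)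
    (e.hom ≫ ((singleFunctors C).shiftIso (n + 1) (-(n + 1)) 0 (by lia)).hom.app _) (by lia)
  refine ⟨A, p, hp, ?_⟩
  apply homEquiv.injective
  simp only [← cancel_mono (((singleFunctors C).shiftIso (n + 1) (-(n + 1)) 0
    (by lia)).hom.app _), zero_hom, Limits.zero_comp, comp_hom, mk₀_hom]
  rw [ShiftedHom.mk₀_comp, Category.assoc]
  exact h

lemma exists_mono_comp_eq_zero [HasExt.{w} C] {X Y : C} {n : ℕ} (e : Ext X Y (n + 1)) :
    ∃ (B : C) (j : Y ⟶ B), Mono j ∧ e.comp (mk₀ j) (add_zero _) = 0 := by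
  let := HasDerivedCategory.standard C
  let K := (CochainComplex.singleFunctor C 0).obj X
  have := K.isStrictlyGE_of_ge (-n) 0 (by lia)
  obtain ⟨B, j, hj, h⟩ := exists_mono_comp_map_eq_zero
    (K := K) (n := -n) (i := -(n + 1))
    (e.hom ≫ ((singleFunctors C).shiftIso (n + 1) (-(n + 1)) 0 (by lia)).hom.app _) (by lia)
  refine ⟨B, j, hj, ?_⟩
  apply homEquiv.injective
  simp only [← cancel_mono (((singleFunctors C).shiftIso (n + 1) (-(n + 1)) 0
    (by lia)).hom.app _), zero_hom, Limits.zero_comp, comp_hom, mk₀_hom]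
  rw [ShiftedHom.comp_mk₀, Category.assoc]
  refine Eq.trans ?_ h
  refine Eq.trans ?_ (Category.assoc _ _ _).symm
  refine congrArg (e.hom ≫ ·) ?_
  exact ((singleFunctors C).shiftIso (n + 1) (-(n + 1)) 0 (by lia)).hom.naturality j

/-- If the objects of a class `Z` have no nonzero morphisms to `N` and every epimorphism onto an
object of `Z` is dominated by an epimorphism in `Z` with kernel in `Z`, then `Ext^n(Z, N) = 0`. -/
lemma eq_zero_of_dominated [HasExt.{w} C] (Z : C → Prop) (N : C)
    (h₀ : ∀ X, Z X → ∀ f : X ⟶ N, f = 0)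
    (h : ∀ X, Z X → ∀ (A : C) (q : A ⟶ X) [Epi q], ∃ (S : ShortComplex C) (_ : S.ShortExact)
      (e : S.X₃ = X) (r : S.X₂ ⟶ A), Z S.X₁ ∧ S.g ≫ eqToHom e = r ≫ q)
    (n : ℕ) (X : C) (hX : Z X) (x : Ext X N n) : x = 0 := by
  induction n generalizing X with
  | zero =>
    obtain ⟨f, rfl⟩ := (mk₀_bijective _ _).2 x
    rw [h₀ X hX f, mk₀_zero]
  | succ n ih =>
    obtain ⟨A, q, hq, hx⟩ := exists_epi_comp_eq_zero x
    obtain ⟨S, hS, rfl, r, h₁, hr⟩ := h X hX A q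
    rw [eqToHom_refl, Category.comp_id] at hr
    have : (mk₀ S.g).comp x (zero_add _) = 0 := by
      rw [hr, ← mk₀_comp_mk₀_assoc, hx, comp_zero]
    -- As `x` dies on `S.X₂`, it is the connecting image of a class of degree `n` on the kernel
    -- `S.X₁`, which again belongs to `Z`.
    obtain ⟨y, rfl⟩ := contravariant_sequence_exact₃ hS _ x this (add_comm 1 n)
    rw [ih _ h₁ y, comp_zero]

end Effaceability

/-! ### Comparison of Ext groups under a fully faithful exact functor. -/

section Map

variable {C : Type u'} [Category.{v} C] [Abelian C] {D : Type u₂} [Category.{v₂} D] [Abelian D]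
variable (F : C ⥤ D) [F.Additive] [PreservesFiniteLimits F] [PreservesFiniteColimits F]
variable [HasExt.{w} C] [HasExt.{w'} D]

lemma mapExtAddHom_zero_bijective [F.Full] [F.Faithful] (X Y : C) :
    Function.Bijective (F.mapExtAddHom X Y 0) := by
  simpa [mapExactFunctor₀] using ⟨F.map_injective, F.map_surjective⟩

/-- A fully faithful exact functor induces bijections on `Ext^n(X, Y)` for `X` in a class in which
extension classes can be effaced by epimorphisms of the class. -/
lemma mapExtAddHom_bijective_of_effaceable [F.Full] [F.Faithful] (Z : C → Prop) (Y : C)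
    (hC : ∀ X, Z X → ∀ (n : ℕ) (x : Ext X Y (n + 1)), ∃ (S : ShortComplex C) (_ : S.ShortExact)
      (e : S.X₃ = X), Z S.X₁ ∧ Z S.X₂ ∧ (mk₀ (S.g ≫ eqToHom e)).comp x (zero_add _) = 0)
    (hD : ∀ X, Z X → ∀ (n : ℕ) (x : Ext (F.obj X) (F.obj Y) (n + 1)), ∃ (S : ShortComplex C)
      (_ : S.ShortExact) (e : S.X₃ = X), Z S.X₁ ∧ Z S.X₂ ∧
        (mk₀ (F.map (S.g ≫ eqToHom e))).comp x (zero_add _) = 0)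
    (n : ℕ) (X : C) (hX : Z X) : Function.Bijective (F.mapExtAddHom X Y n) := by
  induction n generalizing X with
  | zero => exact mapExtAddHom_zero_bijective F X Y
  | succ n ih =>
    refine ⟨(injective_iff_map_eq_zero _).mpr fun x hx => ?_, fun x => ?_⟩
    · obtain ⟨S, hS, rfl, h₁, h₂, hx₀⟩ := hC X hX n x
      rw [eqToHom_refl, Category.comp_id] at hx₀
      obtain ⟨y, rfl⟩ := contravariant_sequence_exact₃ hS _ x hx₀ (add_comm 1 n)
      rw [Functor.mapExtAddHom_apply, mapExactFunctor_comp, mapExactFunctor_extClass] at hx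
      obtain ⟨z, hz⟩ := contravariant_sequence_exact₁ (hS.map_of_exact F) _ _ _ hx
      -- The class on `F S.X₂` restricting to the image of `y` lifts to the source category by
      -- surjectivity on `S.X₂`. Injectivity on `S.X₁` shows that the lift restricts to `y`, so the
      -- connecting map kills `y`.
      obtain ⟨z, rfl⟩ := (ih _ h₂).2 z
      have : (mk₀ S.f).comp z (zero_add n) = y := by
        apply (ih _ h₁).1
        rw [Functor.mapExtAddHom_apply, mapExactFunctor_comp, mapExactFunctor_mk₀]
        exact hz
      rw [← this, hS.extClass_comp_assoc]
    · obtain ⟨S, hS, rfl, h₁, h₂, hx₀⟩ := hD X hX n x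
      rw [eqToHom_refl, Category.comp_id] at hx₀
      obtain ⟨y, rfl⟩ := contravariant_sequence_exact₃ (hS.map_of_exact F) _ x hx₀ (add_comm 1 n)
      obtain ⟨y, rfl⟩ := (ih _ h₁).2 y
      refine ⟨hS.extClass.comp y (add_comm 1 n), ?_⟩
      rw [Functor.mapExtAddHom_apply, mapExactFunctor_comp, mapExactFunctor_extClass]
      rfl

/-- For the class of all objects, effaceability in the source category is automatic, since kernels
cause no restriction; only the target needs a hypothesis. -/
lemma mapExtAddHom_bijective_of_forall_effaceable [F.Full] [F.Faithful] (Y : C)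
    (hD : ∀ (X : C) (n : ℕ) (x : Ext (F.obj X) (F.obj Y) (n + 1)), ∃ (P : C) (p : P ⟶ X),
      Epi p ∧ (mk₀ (F.map p)).comp x (zero_add _) = 0)
    (n : ℕ) (X : C) : Function.Bijective (F.mapExtAddHom X Y n) := by
  have ses : ∀ {P X : C} (p : P ⟶ X) [Epi p],
      (ShortComplex.mk _ _ (kernel.condition p)).ShortExact := fun p _ =>
    { exact := ShortComplex.exact_kernel p }
  refine mapExtAddHom_bijective_of_effaceable F (fun _ => True) Y ?_ ?_ n X trivial
  · intro X _ n x
    obtain ⟨P, p, _, hp⟩ := exists_epi_comp_eq_zero x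
    exact ⟨_, ses p, rfl, trivial, trivial, by simpa using hp⟩
  · intro X _ n x
    obtain ⟨P, p, _, hp⟩ := hD X n x
    exact ⟨_, ses p, rfl, trivial, trivial, by simpa using hp⟩

/-- A fully faithful exact functor `F` induces bijections on `Ext^n(X, Y)` for `X` in a class `Z`
such that every epimorphism onto `F X` is dominated by an epimorphism in `Z` with kernel in `Z`. -/
lemma mapExtAddHom_bijective_of_dominated [F.Full] [F.Faithful] (Z : C → Prop)
    (h : ∀ X, Z X → ∀ (A : D) (q : A ⟶ F.obj X) [Epi q], ∃ (S : ShortComplex C) (_ : S.ShortExact)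
      (e : S.X₃ = X) (r : F.obj S.X₂ ⟶ A), Z S.X₁ ∧ Z S.X₂ ∧ F.map (S.g ≫ eqToHom e) = r ≫ q)
    (n : ℕ) (X Y : C) (hX : Z X) : Function.Bijective (F.mapExtAddHom X Y n) := by
  refine mapExtAddHom_bijective_of_effaceable F Z Y ?_ ?_ n X hX
  · intro X hX n x
    obtain ⟨A, q, _, hq⟩ := exists_epi_comp_eq_zero x
    -- Exactness makes `F.map q` an epimorphism, and fullness brings the dominating morphism back to
    -- the source category.
    obtain ⟨S, hS, e, r, h₁, h₂, hr⟩ := h X hX _ (F.map q)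
    refine ⟨S, hS, e, h₁, h₂, ?_⟩
    have : S.g ≫ eqToHom e = F.preimage r ≫ q := F.map_injective (by simpa using hr)
    rw [this, ← mk₀_comp_mk₀_assoc, hq, comp_zero]
  · intro X hX n x
    obtain ⟨A, q, _, hq⟩ := exists_epi_comp_eq_zero x
    obtain ⟨S, hS, e, r, h₁, h₂, hr⟩ := h X hX _ q
    refine ⟨S, hS, e, h₁, h₂, ?_⟩
    rw [hr, ← mk₀_comp_mk₀_assoc, hq, comp_zero]

/-- The dual of `mapExtAddHom_bijective_of_dominated`. -/
lemma mapExtAddHom_bijective_of_codominated [F.Full] [F.Faithful] (Z : C → Prop)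
    (h : ∀ Y, Z Y → ∀ (B : D) (j : F.obj Y ⟶ B) [Mono j], ∃ (S : ShortComplex C) (_ : S.ShortExact)
      (e : Y = S.X₁) (r : B ⟶ F.obj S.X₂), Z S.X₂ ∧ Z S.X₃ ∧ F.map (eqToHom e ≫ S.f) = j ≫ r)
    (n : ℕ) (X Y : C) (hY : Z Y) : Function.Bijective (F.mapExtAddHom X Y n) := by
  induction n generalizing Y with
  | zero => exact mapExtAddHom_zero_bijective F X Y
  | succ n ih =>
    refine ⟨(injective_iff_map_eq_zero _).mpr fun x hx => ?_, fun x => ?_⟩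
    · obtain ⟨B, j, _, hj⟩ := exists_mono_comp_eq_zero x
      obtain ⟨S, hS, rfl, r, h₂, h₃, hr⟩ := h Y hY _ (F.map j)
      rw [eqToHom_refl, Category.id_comp] at hr
      have hr' : S.f = j ≫ F.preimage r := F.map_injective (by simpa using hr)
      have hx₀ : x.comp (mk₀ S.f) (add_zero _) = 0 := by
        rw [hr', ← mk₀_comp_mk₀, ← comp_assoc_of_third_deg_zero, hj, zero_comp]
      obtain ⟨y, rfl⟩ := covariant_sequence_exact₁ _ hS x hx₀ rfl
      rw [Functor.mapExtAddHom_apply, mapExactFunctor_comp, mapExactFunctor_extClass] at hx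
      obtain ⟨z, hz⟩ := covariant_sequence_exact₃ _ (hS.map_of_exact F) _ _ hx
      obtain ⟨z, rfl⟩ := (ih _ h₂).2 z
      have : z.comp (mk₀ S.g) (add_zero n) = y := by
        apply (ih _ h₃).1
        rw [Functor.mapExtAddHom_apply, mapExactFunctor_comp, mapExactFunctor_mk₀]
        exact hz
      rw [← this, comp_assoc_of_second_deg_zero, hS.comp_extClass, comp_zero]
    · obtain ⟨B, j, _, hj⟩ := exists_mono_comp_eq_zero x
      obtain ⟨S, hS, rfl, r, h₂, h₃, hr⟩ := h Y hY _ j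
      rw [eqToHom_refl, Category.id_comp] at hr
      have hx₀ : x.comp (mk₀ (F.map S.f)) (add_zero _) = 0 := by
        rw [hr, ← mk₀_comp_mk₀, ← comp_assoc_of_third_deg_zero, hj, zero_comp]
      obtain ⟨y, rfl⟩ := covariant_sequence_exact₁ _ (hS.map_of_exact F) x hx₀ rfl
      obtain ⟨y, rfl⟩ := (ih _ h₃).2 y
      refine ⟨y.comp hS.extClass rfl, ?_⟩
      rw [Functor.mapExtAddHom_apply, mapExactFunctor_comp, mapExactFunctor_extClass]
      rfl

/-- The five lemma for the long exact sequence in the first variable. Degree 0 is full faithfulness,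
so no terms of negative degree occur. -/
lemma mapExtAddHom_bijective_X₂_of_contravariant [F.Full] [F.Faithful] {S : ShortComplex C}
    (hS : S.ShortExact) (Y : C) (h₁ : ∀ n, Function.Bijective (F.mapExtAddHom S.X₁ Y n))
    (h₃ : ∀ n, Function.Bijective (F.mapExtAddHom S.X₃ Y n)) (n : ℕ) :
    Function.Bijective (F.mapExtAddHom S.X₂ Y n) := by
  cases n with
  | zero => exact mapExtAddHom_zero_bijective F S.X₂ Y
  | succ n =>
    refine ⟨(injective_iff_map_eq_zero _).mpr fun x hx => ?_, fun x => ?_⟩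
    · have : (mk₀ S.f).comp x (zero_add _) = 0 := by
        apply (h₁ _).1
        rw [map_zero, Functor.mapExtAddHom_apply, mapExactFunctor_comp]
        rw [Functor.mapExtAddHom_apply] at hx
        rw [hx, comp_zero]
      obtain ⟨y, rfl⟩ := contravariant_sequence_exact₂ hS _ x this
      rw [Functor.mapExtAddHom_apply, mapExactFunctor_comp, mapExactFunctor_mk₀] at hx
      obtain ⟨z, hz⟩ := contravariant_sequence_exact₃ (hS.map_of_exact F) _ _ hx (add_comm 1 n)
      obtain ⟨z, rfl⟩ := (h₁ _).2 z
      have : hS.extClass.comp z (add_comm 1 n) = y := by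
        apply (h₃ _).1
        rw [Functor.mapExtAddHom_apply, mapExactFunctor_comp, mapExactFunctor_extClass]
        exact hz
      rw [← this, hS.comp_extClass_assoc]
    · obtain ⟨y, hy⟩ := (h₁ _).2 ((mk₀ (F.map S.f)).comp x (zero_add _))
      have : hS.extClass.comp y (add_comm 1 (n + 1)) = 0 := by
        apply (h₃ _).1
        rw [map_zero, Functor.mapExtAddHom_apply, mapExactFunctor_comp, mapExactFunctor_extClass]
        rw [Functor.mapExtAddHom_apply] at hy
        rw [hy]
        exact (hS.map_of_exact F).extClass_comp_assoc _
      obtain ⟨z, rfl⟩ := contravariant_sequence_exact₁ hS _ _ _ this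
      have hz : (mk₀ (F.map S.f)).comp (x - F.mapExtAddHom _ _ _ z) (zero_add _) = 0 := by
        rw [Functor.mapExtAddHom_apply, mapExactFunctor_comp, mapExactFunctor_mk₀] at hy
        rw [sub_eq_add_neg, comp_add, comp_neg, ← hy, Functor.mapExtAddHom_apply, add_neg_cancel]
      obtain ⟨t, ht⟩ := contravariant_sequence_exact₂ (hS.map_of_exact F) _ _ hz
      obtain ⟨t, rfl⟩ := (h₃ _).2 t
      refine ⟨(mk₀ S.g).comp t (zero_add _) + z, ?_⟩
      rw [map_add, ← eq_sub_iff_add_eq, Functor.mapExtAddHom_apply, mapExactFunctor_comp,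
        mapExactFunctor_mk₀]
      exact ht

/-- The five lemma in the second variable. -/
lemma mapExtAddHom_bijective_X₂_of_covariant [F.Full] [F.Faithful] {S : ShortComplex C}
    (hS : S.ShortExact) (X : C) (h₁ : ∀ n, Function.Bijective (F.mapExtAddHom X S.X₁ n))
    (h₃ : ∀ n, Function.Bijective (F.mapExtAddHom X S.X₃ n)) (n : ℕ) :
    Function.Bijective (F.mapExtAddHom X S.X₂ n) := by
  cases n with
  | zero => exact mapExtAddHom_zero_bijective F X S.X₂
  | succ n =>
    refine ⟨(injective_iff_map_eq_zero _).mpr fun x hx => ?_, fun x => ?_⟩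
    · have : x.comp (mk₀ S.g) (add_zero _) = 0 := by
        apply (h₃ _).1
        rw [map_zero, Functor.mapExtAddHom_apply, mapExactFunctor_comp]
        rw [Functor.mapExtAddHom_apply] at hx
        rw [hx, zero_comp]
      obtain ⟨y, rfl⟩ := covariant_sequence_exact₂ _ hS x this
      rw [Functor.mapExtAddHom_apply, mapExactFunctor_comp, mapExactFunctor_mk₀] at hx
      obtain ⟨z, hz⟩ := covariant_sequence_exact₁ _ (hS.map_of_exact F) _ hx rfl
      obtain ⟨z, rfl⟩ := (h₃ _).2 z
      have : z.comp hS.extClass rfl = y := by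
        apply (h₁ _).1
        rw [Functor.mapExtAddHom_apply, mapExactFunctor_comp, mapExactFunctor_extClass]
        exact hz
      rw [← this, comp_assoc_of_third_deg_zero, hS.extClass_comp, comp_zero]
    · obtain ⟨y, hy⟩ := (h₃ _).2 (x.comp (mk₀ (F.map S.g)) (add_zero _))
      have : y.comp hS.extClass rfl = 0 := by
        apply (h₁ _).1
        rw [map_zero, Functor.mapExtAddHom_apply, mapExactFunctor_comp, mapExactFunctor_extClass]
        rw [Functor.mapExtAddHom_apply] at hy
        rw [hy]
        have h := (hS.map_of_exact F).comp_extClass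
        refine (comp_assoc_of_second_deg_zero x (mk₀ (S.map F).g) _ _).trans ?_
        exact (congrArg (fun y => x.comp y _) h).trans (comp_zero _ _ _ _ _)
      obtain ⟨z, rfl⟩ := covariant_sequence_exact₃ _ hS _ _ this
      have hz : (x - F.mapExtAddHom _ _ _ z).comp (mk₀ (F.map S.g)) (add_zero _) = 0 := by
        rw [Functor.mapExtAddHom_apply, mapExactFunctor_comp, mapExactFunctor_mk₀] at hy
        rw [sub_eq_add_neg, add_comp, neg_comp, ← hy, Functor.mapExtAddHom_apply, add_neg_cancel]
      obtain ⟨t, ht⟩ := covariant_sequence_exact₂ _ (hS.map_of_exact F) _ hz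
      obtain ⟨t, rfl⟩ := (h₁ _).2 t
      refine ⟨t.comp (mk₀ S.f) (add_zero _) + z, ?_⟩
      rw [map_add, ← eq_sub_iff_add_eq, Functor.mapExtAddHom_apply, mapExactFunctor_comp,
        mapExactFunctor_mk₀]
      exact ht

end Map

end CategoryTheory.Abelian.Ext

namespace RootReductive

/-! ### Splitting off the center of a reductive Lie algebra. -/

section Reductive
variable {k : Type u} [Field k] {L : Type u} [LieRing L] [LieAlgebra k L]

/-- As the center acts by zero, an ideal of `S` is an ideal of `L`. So the radical of `S` lies in
the radical of `L`, which is the center, and the center meets `S` in zero. -/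
lemma hasTrivialRadical_of_isCompl_center [FiniteDimensional k L]
    [LieAlgebra.HasCentralRadical k L] (S : LieIdeal k L)
    (hS : ∀ x : L, ∃ z ∈ LieAlgebra.center k L, ∃ s ∈ S, x = z + s)
    (hS' : ∀ x ∈ S, x ∈ LieAlgebra.center k L → x = 0) : LieAlgebra.HasTrivialRadical k S := by
  constructor
  set r := LieAlgebra.radical k S
  let J : LieIdeal k L :=
    { r.toSubmodule.map S.incl.toLinearMap with
      lie_mem := by
        rintro x _ ⟨y, hy, rfl⟩
        obtain ⟨z, hz, s, hs, rfl⟩ := hS x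
        refine ⟨⁅(⟨s, hs⟩ : S), y⁆, lie_mem_right k S r _ _ hy, ?_⟩
        have : ⁅z, (y : L)⁆ = 0 := by
          rw [← lie_skew, (LieModule.mem_maxTrivSubmodule k L L z).mp hz, neg_zero]
        change ⁅s, (y : L)⁆ = ⁅z + s, (y : L)⁆
        rw [add_lie, this, zero_add] }
  have hJS : ∀ y ∈ J, y ∈ S := by
    rintro _ ⟨y, hy, rfl⟩
    exact y.2
  have hJr : ∀ y (hy : y ∈ J), (⟨y, hJS y hy⟩ : S) ∈ r := by
    rintro _ ⟨y, hy, rfl⟩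
    exact hy
  let f : J →ₗ⁅k⁆ r :=
    { toFun := fun y => ⟨⟨y, hJS y y.2⟩, hJr y y.2⟩
      map_add' := fun _ _ => rfl
      map_smul' := fun _ _ => rfl
      map_lie' := rfl }
  have hf : Function.Injective f := fun x y h => by
    have := congrArg (fun z : r => ((z : S) : L)) h
    exact Subtype.ext this
  have : LieAlgebra.IsSolvable J := hf.lieAlgebra_isSolvable
  have hJ : J ≤ LieAlgebra.center k L := by
    rw [← LieAlgebra.radical_eq_center]
    exact (LieAlgebra.LieIdeal.solvable_iff_le_radical k L J).mp this
  rw [eq_bot_iff]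
  intro y hy
  have h0 := hS' y y.2 (hJ ⟨y, hy, rfl⟩)
  exact Subtype.ext h0

lemma center_le_of_isCartanSubalgebra (H : LieSubalgebra k L) [H.IsCartanSubalgebra] {z : L}
    (hz : z ∈ LieAlgebra.center k L) : z ∈ H := by
  rw [← LieSubalgebra.IsCartanSubalgebra.self_normalizing (H := H),
    LieSubalgebra.mem_normalizer_iff']
  intro y _
  rw [(LieModule.mem_maxTrivSubmodule k L L z).mp hz]
  exact H.zero_mem

/-- The center lies in `H` and commutes with everything, so an element of `S` normalizing the part
of `H` in `S` normalizes all of `H`. -/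
lemma isCartanSubalgebra_comap (S : LieIdeal k L)
    (hS : ∀ x : L, ∃ z ∈ LieAlgebra.center k L, ∃ s ∈ S, x = z + s)
    (H : LieSubalgebra k L) [H.IsCartanSubalgebra] :
    (H.comap S.incl).IsCartanSubalgebra := by
  constructor
  · let f : H.comap S.incl →ₗ⁅k⁆ H :=
      { toFun := fun y => ⟨y.1, y.2⟩
        map_add' := fun _ _ => rfl
        map_smul' := fun _ _ => rfl
        map_lie' := rfl }
    have hf : Function.Injective f := fun x y h =>
      Subtype.ext (Subtype.ext (congrArg (fun z : H => (z : L)) h))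
    exact hf.lieAlgebra_isNilpotent
  · refine le_antisymm (fun x hx => ?_) (LieSubalgebra.le_normalizer _)
    rw [LieSubalgebra.mem_normalizer_iff'] at hx
    change (x : L) ∈ H
    rw [← LieSubalgebra.IsCartanSubalgebra.self_normalizing (H := H),
      LieSubalgebra.mem_normalizer_iff']
    intro y hy
    obtain ⟨z, hz, s, hs, rfl⟩ := hS y
    have hzH := center_le_of_isCartanSubalgebra H hz
    have hz0 : ⁅z, (x : L)⁆ = 0 := by
      rw [← lie_skew, (LieModule.mem_maxTrivSubmodule k L L z).mp hz, neg_zero]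
    have hsH : s ∈ H := by simpa using H.sub_mem hy hzH
    rw [add_lie, hz0, zero_add]
    exact hx ⟨s, hs⟩ hsH

end Reductive

/-! ### The semisimple parts of the members of an exhaustion. -/

section LieAlgebras

variable {k : Type u} [Field k] {g : Type u} [LieRing g] [LieAlgebra k g]

/-- A semisimple Lie algebra `S` embedded in `G`, which is a complement of the center of `G`,
together with the corresponding Cartan subalgebra `HS`. -/
structure IsSemisimplePart (G H : LieSubalgebra k g) {S : Type u} [LieRing S] [LieAlgebra k S]
    (HS : LieSubalgebra k S) (φ : S →ₗ⁅k⁆ g) : Prop where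
  injective : Function.Injective φ
  map_mem : ∀ s, φ s ∈ G
  mem_iff : ∀ s, s ∈ HS ↔ φ s ∈ H
  exists_add : ∀ x ∈ G, ∃ z ∈ H, (∀ y ∈ G, ⁅z, y⁆ = 0) ∧ ∃ s, x = z + φ s

variable [CharZero k] {gn hn : ℕ → LieSubalgebra k g}

/-- The semisimple action of `gn n` on `gn (n + 1)` gives a stable complement of the center of `gn
n`; its intersection with `gn n` is an ideal complementing the center there. Trivial radical in
characteristic zero then makes the Killing form nondegenerate. -/
lemma IsRootReductiveExhaustion.exists_isSemisimplePart (E : IsRootReductiveExhaustion gn hn)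
    (n : ℕ) : ∃ (S : Type u) (_ : LieRing S) (_ : LieAlgebra k S) (HS : LieSubalgebra k S)
      (_ : FiniteDimensional k S) (_ : LieAlgebra.IsKilling k S) (_ : HS.IsCartanSubalgebra)
      (φ : S →ₗ⁅k⁆ g), IsSemisimplePart (gn n) (hn n) HS φ := by
  have := E.finiteDimensional n
  have := E.reductive n
  have := E.cartan n
  let L := gn n
  let Z : Submodule k g := (LieAlgebra.center k L).toSubmodule.map (gn n).toSubmodule.subtype
  have hZ0 : ∀ z ∈ Z, ∀ y ∈ gn n, ⁅y, z⁆ = 0 := by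
    rintro _ ⟨z, hz, rfl⟩ y hy
    exact congrArg Subtype.val ((LieModule.mem_maxTrivSubmodule k L L z).mp hz ⟨y, hy⟩)
  obtain ⟨N, hN, hNs, hi, hs⟩ := E.reductive_in_succ n Z
    (by
      rintro _ ⟨z, hz, rfl⟩
      exact E.le_succ n z.2)
    (by
      intro x hx z hz
      rw [hZ0 z hz x hx]
      exact Z.zero_mem)
  let S : LieIdeal k L :=
    { N.comap (gn n).toSubmodule.subtype with
      lie_mem := fun {x y} hy => hNs x x.2 y hy }
  have hS : ∀ x : L, ∃ z ∈ LieAlgebra.center k L, ∃ s ∈ S, x = z + s := by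
    intro x
    have hx : (x : g) ∈ Z ⊔ N := by
      rw [hs]
      exact E.le_succ n x.2
    obtain ⟨_, ⟨z, hz, rfl⟩, s, hs, e⟩ := Submodule.mem_sup.mp hx
    refine ⟨z, hz, x - z, ?_, by abel⟩
    change ((x - z : L) : g) ∈ N
    have : ((x - z : L) : g) = s := by
      rw [AddSubgroupClass.coe_sub, ← e]
      simp
    rwa [this]
  have hS' : ∀ x ∈ S, x ∈ LieAlgebra.center k L → x = 0 := by
    intro x hx hz
    have : (x : g) ∈ Z ⊓ N := ⟨⟨x, hz, rfl⟩, hx⟩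
    rw [hi] at this
    exact Subtype.ext this
  have := hasTrivialRadical_of_isCompl_center S hS hS'
  refine ⟨S, inferInstance, inferInstance, ((hn n).comap (gn n).incl).comap S.incl,
    inferInstance, inferInstance, isCartanSubalgebra_comap S hS _,
    (gn n).incl.comp S.incl, ?_, fun s => s.1.2, fun s => Iff.rfl, ?_⟩
  · intro x y h
    exact Subtype.ext (Subtype.ext h)
  · intro x hx
    obtain ⟨z, hz, s, hs, e⟩ := hS ⟨x, hx⟩
    refine ⟨z, center_le_of_isCartanSubalgebra ((hn n).comap (gn n).incl) hz, ?_, ⟨s, hs⟩,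
      congrArg Subtype.val e⟩
    intro y hy
    rw [← lie_skew, hZ0 z ⟨z, hz, rfl⟩ y hy, neg_zero]

end LieAlgebras

section LieAlgebras

variable {k : Type u} [Field k] {g : Type u} [LieRing g]
  [LieAlgebra k g] {G H : LieSubalgebra k g} {S : Type u} [LieRing S] [LieAlgebra k S]
  {HS : LieSubalgebra k S} {φ : S →ₗ⁅k⁆ g}

namespace IsSemisimplePart

variable (E : IsSemisimplePart G H HS φ)
include E

lemma exists_add_of_mem {x : g} (hx : x ∈ H) (hHG : H ≤ G) :
    ∃ z ∈ H, (∀ y ∈ G, ⁅z, y⁆ = 0) ∧ ∃ s ∈ HS, x = z + φ s := by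
  obtain ⟨z, hz, hz0, s, rfl⟩ := E.exists_add x (hHG hx)
  exact ⟨z, hz, hz0, s, (E.mem_iff s).mpr (by simpa using H.sub_mem hx hz), rfl⟩

/-- The action of `H` on the image of `S` factors through `HS`. -/
lemma forall_lie_eq (hHG : H ≤ G) {s : S} {a : HS → k}
    (hs : ∀ y : HS, ⁅(y : S), s⁆ = a y • s) : ∃ α : Module.Dual k H, (∀ x : H, ⁅(x : g), φ s⁆ = α x • φ s) ∧ ∀ (y : HS) (hy : φ y ∈ H), s ≠ 0 → α ⟨φ y, hy⟩ = a y := by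
  by_cases hs0 : s = 0
  · exact ⟨0, by simp [hs0], fun _ _ h => absurd hs0 h⟩
  have h1 : ∀ x : H, ∃ c : k, ⁅(x : g), φ s⁆ = c • φ s := by
    intro x
    obtain ⟨z, hz, hz0, t, ht, e⟩ := E.exists_add_of_mem x.2 hHG
    refine ⟨a ⟨t, ht⟩, ?_⟩
    rw [e, add_lie, hz0 _ (E.map_mem s), zero_add, ← LieHom.map_lie]
    erw [hs ⟨t, ht⟩]
    rw [map_smul]
  choose c hc using h1
  have hφ : φ s ≠ 0 := fun h => hs0 (E.injective (by rw [h, map_zero]))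
  have inj : ∀ {c d : k}, c • φ s = d • φ s → c = d := fun h => smul_left_injective k hφ h
  refine ⟨{ toFun := c, map_add' := fun x y => inj ?_, map_smul' := fun r x => inj ?_ }, hc, ?_⟩
  · rw [← hc, add_smul, ← hc, ← hc, ← add_lie]; rfl
  · rw [← hc, RingHom.id_apply, smul_assoc, ← hc, ← smul_lie]; rfl
  · intro y hy _
    refine inj ?_
    change c _ • _ = _
    rw [← hc, ← map_smul, ← hs, LieHom.map_lie]

/-- Bracketing with `y₀` removes central components, and an eigenvector with nonzero eigenvalue is a
multiple of its bracket. -/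
lemma exists_eq_map (hHG : H ≤ G) {x : g} (hx : x ∈ G) {y₀ : g} (hy₀ : y₀ ∈ H) {c : k}
    (hc : c ≠ 0) (h : ⁅y₀, x⁆ = c • x) : ∃ s, φ s = x := by
  obtain ⟨z, hz, hz0, s, rfl⟩ := E.exists_add x hx
  obtain ⟨w, hw, hw0, t, ht, rfl⟩ := E.exists_add_of_mem hy₀ hHG
  refine ⟨c⁻¹ • ⁅t, s⁆, ?_⟩
  have h2 : ⁅φ t, z⁆ = 0 := by rw [← lie_skew, hz0 _ (E.map_mem t), neg_zero]
  rw [add_lie, hw0 _ hx, zero_add, lie_add, h2, zero_add, ← LieHom.map_lie] at h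
  rw [map_smul, h, smul_smul, inv_mul_cancel₀ hc, one_smul]

variable [CharZero k] [FiniteDimensional k S] [LieAlgebra.IsKilling k S] [HS.IsCartanSubalgebra]

omit [CharZero k] in
lemma lie_eq_zero (hHG : H ≤ G) {x y : g} (hx : x ∈ H) (hy : y ∈ H) : ⁅x, y⁆ = 0 := by
  obtain ⟨z, hz, hz0, s, hs, rfl⟩ := E.exists_add_of_mem hx hHG
  obtain ⟨w, hw, hw0, t, ht, rfl⟩ := E.exists_add_of_mem hy hHG
  have h1 : ⁅s, t⁆ = 0 := by
    have : ⁅(⟨s, hs⟩ : HS), (⟨t, ht⟩ : HS)⁆ = 0 := trivial_lie_zero _ _ _ _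
    exact congrArg Subtype.val this
  have h2 : ⁅φ s, w⁆ = 0 := by rw [← lie_skew, hw0 _ (E.map_mem s), neg_zero]
  rw [add_lie, hz0 _ (hHG hy), zero_add, lie_add, h2, zero_add, ← LieHom.map_lie, h1, map_zero]

variable [IsAlgClosed k]

lemma mem_sup_span (hHG : H ≤ G) {x : g} (hx : x ∈ G) :
    x ∈ H.toSubmodule ⊔ Submodule.span k {v | v ∈ G ∧ IsRootVector H v} := by
  obtain ⟨z, hz, hz0, s, rfl⟩ := E.exists_add x hx
  refine Submodule.add_mem _ (Submodule.mem_sup_left hz) ?_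
  have hs : s ∈ (HS.toLieSubmodule ⊔ ⨆ α : LieModule.Weight k HS S, ⨆ (_ : α.IsNonZero),
      LieAlgebra.rootSpace HS α).toSubmodule := by
    rw [LieAlgebra.cartan_sup_iSup_rootSpace_eq_top]; trivial
  rw [LieSubmodule.sup_toSubmodule, LieSubmodule.iSup_toSubmodule] at hs
  simp only [LieSubmodule.iSup_toSubmodule] at hs
  set T := H.toSubmodule ⊔ Submodule.span k {v | v ∈ G ∧ IsRootVector H v}
  suffices h : HS.toLieSubmodule.toSubmodule ⊔ ⨆ α : LieModule.Weight k HS S,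
      ⨆ (_ : α.IsNonZero), (LieAlgebra.rootSpace HS α).toSubmodule ≤ T.comap φ.toLinearMap from h hs
  refine sup_le (fun y hy => Submodule.mem_sup_left ((E.mem_iff y).mp hy))
    (iSup₂_le fun α hα y hy => ?_)
  by_cases hy0 : y = 0
  · rw [hy0]; exact Submodule.zero_mem _
  refine Submodule.mem_sup_right (Submodule.subset_span ⟨E.map_mem y, ?_, ?_⟩)
  · exact fun h => hy0 (E.injective (h.trans (map_zero φ).symm))
  · obtain ⟨δ, hδ, h2⟩ := E.forall_lie_eq hHG (s := y) (a := α)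
      (fun h => LieAlgebra.IsKilling.lie_eq_smul_of_mem_rootSpace hy h)
    refine ⟨δ, fun h => hα ?_, hδ⟩
    funext t
    rw [← h2 t ((E.mem_iff _).mp t.2) hy0, h]
    rfl

/-- The weight of `HS` on `S` given by a root vector of `G`. -/
lemma exists_weight (hHG : H ≤ G) {x : g} (hx : x ∈ G) (hx0 : x ≠ 0) {α : Module.Dual k H}
    (hα : α ≠ 0) (h : ∀ y : H, ⁅(y : g), x⁆ = α y • x) :
    ∃ w : HS.root, ∃ s, φ s = x ∧ s ∈ LieAlgebra.rootSpace HS w.1 ∧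
      ∀ y : HS, w.1 y = α ⟨φ y, (E.mem_iff y).mp y.2⟩ := by
  obtain ⟨y₀, hy₀⟩ : ∃ y, α y ≠ 0 := by
    by_contra! hcon
    exact hα (LinearMap.ext hcon)
  obtain ⟨s, rfl⟩ := E.exists_eq_map hHG hx y₀.2 hy₀ (h y₀)
  have hs0 : s ≠ 0 := by rintro rfl; exact hx0 (map_zero φ)
  let a : HS → k := fun y => α ⟨φ y, (E.mem_iff y).mp y.2⟩
  have hs : ∀ y : HS, ⁅(y : S), s⁆ = a y • s := fun y => E.injective (by
    rw [LieHom.map_lie, map_smul]; exact h ⟨φ y, (E.mem_iff y).mp y.2⟩)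
  have hmem : s ∈ LieAlgebra.rootSpace HS a := by
    apply LieModule.weightSpace_le_genWeightSpace
    rw [LieModule.mem_weightSpace]
    exact hs
  have hne : LieAlgebra.rootSpace HS a ≠ ⊥ := fun hb => hs0 (by
    rw [hb] at hmem; exact hmem)
  -- The central component of `y₀` kills `x`, so the nonzero eigenvalue is produced by the component
  -- in the semisimple part.
  have ha : ∃ y, a y ≠ 0 := by
    obtain ⟨z, hz, hz0, t, ht, e⟩ := E.exists_add_of_mem y₀.2 hHG
    refine ⟨⟨t, ht⟩, fun h0 => hy₀ ?_⟩
    have h1 := h y₀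
    rw [e, add_lie, hz0 _ hx, zero_add] at h1
    have h2 := h ⟨φ t, (E.mem_iff t).mp ht⟩
    have h3 : α ⟨φ t, (E.mem_iff t).mp ht⟩ = 0 := h0
    rw [h3, zero_smul] at h2
    rw [h2] at h1
    exact (smul_eq_zero.mp h1.symm).resolve_right hx0
  refine ⟨⟨⟨a, hne⟩, ?_⟩, s, rfl, hmem, fun y => rfl⟩
  simp only [LieSubalgebra.root, Finset.mem_filter, Finset.mem_univ, true_and]
  intro h0
  obtain ⟨y, hy⟩ := ha
  exact hy (congrFun h0 y)

/-- Both vectors come from one root space of the semisimple part, which is one dimensional. -/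
lemma mem_span_singleton (hHG : H ≤ G) {x y : g} (hx : x ∈ G) (hx0 : x ≠ 0) (hy : y ∈ G)
    {α : Module.Dual k H} (hα : α ≠ 0) (h : ∀ t : H, ⁅(t : g), x⁆ = α t • x)
    (h' : ∀ t : H, ⁅(t : g), y⁆ = α t • y) : y ∈ Submodule.span k {x} := by
  by_cases hy0 : y = 0
  · rw [hy0]; exact Submodule.zero_mem _
  obtain ⟨w, s, rfl, hs, hw⟩ := E.exists_weight hHG hx hx0 hα h
  obtain ⟨w', s', rfl, hs', hw'⟩ := E.exists_weight hHG hy hy0 hα h'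
  have hww : w.1 = w'.1 := by ext t; exact (hw t).trans (hw' t).symm
  rw [← hww] at hs'
  have h1 := LieAlgebra.IsKilling.finrank_rootSpace_eq_one w.1 (LieSubalgebra.isNonZero_coe_root w)
  have hs0 : (⟨s, hs⟩ : LieAlgebra.rootSpace HS w.1) ≠ 0 := by
    intro h0
    exact hx0 (by rw [show s = 0 from congrArg Subtype.val h0, map_zero])
  obtain ⟨c, hc⟩ := (finrank_eq_one_iff_of_nonzero' _ hs0).mp h1 ⟨s', hs'⟩
  refine Submodule.mem_span_singleton.mpr ⟨c, ?_⟩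
  rw [← map_smul]
  exact congrArg φ (congrArg Subtype.val hc)

end IsSemisimplePart
end LieAlgebras

/-! ### Root spaces and coroots of a root-reductive Lie algebra. -/

section LieAlgebras

variable {k : Type u} [Field k] [CharZero k] [IsAlgClosed k] {g : Type u} [LieRing g]
  [LieAlgebra k g]

namespace IsSemisimplePart
variable {G H : LieSubalgebra k g} {S : Type u} [LieRing S] [LieAlgebra k S]
  {HS : LieSubalgebra k S} {φ : S →ₗ⁅k⁆ g} [FiniteDimensional k S] [LieAlgebra.IsKilling k S]
  [HS.IsCartanSubalgebra] (E : IsSemisimplePart G H HS φ)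
include E

/-- If the bracket vanished, `t` would be a primitive vector of negative weight `m` for the `sl₂` of
the root `w`, while primitive weights in a finite dimensional module are natural numbers. -/
lemma lie_ne_zero {s t : S} {w v : HS.root} (hs : s ∈ LieAlgebra.rootSpace HS w.1)
    (hs0 : s ≠ 0) (ht : t ∈ LieAlgebra.rootSpace HS v.1) (ht0 : t ≠ 0) {m : ℤ} (hm : m < 0)
    (h : v.1 (LieAlgebra.IsKilling.coroot w.1) = m) : ⁅s, t⁆ ≠ 0 := by
  have hw := LieSubalgebra.isNonZero_coe_root w
  obtain ⟨h₀, e, f, ht3, he, hf⟩ :=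
    LieAlgebra.IsKilling.exists_isSl2Triple_of_weight_isNonZero hw
  have hh : h₀ = _ := ht3.h_eq_coroot hw he hf
  intro hst
  have h1 := LieAlgebra.IsKilling.finrank_rootSpace_eq_one w.1 hw
  have hs0' : (⟨s, hs⟩ : LieAlgebra.rootSpace HS w.1) ≠ 0 := fun h0 =>
    hs0 (congrArg Subtype.val h0)
  obtain ⟨c, hc⟩ := (finrank_eq_one_iff_of_nonzero' _ hs0').mp h1 ⟨e, he⟩
  have hc : c • s = e := congrArg Subtype.val hc
  have P : ht3.HasPrimitiveVectorWith t (m : k) :=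
    { ne_zero := ht0
      lie_h := by
        rw [hh, ← h]
        exact LieAlgebra.IsKilling.lie_eq_smul_of_mem_rootSpace ht _
      lie_e := by rw [← hc, smul_lie, hst, smul_zero] }
  obtain ⟨n, hn⟩ := P.exists_nat
  have : m = n := by exact_mod_cast hn
  lia

end IsSemisimplePart

variable {h : LieSubalgebra k g}

omit [CharZero k] [IsAlgClosed k] in
lemma lie_mem_rootSpace_add {α β : Module.Dual k h} {x y : g} (hx : x ∈ rootSpace h α)
    (hy : y ∈ rootSpace h β) : ⁅x, y⁆ ∈ rootSpace h (α + β) := by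
  intro H
  rw [leibniz_lie, hx H, hy H, smul_lie, lie_smul, LinearMap.add_apply, add_smul]

namespace IsRootReductiveExhaustion

variable {gn hn : ℕ → LieSubalgebra k g} (E : IsRootReductiveExhaustion gn hn)
  (hh : ∀ x : g, x ∈ h ↔ ∃ n, x ∈ hn n)

include E

omit [CharZero k] [IsAlgClosed k] in
lemma gn_mono : Monotone gn := monotone_nat_of_le_succ E.le_succ

omit [CharZero k] [IsAlgClosed k] in
lemma hn_mono : Monotone hn := monotone_nat_of_le_succ E.cartan_le_succ

omit [CharZero k] [IsAlgClosed k] in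
lemma isRootVector_of_le {n m : ℕ} (hnm : n ≤ m) {x : g} (hx : x ∈ gn n)
    (h : IsRootVector (hn n) x) : IsRootVector (hn m) x := by
  induction m, hnm using Nat.le_induction with
  | base => exact h
  | succ m hm ih => exact E.rootVector_succ m x (E.gn_mono hm hx) ih

include hh

-- A root vector at one level stays a root vector at all later levels. Its eigenvalues there fit
-- together to a linear form on the union of the Cartan subalgebras.
omit [CharZero k] [IsAlgClosed k] in
lemma exists_mem_rootSpace {n : ℕ} {x : g} (hx : x ∈ gn n) (h1 : IsRootVector (hn n) x) :
    ∃ α ∈ roots h, x ∈ rootSpace h α := by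
  have hx0 := h1.1
  have h2 : ∀ H : h, ∃ c : k, ⁅(H : g), x⁆ = c • x := by
    intro H
    obtain ⟨m, hm⟩ := (hh H).mp H.2
    obtain ⟨-, α, -, hα⟩ := E.isRootVector_of_le (le_max_left n m) hx h1
    exact ⟨_, hα ⟨H, E.hn_mono (le_max_right n m) hm⟩⟩
  choose c hc using h2
  have inj : ∀ {c d : k}, c • x = d • x → c = d := fun h => smul_left_injective k hx0 h
  let α : Module.Dual k h :=
    { toFun := c
      map_add' := fun y z => inj (by rw [← hc, add_smul, ← hc, ← hc, ← add_lie]; rfl)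
      map_smul' := fun r y => inj (by
        rw [← hc, RingHom.id_apply, smul_assoc, ← hc, ← smul_lie]; rfl) }
  have hα : x ∈ rootSpace h α := hc
  refine ⟨α, ⟨fun h0 => ?_, fun hb => hx0 (by rw [hb] at hα; exact hα)⟩, hα⟩
  obtain ⟨-, β, hβ, hβx⟩ := h1
  refine hβ (LinearMap.ext fun y => ?_)
  have : c ⟨y, (hh _).mpr ⟨n, y.2⟩⟩ = 0 := DFunLike.congr_fun h0 _
  refine inj ?_
  rw [← hβx, LinearMap.zero_apply, ← this]
  exact hc ⟨y, (hh _).mpr ⟨n, y.2⟩⟩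

omit [CharZero k] [IsAlgClosed k] in
lemma exists_restrict_ne_zero {α : Module.Dual k h} (hα : α ≠ 0) : ∃ n, ∀ m, n ≤ m →
    ∃ y : h, (y : g) ∈ hn m ∧ α y ≠ 0 := by
  obtain ⟨y, hy⟩ : ∃ y, α y ≠ 0 := by
    by_contra! hcon
    exact hα (LinearMap.ext hcon)
  obtain ⟨n, hn'⟩ := (hh y).mp y.2
  exact ⟨n, fun m hm => ⟨y, E.hn_mono hm hn', hy⟩⟩

end IsRootReductiveExhaustion

namespace IsRootReductive

variable (hg : IsRootReductive h)
include hg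

lemma lie_eq_zero {x y : g} (hx : x ∈ h) (hy : y ∈ h) : ⁅x, y⁆ = 0 := by
  obtain ⟨gn, hn, E, hh⟩ := hg
  obtain ⟨n, hn'⟩ := (hh x).mp hx
  obtain ⟨m, hm⟩ := (hh y).mp hy
  obtain ⟨S, _, _, HS, _, _, _, φ, P⟩ := E.exists_isSemisimplePart (max n m)
  exact P.lie_eq_zero (E.cartan_le _) (E.hn_mono (le_max_left _ _) hn')
    (E.hn_mono (le_max_right _ _) hm)

lemma sup_iSup_rootSpace : h.toSubmodule ⊔ ⨆ α ∈ roots h, rootSpace h α = ⊤ := by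
  obtain ⟨gn, hn, E, hh⟩ := hg
  rw [eq_top_iff]
  rintro x -
  obtain ⟨n, hx⟩ := E.exhausts x
  obtain ⟨S, _, _, HS, _, _, _, φ, P⟩ := E.exists_isSemisimplePart n
  refine sup_le (α := Submodule k g) ?_ ?_ (P.mem_sup_span (E.cartan_le n) hx)
  · exact fun y hy => Submodule.mem_sup_left ((hh y).mpr ⟨n, hy⟩)
  · rw [Submodule.span_le]
    rintro v ⟨hv, hv'⟩
    obtain ⟨α, hα, hvα⟩ := E.exists_mem_rootSpace hh hv hv'
    exact Submodule.mem_sup_right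
      (Submodule.mem_iSup_of_mem α (Submodule.mem_iSup_of_mem hα hvα))

lemma mem_span_singleton {α : Module.Dual k h} (hα : α ≠ 0) {x y : g} (hx : x ∈ rootSpace h α)
    (hx0 : x ≠ 0) (hy : y ∈ rootSpace h α) : y ∈ Submodule.span k {x} := by
  obtain ⟨gn, hn, E, hh⟩ := hg
  obtain ⟨n₁, h₁⟩ := E.exhausts x
  obtain ⟨n₂, h₂⟩ := E.exhausts y
  obtain ⟨n₃, h₃⟩ := E.exists_restrict_ne_zero hh hα
  set n := max (max n₁ n₂) n₃
  obtain ⟨S, _, _, HS, _, _, _, φ, P⟩ := E.exists_isSemisimplePart n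
  have hle : hn n ≤ h := fun y hy => (hh y).mpr ⟨n, hy⟩
  obtain ⟨t, ht, ht0⟩ := h₃ n (le_max_right _ _)
  refine P.mem_span_singleton (E.cartan_le n) (E.gn_mono (by simp [n]) h₁) hx0
    (E.gn_mono (by simp [n]) h₂) (α := α ∘ₗ (LieSubalgebra.inclusion hle : hn n →ₗ[k] h)) ?_
    (fun t => hx ⟨t, hle t.2⟩) (fun t => hy ⟨t, hle t.2⟩)
  exact fun h0 => ht0 (DFunLike.congr_fun h0 ⟨t, ht⟩)

/-- A finite set of roots spans a finite root system in the following sense. -/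
lemma exists_coroots (R : Set (Module.Dual k h)) (hR : R.Finite) (hRr : R ⊆ roots h) (H₀ : h) :
    ∃ (J : Type u) (_ : Fintype J) (c : J → h), (∀ α ∈ R, ∀ j, ∃ m : ℤ, α (c j) = m) ∧
      (∀ v ∈ Submodule.span k R, (∀ j, v (c j) = 0) → v H₀ = 0) ∧
      ∀ α ∈ R, ∀ β ∈ R, ∀ m : ℤ, m < 0 → ∑ j, α (c j) * β (c j) = m →
        α + β = 0 ∨ α + β ∈ roots h := by
  obtain ⟨gn, hn, E, hh⟩ := hg
  have h1 : ∀ α ∈ R, ∃ n, ∃ x ∈ rootSpace h α, x ≠ 0 ∧ ∀ m, n ≤ m → x ∈ gn m ∧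
      ∃ y : h, (y : g) ∈ hn m ∧ α y ≠ 0 := by
    intro α hα
    obtain ⟨x, hx, hx0⟩ := (Submodule.ne_bot_iff _).mp (hRr hα).2
    obtain ⟨n₁, h₁⟩ := E.exhausts x
    obtain ⟨n₃, h₃⟩ := E.exists_restrict_ne_zero hh (hRr hα).1
    exact ⟨max n₁ n₃, x, hx, hx0, fun m hm => ⟨E.gn_mono ((le_max_left _ _).trans hm) h₁,
      h₃ m ((le_max_right _ _).trans hm)⟩⟩
  choose! N x hx hx0 hm using h1
  obtain ⟨n₀, hn₀⟩ := (hh H₀).mp H₀.2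
  obtain ⟨n₁, hn₁⟩ := (hR.image N).bddAbove
  -- One level contains `H₀` and a root vector for every root in `R`, and is so large that no root
  -- in `R` vanishes on its Cartan subalgebra.
  set n := max n₀ n₁
  have hmn := fun α (hα : α ∈ R) => hm α hα n ((hn₁ ⟨α, hα, rfl⟩).trans (le_max_right _ _))
  obtain ⟨S, _, _, HS, _, _, _, φ, P⟩ := E.exists_isSemisimplePart n
  have hle : hn n ≤ h := fun y hy => (hh y).mpr ⟨n, hy⟩
  have hHS : ∀ t : HS, φ t ∈ h := fun t => hle ((P.mem_iff t).mp t.2)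
  have h2 : ∀ α ∈ R, ∃ w : HS.root, ∃ s, φ s = x α ∧ s ∈ LieAlgebra.rootSpace HS w.1 ∧
      ∀ y : HS, w.1 y = α ⟨φ y, hHS y⟩ := by
    intro α hα
    obtain ⟨hxn, t, ht, ht0⟩ := hmn α hα
    exact P.exists_weight (E.cartan_le n) hxn (hx0 α hα)
      (α := α ∘ₗ (LieSubalgebra.inclusion hle : hn n →ₗ[k] h))
      (fun h0 => ht0 (DFunLike.congr_fun h0 ⟨t, ht⟩)) (fun t => hx α hα ⟨t, hle t.2⟩)
  choose w s hs hsw hw using h2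
  have hs0 : ∀ α (hα : α ∈ R), s α hα ≠ 0 := fun α hα h0 => hx0 α hα (by rw [← hs α hα, h0, map_zero])
  let Q := LieAlgebra.IsKilling.rootSystem HS
  -- All coroots of the semisimple part are used, so that the sum of the products `α (c j) * β (c
  -- j)` is the canonical invariant form of its root system.
  let c : HS.root → h := fun j => ⟨φ (LieAlgebra.IsKilling.coroot j.1 : HS), hHS _⟩
  have hc : ∀ α (hα : α ∈ R) (j : HS.root), α (c j) = Q.pairing (w α hα) j := by
    intro α hα j
    rw [← hw α hα]
    rfl
  have hcZ : ∀ α (hα : α ∈ R) (j : HS.root), α (c j) = Q.pairingIn ℤ (w α hα) j := by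
    intro α hα j
    rw [hc α hα]
    exact (Q.algebraMap_pairingIn ℤ _ _).symm
  refine ⟨HS.root, inferInstance, c, fun α hα j => ⟨_, hcZ α hα j⟩, ?_, ?_⟩
  · intro v hv hv0
    obtain ⟨z, hz, hz0, t, ht, e⟩ :=
      P.exists_add_of_mem (E.hn_mono (le_max_left n₀ n₁) hn₀) (E.cartan_le n)
    -- The central component of `H₀` commutes with the chosen root vectors, so every root in `R`
    -- vanishes on it.
    have hvz : v ⟨z, hle hz⟩ = 0 := by
      refine Submodule.span_induction (p := fun v _ => v ⟨z, hle hz⟩ = 0) ?_ rfl ?_ ?_ hv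
      · intro α hα
        have h3 := hx α hα ⟨z, hle hz⟩
        rw [hz0 _ (hmn α hα).1] at h3
        exact (smul_eq_zero.mp h3.symm).resolve_right (hx0 α hα)
      · intro a b _ _ ha hb
        rw [LinearMap.add_apply, ha, hb, add_zero]
      · intro r a _ ha
        rw [LinearMap.smul_apply, ha, smul_zero]
    let ψ : HS →ₗ[k] h :=
      { toFun := fun t => ⟨φ t, hHS t⟩
        map_add' := fun a b => Subtype.ext (map_add φ _ _)
        map_smul' := fun a b => Subtype.ext (map_smul φ _ _) }
    have h4 : v ∘ₗ ψ = 0 := by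
      refine LinearMap.ext_on (s := Set.range Q.coroot)
        (RootPairing.IsRootSystem.span_coroot_eq_top (P := Q)) ?_
      rintro _ ⟨j, rfl⟩
      exact hv0 j
    have h5 : H₀ = ⟨z, hle hz⟩ + ψ ⟨t, ht⟩ := Subtype.ext e
    rw [h5, map_add, hvz, zero_add]
    exact DFunLike.congr_fun h4 _
  · intro α hα β hβ m hm0 hsum
    -- Twice the form at `β` and `α` is the Cartan integer times the positive norm of `α`, so the
    -- Cartan integer inherits the negative sign.
    have hp : Q.pairingIn ℤ (w β hβ) (w α hα) < 0 := by
      obtain ⟨q, hq0, hq⟩ := (Q.posRootForm ℤ).exists_pos_eq (w α hα)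
      have h3 := (Q.posRootForm ℤ).two_mul_apply_root_root (w β hβ) (w α hα)
      rw [← hq, ← Q.algebraMap_pairingIn ℤ] at h3
      have h4 : (Q.posRootForm ℤ).form (Q.root (w β hβ)) (Q.root (w α hα)) = m := by
        rw [← hsum]
        refine (Q.rootForm_apply_apply _ _).trans (Finset.sum_congr rfl fun j _ => ?_)
        rw [hc α hα, hc β hβ, mul_comm]
        rfl
      rw [h4] at h3
      have h5 : 2 * m = Q.pairingIn ℤ (w β hβ) (w α hα) * q := by
        simp only [algebraMap_int_eq, eq_intCast] at h3
        exact_mod_cast h3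
      by_contra! hp
      have := mul_nonneg hp hq0.le
      lia
    by_cases h0 : α + β = 0
    · exact Or.inl h0
    refine Or.inr ⟨h0, (Submodule.ne_bot_iff _).mpr
      ⟨_, lie_mem_rootSpace_add (hx α hα) (hx β hβ), ?_⟩⟩
    rw [← hs α hα, ← hs β hβ, ← LieHom.map_lie]
    intro h6
    refine P.lie_ne_zero (hsw α hα) (hs0 α hα) (hsw β hβ) (hs0 β hβ) hp ?_
      (P.injective (h6.trans (map_zero φ).symm))
    exact (Q.algebraMap_pairingIn ℤ (w β hβ) (w α hα)).symm

end IsRootReductive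
end LieAlgebras

/-! ### Independence of simple roots and finiteness of decompositions. -/

section PositiveRoots

variable {k : Type u} [Field k] [CharZero k] [IsAlgClosed k] {g : Type u} [LieRing g]
  [LieAlgebra k g] {h : LieSubalgebra k g} {Φp : Set (Module.Dual k h)}

lemma IsPositiveSystem.mem_roots (hΦ : IsPositiveSystem h Φp) {α : Module.Dual k h}
    (hα : α ∈ Φp) : α ∈ roots h := (hΦ.mem_roots_iff α).mpr (Or.inl hα)

lemma IsPositiveSystem.neg_mem_roots (hΦ : IsPositiveSystem h Φp) {α : Module.Dual k h}
    (hα : α ∈ Φp) : -α ∈ roots h := (hΦ.mem_roots_iff _).mpr (Or.inr (by rwa [neg_neg]))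

/-- Evaluations `n` of the elements of a finite set of roots at coroots. -/
lemma IsRootReductive.exists_int_coroots (hg : IsRootReductive h) (R : Set (Module.Dual k h))
    (hR : R.Finite) (hRr : R ⊆ roots h) (H₀ : h) :
    ∃ (J : Type u) (_ : Fintype J) (n : J → AddSubgroup.closure R →+ ℤ),
      (∀ v, (∀ j, n j v = 0) → v.1 H₀ = 0) ∧
      ∀ α (hα : α ∈ R) β (hβ : β ∈ R),
        ∑ j, n j ⟨α, AddSubgroup.subset_closure hα⟩ * n j ⟨β, AddSubgroup.subset_closure hβ⟩ < 0 →
          α + β = 0 ∨ α + β ∈ roots h := by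
  obtain ⟨J, _, c, h1, h2, h3⟩ := hg.exists_coroots R hR hRr H₀
  have h4 : ∀ (j : J) (v : AddSubgroup.closure R), ∃ m : ℤ, v.1 (c j) = (m : k) := by
    rintro j ⟨v, hv⟩
    refine AddSubgroup.closure_induction (p := fun v _ => ∃ m : ℤ, v (c j) = (m : k))
      (fun α hα => h1 α hα j) ⟨0, by simp⟩ ?_ ?_ hv
    · rintro a b _ _ ⟨m, hm⟩ ⟨n, hn⟩
      exact ⟨m + n, by rw [LinearMap.add_apply, hm, hn]; push_cast; rfl⟩
    · rintro a _ ⟨m, hm⟩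
      exact ⟨-m, by rw [LinearMap.neg_apply, hm]; push_cast; rfl⟩
  choose n hn using h4
  refine ⟨J, inferInstance, fun j => AddMonoidHom.mk' (n j) fun a b => ?_, ?_, ?_⟩
  · have : ((n j (a + b) : ℤ) : k) = (n j a + n j b : ℤ) := by
      push_cast
      rw [← hn, ← hn, ← hn]
      rfl
    exact_mod_cast this
  · intro v hv
    refine h2 v ?_ fun j => by rw [hn]; exact_mod_cast hv j
    have : AddSubgroup.closure R ≤ (Submodule.span k R).toAddSubgroup :=
      (AddSubgroup.closure_le _).mpr Submodule.subset_span
    exact this v.2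
  · intro α hα β hβ hlt
    refine h3 α hα β hβ _ hlt ?_
    push_cast
    refine Finset.sum_congr rfl fun j _ => ?_
    exact congrArg₂ (· * ·) (hn j ⟨α, AddSubgroup.subset_closure hα⟩)
      (hn j ⟨β, AddSubgroup.subset_closure hβ⟩)

lemma _root_.Multiset.exists_neg_of_sum_neg {s : Multiset ℤ} (hs : s.sum < 0) :
    ∃ x ∈ s, x < 0 := by
  by_contra! hcon
  exact absurd (Multiset.sum_nonneg hcon) (not_le.mpr hs)

lemma _root_.Multiset.sum_nonpos' {s : Multiset ℤ} (hs : ∀ x ∈ s, x ≤ 0) : s.sum ≤ 0 := by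
  simpa using Multiset.sum_le_card_nsmul s 0 hs

lemma sum_mul_multiset_sum {A J : Type*} [AddCommGroup A] [Fintype J] (n : J → A →+ ℤ)
    (s t : Multiset A) : ∑ j, n j s.sum * n j t.sum =
      (s.map fun a => (t.map fun b => ∑ j, n j a * n j b).sum).sum := by
  have h1 : ∀ a, (t.map fun b => ∑ j, n j a * n j b).sum = ∑ j, n j a * n j t.sum := by
    intro a
    induction t using Multiset.induction_on with
    | empty => simp
    | cons b t ih => simp [ih, mul_add, Finset.sum_add_distrib]
  simp only [h1]
  induction s using Multiset.induction_on with
  | empty => simp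
  | cons b s ih => simp [← ih, add_mul, Finset.sum_add_distrib]

variable (hg : IsRootReductive h) (hΦ : IsPositiveSystem h Φp)
include hg hΦ

/-- If β plus further positive roots were zero, pairing with β, whose norm is positive, would give a
summand δ with negative product. Then β + δ is a positive root, being nonzero because -δ is not
positive, and replacing β and δ by it gives a shorter relation. -/
lemma multiset_sum_ne_zero (s : Multiset (Module.Dual k h)) (hs : ∀ α ∈ s, α ∈ Φp)
    (hs0 : s ≠ 0) : s.sum ≠ 0 := by
  induction hn : s.card using Nat.strong_induction_on generalizing s with
  | _ N ih =>
    classical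
    intro hsum
    obtain ⟨β, hβs⟩ := Multiset.exists_mem_of_ne_zero hs0
    obtain ⟨t, rfl⟩ := Multiset.exists_cons_of_mem hβs
    have hβ := hs β (by simp)
    obtain ⟨H₀, hH₀⟩ : ∃ H₀, β H₀ ≠ 0 := by
      by_contra! hcon
      exact (hΦ.mem_roots hβ).1 (LinearMap.ext hcon)
    let R : Set (Module.Dual k h) := {α | α ∈ β ::ₘ t}
    have hR : R.Finite := (β ::ₘ t).finite_toSet
    obtain ⟨J, _, n, h1, h2⟩ :=
      hg.exists_int_coroots R hR (fun α hα => hΦ.mem_roots (hs α hα)) H₀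
    have hβR : β ∈ R := by simp [R]
    let b : AddSubgroup.closure R := ⟨β, AddSubgroup.subset_closure hβR⟩
    let f : AddSubgroup.closure R →+ ℤ := ∑ j, (n j b) • n j
    have hf : ∀ v, f v = ∑ j, n j b * n j v := fun v => by
      simp [f, AddMonoidHom.finsetSum_apply]
    have hpos : 0 < f b := by
      rw [hf]
      -- A zero norm would make `β` vanish on all coroots, hence at `H₀`, which was chosen with `β
      -- H₀ ≠ 0`.
      refine lt_of_le_of_ne (Finset.sum_nonneg fun j _ => mul_self_nonneg _) fun h0 => hH₀ ?_
      refine h1 b fun j => ?_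
      have := (Finset.sum_eq_zero_iff_of_nonneg fun j _ => mul_self_nonneg (n j b)).mp h0.symm j
        (Finset.mem_univ j)
      exact mul_self_eq_zero.mp this
    let t' : Multiset (AddSubgroup.closure R) :=
      t.pmap (fun α hα => ⟨α, AddSubgroup.subset_closure (Multiset.mem_cons_of_mem hα)⟩)
        fun _ h => h
    have ht' : t'.map (AddSubgroup.closure R).subtype = t := by
      rw [Multiset.map_pmap]
      exact (Multiset.pmap_eq_map _ _ _ _).trans (Multiset.map_id' _)
    have hsum' : b + t'.sum = 0 := by
      apply Subtype.ext
      rw [AddSubgroup.coe_add, ← AddSubgroup.coe_subtype, map_multiset_sum, ht']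
      simpa using hsum
    have hneg : (t'.map f).sum < 0 := by
      rw [← map_multiset_sum]
      have := congrArg f hsum'
      rw [map_add, map_zero] at this
      lia
    obtain ⟨_, hx, hx0⟩ := Multiset.exists_neg_of_sum_neg hneg
    obtain ⟨⟨δ, hδ'⟩, hδt, rfl⟩ := Multiset.mem_map.mp hx
    have hδ : δ ∈ t := by
      rw [← ht']
      exact Multiset.mem_map_of_mem (AddSubgroup.closure R).subtype hδt
    have hδΦ := hs δ (by simp [hδ])
    have hβδ : β + δ ∈ Φp := by
      rcases h2 β hβR δ (by simp [R, hδ]) (by rw [hf] at hx0; exact hx0) with h0 | h0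
      · exact absurd (by rwa [← eq_neg_of_add_eq_zero_left h0]) (hΦ.not_both δ hδΦ)
      · exact hΦ.add_mem β hβ δ hδΦ h0
    obtain ⟨t₂, rfl⟩ := Multiset.exists_cons_of_mem hδ
    refine ih (t₂.card + 1) (by rw [← hn]; simp) ((β + δ) ::ₘ t₂) ?_ (by simp) (by simp) ?_
    · intro α hα
      rcases Multiset.mem_cons.mp hα with rfl | hα
      · exact hβδ
      · exact hs α (by simp [hα])
    · rw [← hsum]; simp [add_assoc]

/-- Simple roots are linearly independent over `ℕ`. -/
lemma multiset_eq_of_sum_eq (s t : Multiset (Module.Dual k h)) (hs : ∀ α ∈ s, α ∈ simpleRoots Φp)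
    (ht : ∀ α ∈ t, α ∈ simpleRoots Φp) (hst : s.sum = t.sum) : s = t := by
  classical
  -- Cancel the common part of the two multisets.
  wlog hd : Disjoint s t generalizing s t
  · have h1 := this (s - t) (t - s) (fun α hα => hs α (Multiset.mem_of_le (Multiset.sub_le_self _ _) hα))
      (fun α hα => ht α (Multiset.mem_of_le (Multiset.sub_le_self _ _) hα)) ?_ ?_
    · have e1 := Multiset.sub_add_inter s t
      have e2 := Multiset.sub_add_inter t s
      rw [Multiset.inter_comm] at e2
      exact e1.symm.trans ((congrArg (· + s ∩ t) h1).trans e2)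
    · have e1 := congrArg Multiset.sum (Multiset.sub_add_inter s t)
      have e2 := congrArg Multiset.sum (Multiset.sub_add_inter t s)
      rw [Multiset.inter_comm] at e2
      rw [Multiset.sum_add] at e1 e2
      rw [← add_left_inj, e1, e2, hst]
    · rw [Multiset.disjoint_left]
      intro a ha hb
      rw [← Multiset.count_pos] at ha hb
      rw [Multiset.count_sub] at ha hb
      lia
  suffices hv : s.sum = 0 by
    have h1 : s = 0 := by
      by_contra h0
      exact multiset_sum_ne_zero hg hΦ s (fun α hα => (hs α hα).1) h0 hv
    have h2 : t = 0 := by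
      by_contra h0
      exact multiset_sum_ne_zero hg hΦ t (fun α hα => (ht α hα).1) h0 (hst ▸ hv)
    rw [h1, h2]
  refine LinearMap.ext fun H₀ => ?_
  -- The negatives of the elements of `t` are included because the criterion for sums of roots is
  -- applied to `α + (-β)`.
  let R : Set (Module.Dual k h) := {α | α ∈ s ∨ α ∈ t ∨ -α ∈ t}
  have hR : R.Finite := by
    have : R = {α | α ∈ s} ∪ {α | α ∈ t} ∪ {α | -α ∈ t} := by ext; simp [R, or_assoc]
    rw [this]
    refine (s.finite_toSet.union t.finite_toSet).union ?_
    exact t.finite_toSet.preimage neg_injective.injOn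
  obtain ⟨J, _, n, h1, h2⟩ := hg.exists_int_coroots R hR (by
    rintro α (hα | hα | hα)
    · exact hΦ.mem_roots (hs α hα).1
    · exact hΦ.mem_roots (ht α hα).1
    · rw [← neg_neg α]; exact hΦ.neg_mem_roots (ht _ hα).1) H₀
  let A := AddSubgroup.closure R
  let lift : ∀ u : Multiset (Module.Dual k h), (∀ α ∈ u, α ∈ R) → Multiset A := fun u hu =>
    u.pmap (fun α hα => ⟨α, AddSubgroup.subset_closure hα⟩) hu
  have hlift : ∀ u hu, (lift u hu).map A.subtype = u := fun u hu => by
    simp only [lift]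
    rw [Multiset.map_pmap]
    exact (Multiset.pmap_eq_map _ _ _ _).trans (Multiset.map_id' _)
  have hlift' : ∀ u hu (a : A), a ∈ lift u hu → a.1 ∈ u := fun u hu a ha => by
    rw [← hlift u hu]
    exact Multiset.mem_map_of_mem A.subtype ha
  have hsum : ∀ u hu, (lift u hu).sum.1 = u.sum := fun u hu => by
    rw [← AddSubgroup.coe_subtype, map_multiset_sum, hlift]
  let s' := lift s fun α hα => Or.inl hα
  let t' := lift t fun α hα => Or.inr (Or.inl hα)
  let v := s'.sum
  have hvt : v = t'.sum := Subtype.ext (by rw [hsum, hsum, hst])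
  -- The norm of the common sum expands into products of distinct simple roots. These are not
  -- positive: otherwise α - β would be a root, and α or β would be a sum of two positive roots.
  have hle : ∑ j, n j v * n j v ≤ 0 := by
    have e1 := sum_mul_multiset_sum n s' t'
    rw [← hvt] at e1
    rw [e1]
    refine Multiset.sum_nonpos' fun x hx => ?_
    obtain ⟨⟨α, hα'⟩, hα, rfl⟩ := Multiset.mem_map.mp hx
    refine Multiset.sum_nonpos' fun y hy => ?_
    obtain ⟨⟨β, hβ'⟩, hβ, rfl⟩ := Multiset.mem_map.mp hy
    replace hα : α ∈ s := hlift' _ _ _ hα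
    replace hβ : β ∈ t := hlift' _ _ _ hβ
    by_contra! hlt
    have hne : α ≠ β := by
      rintro rfl
      exact (Multiset.disjoint_left.mp hd) hα hβ
    have hβR : -β ∈ R := Or.inr (Or.inr (by rwa [neg_neg]))
    have e2 : (⟨-β, AddSubgroup.subset_closure hβR⟩ : A) = -⟨β, hβ'⟩ := rfl
    rcases h2 α (Or.inl hα) (-β) hβR (by
      simp only [e2, map_neg, mul_neg, Finset.sum_neg_distrib]
      exact neg_neg_of_pos hlt) with h0 | h0
    · exact hne (by rwa [← sub_eq_add_neg, sub_eq_zero] at h0)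
    · rcases (hΦ.mem_roots_iff _).mp h0 with h3 | h3
      · exact (hs α hα).2 ⟨α + -β, h3, β, (ht β hβ).1, by abel⟩
      · exact (ht β hβ).2 ⟨-(α + -β), h3, α, (hs α hα).1, by abel⟩
  rw [← hsum s fun α hα => Or.inl hα]
  refine h1 v fun j => ?_
  have := (Finset.sum_eq_zero_iff_of_nonneg fun j _ => mul_self_nonneg (n j v)).mp
    (le_antisymm hle (Finset.sum_nonneg fun j _ => mul_self_nonneg _)) j (Finset.mem_univ j)
  exact mul_self_eq_zero.mp this

/-- A weight is a sum of positive roots in finitely many ways only. -/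
lemma finite_lists_of_sum_eq (hD : IsDynkin Φp) (γ : Module.Dual k h) :
    {l : List (Module.Dual k h) | (∀ α ∈ l, α ∈ Φp) ∧ l.sum = γ}.Finite := by
  classical
  by_cases hγ : γ ∈ posCone Φp
  swap
  · convert Set.finite_empty
    ext l
    simp only [Set.mem_ofPred_eq, Set.mem_empty_iff_false, iff_false]
    rintro ⟨hl, rfl⟩
    exact hγ (AddSubmonoid.list_sum_mem _ fun α hα => AddSubmonoid.subset_closure (hl α hα))
  have key : ∀ δ ∈ posCone Φp, ∃ s : Multiset (Module.Dual k h),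
      (∀ α ∈ s, α ∈ simpleRoots Φp) ∧ s.sum = δ := fun δ hδ =>
    AddSubmonoid.exists_multiset_of_mem_closure (hD δ hδ)
  choose! m hm hms using key
  have hsub : ∀ α ∈ Φp, α ∈ posCone Φp := fun α hα => AddSubmonoid.subset_closure hα
  -- By uniqueness, the simple decompositions of the members of a list add up to the simple
  -- decomposition of its sum.
  have hlist : ∀ l : List (Module.Dual k h), (∀ α ∈ l, α ∈ Φp) → l.sum = γ →
      (l.map m).sum = m γ := by
    rintro l hl rfl
    refine multiset_eq_of_sum_eq hg hΦ _ _ ?_ (hm _ hγ) ?_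
    · intro α hα
      have : ∀ l : List (Module.Dual k h), (∀ α ∈ l, α ∈ Φp) → α ∈ (l.map m).sum →
          α ∈ simpleRoots Φp := by
        intro l
        induction l with
        | nil => simp
        | cons a l ih =>
          intro hl hα
          rw [List.map_cons, List.sum_cons, Multiset.mem_add] at hα
          rcases hα with hα | hα
          · exact hm a (hsub a (hl a (by simp))) α hα
          · exact ih (fun b hb => hl b (by simp [hb])) hα
      exact this l hl hα
    · rw [hms _ hγ]
      clear hγ
      induction l with
      | nil => simp
      | cons a l ih =>
        rw [List.map_cons, List.sum_cons, List.sum_cons, Multiset.sum_add,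
          ih (fun b hb => hl b (by simp [hb])), hms a (hsub a (hl a (by simp)))]
  -- The members of such a list are sums of submultisets of `m γ`. Each contributes at least one
  -- simple root, so the length is at most the cardinality of `m γ`.
  let T : Set (Module.Dual k h) := Multiset.sum '' {s | s ≤ m γ}
  have hT : T.Finite := by
    refine Set.Finite.image _ ?_
    exact (Multiset.finite_toSet (m γ).powerset).subset fun s hs => Multiset.mem_powerset.mpr hs
  have hle : ∀ l : List (Module.Dual k h), ∀ α ∈ l, m α ≤ (l.map m).sum := fun l α hα =>
    List.single_le_sum (fun _ _ => zero_le) _ (List.mem_map_of_mem hα)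
  have hlen : ∀ l : List (Module.Dual k h), (∀ α ∈ l, α ∈ Φp) →
      l.length ≤ (l.map m).sum.card := by
    intro l
    induction l with
    | nil => simp
    | cons a l ih =>
      intro hl
      have h0 : 0 < (m a).card := by
        rw [Multiset.card_pos]
        intro h0
        have h1 := hms a (hsub a (hl a (by simp)))
        rw [h0, Multiset.sum_zero] at h1
        exact (hΦ.mem_roots (hl a (by simp))).1 h1.symm
      have := ih fun b hb => hl b (by simp [hb])
      simp only [List.length_cons, List.map_cons, List.sum_cons, Multiset.card_add]
      lia
  have := hT.to_subtype
  refine ((List.finite_length_le T (m γ).card).image (List.map Subtype.val)).subset ?_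
  rintro l ⟨hl, hlγ⟩
  have hlT : ∀ α ∈ l, α ∈ T := fun α hα =>
    ⟨m α, (hle l α hα).trans (hlist l hl hlγ).le, hms α (hsub α (hl α hα))⟩
  lift l to List T using hlT
  refine ⟨l, ?_, rfl⟩
  have := hlen _ hl
  rwa [hlist _ hl hlγ, List.length_map] at this

end PositiveRoots

/-! ### Enveloping algebras, generation by the Lie algebra, and restriction. -/

section Enveloping

attribute [local instance 100] LieRing.ofAssociativeRing

open UniversalEnvelopingAlgebra TensorProduct

variable {k : Type u} [Field k] {g : Type u} [LieRing g] [LieAlgebra k g]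

/-- By the universal property the identity of the enveloping algebra factors through `A`. This
reduces statements about all of `U(g)` to elements of `g`. -/
lemma eq_top_of_forall_ι_mem (A : Subalgebra k (UniversalEnvelopingAlgebra k g))
    (hA : ∀ x : g, ι k x ∈ A) : A = ⊤ := by
  let f : g →ₗ⁅k⁆ A :=
    { toFun := fun x => ⟨ι k x, hA x⟩
      map_add' := fun x y => Subtype.ext (map_add (ι k) x y)
      map_smul' := fun c x => Subtype.ext (map_smul (ι k) c x)
      map_lie' := fun {x y} => Subtype.ext (LieHom.map_lie (ι k) x y) }
  have h : A.val.comp (lift k f) = AlgHom.id k _ := by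
    refine UniversalEnvelopingAlgebra.hom_ext k (LieHom.ext fun x => ?_)
    change ((lift k f (ι k x) : A) : UniversalEnvelopingAlgebra k g) = ι k x
    rw [lift_ι_apply]
    rfl
  rw [eq_top_iff]
  rintro u -
  have := DFunLike.congr_fun h u
  change ((lift k f u : A) : UniversalEnvelopingAlgebra k g) = u at this
  exact this ▸ (lift k f u).2

section Modules

variable {M : Type*} [AddCommGroup M] [Module k M] [Module (UniversalEnvelopingAlgebra k g) M]
  [IsScalarTower k (UniversalEnvelopingAlgebra k g) M]
  {N : Type*} [AddCommGroup N] [Module k N] [Module (UniversalEnvelopingAlgebra k g) N]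
  [IsScalarTower k (UniversalEnvelopingAlgebra k g) N]

lemma smul_mem_of_forall_ι_smul_mem (p : Submodule k M)
    (hp : ∀ (x : g), ∀ m ∈ p, ι k x • m ∈ p) (u : UniversalEnvelopingAlgebra k g) {m : M}
    (hm : m ∈ p) : u • m ∈ p := by
  let A : Subalgebra k (UniversalEnvelopingAlgebra k g) :=
    { carrier := {u | ∀ m ∈ p, u • m ∈ p}
      mul_mem' := fun {a b} ha hb m hm => by rw [mul_smul]; exact ha _ (hb _ hm)
      add_mem' := fun {a b} ha hb m hm => by rw [add_smul]; exact p.add_mem (ha _ hm) (hb _ hm)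
      algebraMap_mem' := fun c m hm => by rw [algebraMap_smul]; exact p.smul_mem c hm }
  have hA : A = ⊤ := eq_top_of_forall_ι_mem A hp
  exact (hA ▸ Algebra.mem_top : u ∈ A) m hm

/-- A subspace which is stable under `g` is a submodule. -/
def submoduleOfForall (p : Submodule k M) (hp : ∀ (x : g), ∀ m ∈ p, ι k x • m ∈ p) :
    Submodule (UniversalEnvelopingAlgebra k g) M where
  __ := p
  smul_mem' u _ hm := smul_mem_of_forall_ι_smul_mem p hp u hm

/-- A linear map which commutes with the action of `g` is a homomorphism of modules. -/
def homOfForall (f : M →ₗ[k] N) (hf : ∀ (x : g) m, f (ι k x • m) = ι k x • f m) :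
    M →ₗ[UniversalEnvelopingAlgebra k g] N where
  toFun := f
  map_add' := map_add f
  map_smul' u m := by
    let A : Subalgebra k (UniversalEnvelopingAlgebra k g) :=
      { carrier := {u | ∀ m, f (u • m) = u • f m}
        mul_mem' := fun {a b} ha hb m => by rw [mul_smul, ha, hb, mul_smul]
        add_mem' := fun {a b} ha hb m => by rw [add_smul, map_add, ha, hb, add_smul]
        algebraMap_mem' := fun c m => by rw [algebraMap_smul, map_smul, algebraMap_smul] }
    have hA : A = ⊤ := eq_top_of_forall_ι_mem A hf
    exact (hA ▸ Algebra.mem_top : u ∈ A) m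

end Modules

/-- The homomorphism of enveloping algebras induced by the inclusion of a subalgebra. -/
noncomputable def envelopingIncl (b : LieSubalgebra k g) :
    UniversalEnvelopingAlgebra k b →ₐ[k] UniversalEnvelopingAlgebra k g :=
  lift k ((ι k).comp b.incl)

@[simp] lemma envelopingIncl_ι (b : LieSubalgebra k g) (x : b) :
    envelopingIncl b (ι k x) = ι k (x : g) := lift_ι_apply k _ x

section Restriction

variable (b : LieSubalgebra k g) (M : Type*) [AddCommGroup M]
  [Module (UniversalEnvelopingAlgebra k g) M]

/-- The restriction of a `g`-module to a subalgebra. -/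
noncomputable instance restrictModule : Module (UniversalEnvelopingAlgebra k b) M :=
  Module.compHom M (envelopingIncl b).toRingHom

variable {M}

lemma restrict_smul_def (u : UniversalEnvelopingAlgebra k b) (m : M) :
    u • m = envelopingIncl b u • m := rfl

@[simp] lemma restrict_ι_smul (x : b) (m : M) : (ι k x) • m = ι k (x : g) • m := by
  rw [restrict_smul_def, envelopingIncl_ι]

instance restrict_isScalarTower [Module k M] [IsScalarTower k (UniversalEnvelopingAlgebra k g) M] :
    IsScalarTower k (UniversalEnvelopingAlgebra k b) M where
  smul_assoc c u m := by
    rw [restrict_smul_def, map_smul, smul_assoc, restrict_smul_def]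

variable {N : Type*} [AddCommGroup N] [Module (UniversalEnvelopingAlgebra k g) N]

/-- The restriction of a homomorphism of `g`-modules to a subalgebra. -/
def restrictHom (f : M →ₗ[UniversalEnvelopingAlgebra k g] N) :
    M →ₗ[UniversalEnvelopingAlgebra k b] N where
  toFun := f
  map_add' := map_add f
  map_smul' u m := map_smul f (envelopingIncl b u) m

end Restriction

/-! ### Induced modules for a decomposition into two subalgebras. -/

section Induction

variable {a b : LieSubalgebra k g} (hab : IsCompl a.toSubmodule b.toSubmodule)
variable (V : Type u) [AddCommGroup V] [Module k V] [Module (UniversalEnvelopingAlgebra k b) V]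
  [IsScalarTower k (UniversalEnvelopingAlgebra k b) V]

/-- The space underlying the induced module `U(g) ⊗_{U(b)} V`, for a decomposition `g = a ⊕ b`. -/
def Ind (_hab : IsCompl a.toSubmodule b.toSubmodule) (V : Type u) [AddCommGroup V] [Module k V] :
    Type u := UniversalEnvelopingAlgebra k a ⊗[k] V

namespace Ind

noncomputable instance : AddCommGroup (Ind hab V) :=
  inferInstanceAs (AddCommGroup (UniversalEnvelopingAlgebra k a ⊗[k] V))

noncomputable instance : Module k (Ind hab V) :=
  inferInstanceAs (Module k (UniversalEnvelopingAlgebra k a ⊗[k] V))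

/-- Left multiplication by elements of `U(a)` on the induced module. -/
noncomputable def leftMul : UniversalEnvelopingAlgebra k a →ₐ[k] Module.End k (Ind hab V) :=
  Algebra.lsmul k k (UniversalEnvelopingAlgebra k a ⊗[k] V)

variable {V}

/-- The pure tensors in the induced module. -/
noncomputable def tmul (u : UniversalEnvelopingAlgebra k a) (v : V) : Ind hab V := u ⊗ₜ[k] v

variable {hab}

lemma leftMul_tmul (u u' : UniversalEnvelopingAlgebra k a) (v : V) :
    leftMul hab V u (tmul hab u' v) = tmul hab (u * u') v := rfl

lemma induction_on {p : Submodule k (Ind hab V)} (h1 : ∀ v, tmul hab 1 v ∈ p)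
    (h2 : ∀ (y : a), ∀ w ∈ p, leftMul hab V (ι k y) w ∈ p) (w : Ind hab V) : w ∈ p := by
  let A : Subalgebra k (UniversalEnvelopingAlgebra k a) :=
    { carrier := {u | ∀ w ∈ p, leftMul hab V u w ∈ p}
      mul_mem' := fun {a b} ha hb m hm => by
        rw [map_mul]
        exact ha _ (hb _ hm)
      add_mem' := fun {a b} ha hb m hm => by
        rw [map_add]
        exact p.add_mem (ha _ hm) (hb _ hm)
      algebraMap_mem' := fun c m hm => by
        rw [AlgHom.commutes]
        exact p.smul_mem c hm }
  have hA : A = ⊤ := eq_top_of_forall_ι_mem A h2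
  have key : ∀ u (v : V), tmul hab u v ∈ p := fun u v => by
    have := (hA ▸ Algebra.mem_top : u ∈ A) _ (h1 v)
    rwa [leftMul_tmul, mul_one] at this
  exact TensorProduct.induction_on w p.zero_mem key fun _ _ => p.add_mem

variable (hab V)

/-- The action of `a` on `Hom(g, W)`, for `W` the induced module. -/
noncomputable def homAction : a →ₗ⁅k⁆ Module.End k (g →ₗ[k] Ind hab V) where
  toFun y :=
    -- The formula is forced by `x (y w) = y (x w) - [y, x] w`: it makes the map sending `w` to `x ↦
    -- x w` equivariant under `a`.
    { toFun := fun φ => leftMul hab V (ι k y) ∘ₗ φ - φ ∘ₗ LieAlgebra.ad k g y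
      map_add' := fun φ ψ => by rw [LinearMap.comp_add, LinearMap.add_comp, add_sub_add_comm]
      map_smul' := fun c φ => by
        rw [LinearMap.comp_smul, LinearMap.smul_comp, RingHom.id_apply, smul_sub] }
  map_add' x y := by
    ext φ z
    simp [add_sub_add_comm]
  map_smul' c x := by
    ext φ z
    simp [smul_sub]
  map_lie' := by
    intro x y
    ext φ z
    simp only [LieHom.map_lie, LieRing.of_associative_ring_bracket, LinearMap.coe_mk,
      AddHom.coe_mk, LinearMap.sub_apply, LinearMap.comp_apply, Module.End.mul_apply, map_sub,
      map_mul, LieAlgebra.ad_apply, LieSubalgebra.coe_bracket]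
    abel

variable {V}

lemma homAction_apply (y : a) (φ : g →ₗ[k] Ind hab V) (x : g) :
    homAction hab V y φ x = leftMul hab V (ι k y) (φ x) - φ ⁅(y : g), x⁆ := rfl

variable (V)

lemma tmul_add (u : UniversalEnvelopingAlgebra k a) (v w : V) :
    tmul hab u (v + w) = tmul hab u v + tmul hab u w := TensorProduct.tmul_add _ _ _

lemma add_tmul (u u' : UniversalEnvelopingAlgebra k a) (v : V) :
    tmul hab (u + u') v = tmul hab u v + tmul hab u' v := TensorProduct.add_tmul _ _ _

lemma tmul_smul (c : k) (u : UniversalEnvelopingAlgebra k a) (v : V) :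
    tmul hab u (c • v) = c • tmul hab u v := TensorProduct.tmul_smul _ _ _

lemma smul_tmul (c : k) (u : UniversalEnvelopingAlgebra k a) (v : V) :
    tmul hab (c • u) v = c • tmul hab u v := rfl

lemma zero_tmul (v : V) : tmul hab (0 : UniversalEnvelopingAlgebra k a) v = 0 :=
  TensorProduct.zero_tmul _ _

lemma tmul_zero (u : UniversalEnvelopingAlgebra k a) : tmul hab u (0 : V) = 0 :=
  TensorProduct.tmul_zero _ _

omit [Module (UniversalEnvelopingAlgebra k b) V] [IsScalarTower k (UniversalEnvelopingAlgebra k b) V] in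
lemma tmul_induction {p : Ind hab V → Prop} (w : Ind hab V) (h0 : p 0)
    (h1 : ∀ u v, p (tmul hab u v)) (h2 : ∀ w w', p w → p w' → p (w + w')) : p w :=
  TensorProduct.induction_on w h0 h1 h2

/-- The projection of `g` onto `a` along `b`. -/
noncomputable def projLeft (hab : IsCompl a.toSubmodule b.toSubmodule) : g →ₗ[k] a :=
  a.toSubmodule.projectionOnto b.toSubmodule hab

/-- The projection of `g` onto `b` along `a`. -/
noncomputable def projRight (hab : IsCompl a.toSubmodule b.toSubmodule) : g →ₗ[k] b :=
  b.toSubmodule.projectionOnto a.toSubmodule hab.symm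

lemma projLeft_left (y : a) : projLeft hab y = y := Submodule.projectionOnto_apply_left hab y

lemma projLeft_right (x : b) : projLeft hab x = 0 := Submodule.projectionOnto_apply_right hab x

lemma projRight_left (y : a) : projRight hab y = 0 :=
  Submodule.projectionOnto_apply_right hab.symm y

lemma projRight_right (x : b) : projRight hab x = x :=
  Submodule.projectionOnto_apply_left hab.symm x

/-- The action of `g` on the generators of the induced module. -/
noncomputable def unitAction : V →ₗ[k] g →ₗ[k] Ind hab V :=
  LinearMap.mk₂ k (fun v x =>
      tmul hab (ι k (projLeft hab x)) v + tmul hab 1 (ι k (projRight hab x) • v))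
    (fun v w x => by
      rw [smul_add, tmul_add, tmul_add, add_add_add_comm])
    (fun c v x => by
      rw [smul_comm, tmul_smul, tmul_smul, smul_add])
    (fun v x y => by
      rw [map_add, map_add, map_add, map_add, add_smul, tmul_add, add_tmul, add_add_add_comm])
    (fun c v x => by
      rw [map_smul, map_smul, map_smul, map_smul, smul_assoc, smul_tmul, tmul_smul, smul_add])

variable {V}

lemma unitAction_left (v : V) (y : a) : unitAction hab V v y = tmul hab (ι k y) v := by
  rw [unitAction, LinearMap.mk₂_apply, projLeft_left, projRight_left, map_zero, zero_smul,
    tmul_zero, add_zero]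

lemma unitAction_right (v : V) (x : b) : unitAction hab V v x = tmul hab 1 (ι k x • v) := by
  rw [unitAction, LinearMap.mk₂_apply, projLeft_right, projRight_right, map_zero, zero_tmul,
    zero_add]

variable (V)

/-- The action of `g` on the induced module, as a bilinear map. -/
noncomputable def actionAux : Ind hab V →ₗ[k] g →ₗ[k] Ind hab V :=
  -- By equivariance, the action is determined by its values on `1 ⊗ v`. The universal property of
  -- `U(a)` extends these values, so the action is obtained without the PBW theorem.
  TensorProduct.lift (((LinearMap.llcomp k V (g →ₗ[k] Ind hab V) (g →ₗ[k] Ind hab V)).flip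
    (unitAction hab V)) ∘ₗ (lift k (homAction hab V)).toLinearMap)

variable {V}

lemma actionAux_tmul (u : UniversalEnvelopingAlgebra k a) (v : V) :
    actionAux hab V (tmul hab u v) = lift k (homAction hab V) u (unitAction hab V v) := rfl

lemma actionAux_leftMul (y : a) (w : Ind hab V) (x : g) :
    actionAux hab V (leftMul hab V (ι k y) w) x =
      leftMul hab V (ι k y) (actionAux hab V w x) - actionAux hab V w ⁅(y : g), x⁆ := by
  rw [← homAction_apply]
  refine LinearMap.congr_fun ?_ x
  induction w using tmul_induction with
  | h0 => rw [map_zero, map_zero, map_zero]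
  | h1 u v =>
    refine (actionAux_tmul hab (ι k y * u) v).trans ?_
    rw [map_mul, lift_ι_apply]
    rfl
  | h2 x y hx hy => rw [map_add, map_add, hx, hy, map_add, map_add]

lemma actionAux_one (v : V) (x : g) : actionAux hab V (tmul hab 1 v) x = unitAction hab V v x := by
  rw [actionAux_tmul, map_one]
  rfl

lemma actionAux_left (y : a) (w : Ind hab V) :
    actionAux hab V w y = leftMul hab V (ι k y) w := by
  let p : Submodule k (Ind hab V) := 
    { carrier := {w | ∀ y : a, actionAux hab V w y = leftMul hab V (ι k y) w}
      add_mem' := fun {v w} hv hw y => by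
        rw [map_add, map_add, LinearMap.add_apply, hv, hw]
      zero_mem' := fun y => by rw [map_zero, map_zero]; rfl
      smul_mem' := fun c w hw y => by
        rw [map_smul, map_smul, LinearMap.smul_apply, hw] }
  refine induction_on (p := p) (fun v y => ?_) (fun z w hw y => ?_) w y
  · rw [actionAux_one, unitAction_left, leftMul_tmul, mul_one]
  · have := hw ⁅z, y⁆
    rw [LieSubalgebra.coe_bracket] at this
    rw [actionAux_leftMul, hw y, this, LieHom.map_lie, LieRing.of_associative_ring_bracket,
      map_sub, map_mul, map_mul, LinearMap.sub_apply, Module.End.mul_apply, Module.End.mul_apply]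
    abel

/-- When one argument lies in `a` the identity is built into the action; for two elements of `b` it
holds on the generators because `V` is a `b`-module. The Jacobi identity propagates it from the
generators by multiplication with `a`. -/
lemma actionAux_lie (w : Ind hab V) (x y : g) : actionAux hab V w ⁅x, y⁆ =
    actionAux hab V (actionAux hab V w y) x - actionAux hab V (actionAux hab V w x) y := by
  have h1 : ∀ w (x : a) (y : g), actionAux hab V w ⁅(x : g), y⁆ =
      actionAux hab V (actionAux hab V w y) x - actionAux hab V (actionAux hab V w x) y := by
    intro w x y
    rw [actionAux_left, actionAux_left, actionAux_leftMul]
    abel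
  let p : Submodule k (Ind hab V) := 
    { carrier := {w | ∀ x y : g, actionAux hab V w ⁅x, y⁆ =
        actionAux hab V (actionAux hab V w y) x - actionAux hab V (actionAux hab V w x) y}
      add_mem' := fun {v w} hv hw x y => by
        simp only [map_add, LinearMap.add_apply, hv x y, hw x y]
        abel
      zero_mem' := fun x y => by simp
      smul_mem' := fun c w hw x y => by
        simp only [map_smul, LinearMap.smul_apply, hw x y, smul_sub] }
  refine induction_on (p := p) (fun v x y => ?_) (fun z w hw x y => ?_) w x y
  · have hx : x ∈ a.toSubmodule ⊔ b.toSubmodule := by rw [hab.sup_eq_top]; trivial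
    have hy : y ∈ a.toSubmodule ⊔ b.toSubmodule := by rw [hab.sup_eq_top]; trivial
    obtain ⟨x₁, hx₁, x₂, hx₂, rfl⟩ := Submodule.mem_sup.mp hx
    obtain ⟨y₁, hy₁, y₂, hy₂, rfl⟩ := Submodule.mem_sup.mp hy
    have e1 := h1 (tmul hab 1 v) ⟨x₁, hx₁⟩ (y₁ + y₂)
    have e2 := h1 (tmul hab 1 v) ⟨y₁, hy₁⟩ x₂
    have e3 : actionAux hab V (tmul hab 1 v) ⁅x₂, y₂⁆ =
        actionAux hab V (actionAux hab V (tmul hab 1 v) y₂) x₂ -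
          actionAux hab V (actionAux hab V (tmul hab 1 v) x₂) y₂ := by
      have h2 : ∀ (x : b) v, actionAux hab V (tmul hab 1 v) (x : g) = tmul hab 1 (ι k x • v) :=
        fun x v => by rw [actionAux_one, unitAction_right]
      have h3 := h2 ⁅(⟨x₂, hx₂⟩ : b), (⟨y₂, hy₂⟩ : b)⁆ v
      rw [h2 ⟨x₂, hx₂⟩, h2 ⟨y₂, hy₂⟩, h2 ⟨x₂, hx₂⟩, h2 ⟨y₂, hy₂⟩]
      refine h3.trans ?_
      rw [LieHom.map_lie, LieRing.of_associative_ring_bracket, sub_smul, mul_smul, mul_smul]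
      exact map_sub (TensorProduct.mk k (UniversalEnvelopingAlgebra k a) V 1) _ _
    -- The remaining mixed term has its first entry in `b`; antisymmetry reduces it to the case with
    -- first entry in `a`.
    rw [← lie_skew, map_neg] at e2
    simp only [add_lie, lie_add, map_add, LinearMap.add_apply] at e1 e2 e3 ⊢
    linear_combination (norm := module) e1 - e2 + e3
  · have j : ⁅(z : g), ⁅x, y⁆⁆ = ⁅⁅(z : g), x⁆, y⁆ + ⁅x, ⁅(z : g), y⁆⁆ := by
      rw [← leibniz_lie]
    replace hw : ∀ x y : g, actionAux hab V w ⁅x, y⁆ =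
      actionAux hab V (actionAux hab V w y) x - actionAux hab V (actionAux hab V w x) y := hw
    simp only [actionAux_leftMul, j, map_add, hw, map_sub, LinearMap.sub_apply]
    abel

variable (V)

/-- The action of `g` on the induced module. -/
noncomputable def action : g →ₗ⁅k⁆ Module.End k (Ind hab V) where
  __ := (actionAux hab V).flip
  map_lie' {x y} := by
    ext w
    exact actionAux_lie hab w x y

noncomputable instance : Module (UniversalEnvelopingAlgebra k g) (Ind hab V) :=
  Module.compHom (Ind hab V) (lift k (action hab V)).toRingHom

lemma smul_def (u : UniversalEnvelopingAlgebra k g) (w : Ind hab V) :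
    u • w = lift k (action hab V) u w := rfl

instance : IsScalarTower k (UniversalEnvelopingAlgebra k g) (Ind hab V) where
  smul_assoc c u w := by
    rw [smul_def, smul_def, map_smul]
    rfl

variable {V}

lemma ι_smul (x : g) (w : Ind hab V) : ι k x • w = actionAux hab V w x := by
  rw [smul_def, lift_ι_apply]
  rfl

lemma ι_left_smul (y : a) (w : Ind hab V) : ι k (y : g) • w = leftMul hab V (ι k y) w := by
  rw [ι_smul, actionAux_left]

lemma left_smul (u : UniversalEnvelopingAlgebra k a) (w : Ind hab V) :
    u • w = leftMul hab V u w := by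
  have : Algebra.lsmul k k (Ind hab V) = leftMul hab V := by
    refine UniversalEnvelopingAlgebra.hom_ext k (LieHom.ext fun y => LinearMap.ext fun w => ?_)
    exact (restrict_ι_smul a y w).trans (ι_left_smul hab y w)
  exact LinearMap.congr_fun (DFunLike.congr_fun this u) w

variable (V) in
/-- The canonical linear map to the induced module. -/
noncomputable def unitLinear : V →ₗ[k] Ind hab V :=
  TensorProduct.mk k (UniversalEnvelopingAlgebra k a) V 1

variable (V) in
/-- The canonical map from a `b`-module to the induced module. -/
noncomputable def unit : V →ₗ[UniversalEnvelopingAlgebra k b] Ind hab V :=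
  homOfForall (unitLinear hab V) fun x v => by
    rw [restrict_ι_smul]
    refine Eq.trans ?_ (ι_smul hab (x : g) (tmul hab 1 v)).symm
    rw [actionAux_one, unitAction_right]
    rfl

lemma tmul_one (v : V) : tmul hab 1 v = unit hab V v := rfl

variable {hab}

/-- A subspace of the induced module which contains the generators and is stable under `a` is
everything. -/
lemma mem_of_forall {p : Submodule k (Ind hab V)} (h1 : ∀ v, unit hab V v ∈ p)
    (h2 : ∀ y ∈ a, ∀ w ∈ p, ι k y • w ∈ p) (w : Ind hab V) : w ∈ p :=
  induction_on h1 (fun y w hw => by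
    rw [← ι_left_smul]
    exact h2 y y.2 w hw) w

section Universal

variable {N : Type u} [AddCommGroup N] [Module k N] [Module (UniversalEnvelopingAlgebra k g) N]
  [IsScalarTower k (UniversalEnvelopingAlgebra k g) N]
  {N' : Type*} [AddCommGroup N'] [Module (UniversalEnvelopingAlgebra k g) N']

lemma hom_ext {f f' : Ind hab V →ₗ[UniversalEnvelopingAlgebra k g] N'}
    (h : ∀ v, f (unit hab V v) = f' (unit hab V v)) : f = f' := by
  let p : Submodule k (Ind hab V) :=
    (LinearMap.eqLocus f f').restrictScalars k
  refine LinearMap.ext fun w => ?_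
  refine mem_of_forall (p := p) h (fun y _ w hw => ?_) w
  change f (_ • w) = f' (_ • w)
  rw [map_smul, map_smul]
  exact congrArg _ hw

variable (hab) in
/-- The linear map underlying `Ind.lift`. -/
noncomputable def liftAux (f : V →ₗ[UniversalEnvelopingAlgebra k b] N) : Ind hab V →ₗ[k] N :=
  TensorProduct.lift ((LinearMap.lcomp k N (f.restrictScalars k)) ∘ₗ
    (Algebra.lsmul (A := UniversalEnvelopingAlgebra k a) k k N).toLinearMap)

lemma liftAux_tmul (f : V →ₗ[UniversalEnvelopingAlgebra k b] N)
    (u : UniversalEnvelopingAlgebra k a) (v : V) : liftAux hab f (tmul hab u v) = u • f v := rfl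

/-- Linearity over `a` holds by construction, and linearity over `b` on the generators is that of
`f`. Commuting an element of `g` past `a` extends this to the whole module. -/
lemma liftAux_ι_smul (f : V →ₗ[UniversalEnvelopingAlgebra k b] N) (x : g) (w : Ind hab V) :
    liftAux hab f (ι k x • w) = ι k x • liftAux hab f w := by
  have h1 : ∀ (y : a) w, liftAux hab f (ι k (y : g) • w) = ι k (y : g) • liftAux hab f w := by
    intro y w
    rw [ι_left_smul]
    induction w using tmul_induction with
    | h0 => rw [map_zero, map_zero, smul_zero]
    | h1 u v =>
      rw [leftMul_tmul, liftAux_tmul, liftAux_tmul, mul_smul, restrict_ι_smul]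
    | h2 w w' h h' => rw [map_add, map_add, h, h', map_add, smul_add]
  let p : Submodule k (Ind hab V) :=
    { carrier := {w | ∀ x : g, liftAux hab f (ι k x • w) = ι k x • liftAux hab f w}
      add_mem' := fun {v w} hv hw x => by
        rw [smul_add, map_add, map_add, smul_add, hv, hw]
      zero_mem' := fun x => by rw [smul_zero, map_zero, smul_zero]
      smul_mem' := fun c w hw x => by
        rw [smul_comm (ι k x) c w, map_smul, hw x, map_smul, smul_comm] }
  refine mem_of_forall (p := p) (fun v x => ?_) (fun y hy w hw x => ?_) w x
  · have hx : x ∈ a.toSubmodule ⊔ b.toSubmodule := by rw [hab.sup_eq_top]; trivial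
    obtain ⟨x₁, hx₁, x₂, hx₂, rfl⟩ := Submodule.mem_sup.mp hx
    have h2 : ι k x₂ • unit hab V v = unit hab V (ι k (⟨x₂, hx₂⟩ : b) • v) := by
      rw [map_smul, restrict_ι_smul]
    have h3 : ∀ v, liftAux hab f (unit hab V v) = f v := fun v => by
      rw [← tmul_one, liftAux_tmul, one_smul]
    rw [map_add, add_smul, add_smul, map_add, h1 ⟨x₁, hx₁⟩, h2, h3, h3, map_smul, restrict_ι_smul]
  · replace hw : ∀ x : g, liftAux hab f (ι k x • w) = ι k x • liftAux hab f w := hw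
    have e : ∀ {M : Type u} [AddCommGroup M] [Module (UniversalEnvelopingAlgebra k g) M] (m : M),
        ι k x • ι k y • m = ι k y • ι k x • m - ι k ⁅y, x⁆ • m := fun m => by
      rw [LieHom.map_lie, LieRing.of_associative_ring_bracket, sub_smul, mul_smul, mul_smul]
      abel
    rw [e, map_sub, h1 ⟨y, hy⟩, hw, hw, h1 ⟨y, hy⟩, e]

variable (hab) in
/-- The universal property of the induced module. -/
noncomputable def lift (f : V →ₗ[UniversalEnvelopingAlgebra k b] N) :
    Ind hab V →ₗ[UniversalEnvelopingAlgebra k g] N :=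
  homOfForall (liftAux hab f) (liftAux_ι_smul f)

@[simp] lemma lift_unit (f : V →ₗ[UniversalEnvelopingAlgebra k b] N) (v : V) :
    lift hab f (unit hab V v) = f v := by
  rw [← tmul_one]
  exact (liftAux_tmul f 1 v).trans (one_smul _ _)

variable {V' : Type u} [AddCommGroup V'] [Module k V'] [Module (UniversalEnvelopingAlgebra k b) V']
  [IsScalarTower k (UniversalEnvelopingAlgebra k b) V']
  {V'' : Type u} [AddCommGroup V''] [Module k V''] [Module (UniversalEnvelopingAlgebra k b) V'']
  [IsScalarTower k (UniversalEnvelopingAlgebra k b) V'']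

variable (hab) in
/-- Functoriality of induction. -/
noncomputable def map (f : V →ₗ[UniversalEnvelopingAlgebra k b] V') :
    Ind hab V →ₗ[UniversalEnvelopingAlgebra k g] Ind hab V' :=
  lift hab (unit hab V' ∘ₗ f)

@[simp] lemma map_unit (f : V →ₗ[UniversalEnvelopingAlgebra k b] V') (v : V) :
    map hab f (unit hab V v) = unit hab V' (f v) := lift_unit _ _

/-- On underlying spaces induction is tensoring with `U(a)` over a field, which is why it is exact.
-/
lemma map_eq_lTensor (f : V →ₗ[UniversalEnvelopingAlgebra k b] V') (w : Ind hab V) :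
    map hab f w = (f.restrictScalars k).lTensor (UniversalEnvelopingAlgebra k a) w := by
  induction w using tmul_induction with
  | h0 => rw [map_zero]; exact (map_zero _).symm
  | h1 u v =>
    refine (liftAux_tmul _ u v).trans ((left_smul _ _ _).trans ?_)
    refine (leftMul_tmul u 1 (f v)).trans ?_
    rw [mul_one]
    rfl
  | h2 w w' h h' => rw [map_add, h, h']; exact (map_add _ _ _).symm

lemma map_injective {f : V →ₗ[UniversalEnvelopingAlgebra k b] V'} (hf : Function.Injective f) :
    Function.Injective (map hab f) := by
  intro w w' h
  rw [map_eq_lTensor, map_eq_lTensor] at h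
  exact Module.Flat.lTensor_preserves_injective_linearMap (M := UniversalEnvelopingAlgebra k a)
    (f.restrictScalars k) hf h

lemma map_surjective {f : V →ₗ[UniversalEnvelopingAlgebra k b] V'} (hf : Function.Surjective f) :
    Function.Surjective (map hab f) := by
  intro w
  obtain ⟨v, hv⟩ := LinearMap.lTensor_surjective (UniversalEnvelopingAlgebra k a)
    (g := f.restrictScalars k) hf w
  exact ⟨v, (map_eq_lTensor f v).trans hv⟩

lemma map_exact {f : V →ₗ[UniversalEnvelopingAlgebra k b] V'}
    {f' : V' →ₗ[UniversalEnvelopingAlgebra k b] V''} (h : Function.Exact f f')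
    (hf' : Function.Surjective f') : Function.Exact (map hab f) (map hab f') := by
  have := lTensor_exact (UniversalEnvelopingAlgebra k a) (f := f.restrictScalars k)
    (g := f'.restrictScalars k) h hf'
  intro w
  have := this w
  rw [map_eq_lTensor]
  refine this.trans ?_
  simp only [Set.mem_range, map_eq_lTensor]
  rfl

end Universal

end Ind
end Induction
end Enveloping

open UniversalEnvelopingAlgebra

/-! ### Weight spaces and spanning families of weight vectors. -/

section Weights

variable {k : Type u} [Field k] {g : Type u} [LieRing g] [LieAlgebra k g] {h : LieSubalgebra k g}
variable {M : Type u} [AddCommGroup M] [Module k M] [Module (UniversalEnvelopingAlgebra k g) M]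
  [IsScalarTower k (UniversalEnvelopingAlgebra k g) M]

attribute [local instance 100] LieRing.ofAssociativeRing in
lemma ι_smul_ι_smul (x y : g) (m : M) : ι k x • ι k y • m = ι k ⁅x, y⁆ • m + ι k y • ι k x • m := by
  rw [LieHom.map_lie, LieRing.of_associative_ring_bracket, sub_smul, mul_smul, mul_smul]
  abel

lemma ι_smul_mem_weightSpace {α μ : Module.Dual k h} {x : g} (hx : x ∈ rootSpace h α) {m : M}
    (hm : m ∈ weightSpace h M μ) : ι k x • m ∈ weightSpace h M (μ + α) := by
  intro H
  rw [ι_smul_ι_smul, hx H, hm H, map_smul, smul_assoc, smul_comm (ι k x) (μ H) m, ← add_smul,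
    add_comm, LinearMap.add_apply]

/-- Independence of weight spaces leaves no room: subspaces of the weight spaces that together span
the module must fill each of them. -/
lemma weightSpace_eq_of_le (p : Module.Dual k h → Submodule k M)
    (hp : ∀ μ, p μ ≤ weightSpace h M μ) (hp' : ⨆ μ, p μ = ⊤) (μ : Module.Dual k h) :
    weightSpace h M μ = p μ := by
  classical
  refine le_antisymm (fun m hm => ?_) (hp μ)
  have hm' : m ∈ ⨆ μ, p μ := by rw [hp']; trivial
  obtain ⟨f, hf⟩ := (Submodule.mem_iSup_iff_exists_dfinsupp' _ m).mp hm'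
  -- Subtract `m` from the component at `μ` of its own decomposition. The resulting weight vectors
  -- sum to zero, so each of them vanishes.
  have h0 := mem_of_sum_mem (⊥ : Submodule (UniversalEnvelopingAlgebra k g) M)
    (fun ν => (f ν : M) - if ν = μ then m else 0) (insert μ f.support) (fun ν _ => by
      refine Submodule.sub_mem _ (hp ν (f ν).2) ?_
      split_ifs with e
      · rwa [e]
      · exact Submodule.zero_mem _) (by
      rw [Finset.sum_sub_distrib, Finset.sum_ite_eq' _ μ, if_pos (Finset.mem_insert_self _ _)]
      refine (Submodule.mem_bot _).mpr (sub_eq_zero.mpr ?_)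
      rw [← hf, DFinsupp.sum]
      refine (Finset.sum_subset (Finset.subset_insert _ _) fun ν _ hν => ?_).symm
      rw [DFinsupp.notMem_support_iff.mp hν]
      rfl) μ (Finset.mem_insert_self _ _)
  rw [Submodule.mem_bot, if_pos rfl, sub_eq_zero] at h0
  rw [← h0]
  exact (f μ).2

variable (h M) in
lemma iSupIndep_weightSpace : iSupIndep (weightSpace h M) := by
  classical
  refine iSupIndep_of_dfinsupp_lsum_injective _ ?_
  rw [injective_iff_map_eq_zero]
  intro f hf
  refine DFinsupp.ext fun μ => Subtype.ext ?_
  by_contra h0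
  have hμ : μ ∈ f.support := DFinsupp.mem_support_iff.mpr fun e => h0 (by rw [e]; rfl)
  refine h0 ((Submodule.mem_bot _).mp (mem_of_sum_mem
    (⊥ : Submodule (UniversalEnvelopingAlgebra k g) M) (fun ν => (f ν : M)) f.support
    (fun ν _ => (f ν).2) ?_ μ hμ))
  rw [DFinsupp.lsum_apply_apply, DFinsupp.sumAddHom_apply] at hf
  exact (Submodule.mem_bot _).mpr hf

section Spanning

variable {I : Type*} {v : I → M} {χ : I → Module.Dual k h}
  (hv : ∀ i, v i ∈ weightSpace h M (χ i)) (hs : ⊤ ≤ Submodule.span k (Set.range v))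
include hv hs

lemma iSup_span_weight : ⨆ μ, Submodule.span k (v '' {i | χ i = μ}) = ⊤ := by
  rw [eq_top_iff]
  refine hs.trans (Submodule.span_le.mpr ?_)
  rintro _ ⟨i, rfl⟩
  exact Submodule.mem_iSup_of_mem (χ i) (Submodule.subset_span ⟨i, rfl, rfl⟩)

lemma span_weight_le (μ : Module.Dual k h) :
    Submodule.span k (v '' {i | χ i = μ}) ≤ weightSpace h M μ := by
  refine Submodule.span_le.mpr ?_
  rintro _ ⟨i, rfl, rfl⟩
  exact hv i

lemma IsWeightModule.of_span : IsWeightModule h M := by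
  rw [IsWeightModule, eq_top_iff, ← iSup_span_weight hv hs]
  exact iSup_mono (span_weight_le hv hs)

lemma weightSpace_eq_span (μ : Module.Dual k h) :
    weightSpace h M μ = Submodule.span k (v '' {i | χ i = μ}) :=
  weightSpace_eq_of_le _ (span_weight_le hv hs) (iSup_span_weight hv hs) μ

lemma support_subset_range_of_span : support h M ⊆ Set.range χ := by
  intro μ hμ
  by_contra hn
  refine hμ ?_
  rw [weightSpace_eq_span hv hs, show {i | χ i = μ} = ∅ from ?_, Set.image_empty,
    Submodule.span_empty]
  ext i
  simp only [Set.mem_ofPred_eq, Set.mem_empty_iff_false, iff_false]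
  exact fun e => hn ⟨i, e⟩

lemma HasFiniteWeightSpaces.of_span (hχ : ∀ μ, {i | χ i = μ}.Finite) :
    HasFiniteWeightSpaces h M := by
  intro μ
  rw [weightSpace_eq_span hv hs]
  exact FiniteDimensional.span_of_finite k ((hχ μ).image v)

end Spanning

lemma IsWeightModule.exists_finite_span [FiniteDimensional k M] (hM : IsWeightModule h M) :
    ∃ (I : Type u) (_ : Finite I) (v : I → M) (χ : I → Module.Dual k h),
      (∀ i, v i ∈ weightSpace h M (χ i)) ∧ ⊤ ≤ Submodule.span k (Set.range v) := by
  obtain ⟨t, ht⟩ := (inferInstance : Module.Finite k M).fg_top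
  choose s v hv hs using hM.exists_sum
  refine ⟨Σ m : t, s m, inferInstance, fun i => v i.1 i.2, fun i => i.2, fun i => hv _ _, ?_⟩
  rw [← ht]
  refine Submodule.span_le.mpr fun m hm => ?_
  rw [SetLike.mem_coe, ← hs m]
  exact Submodule.sum_mem _ fun μ hμ => Submodule.subset_span ⟨⟨⟨m, hm⟩, μ, hμ⟩, rfl⟩

lemma IsWeightModule.span_eq_top (hM : IsWeightModule h M) : ⊤ ≤ Submodule.span k
    (Set.range fun i : Σ μ, weightSpace h M μ => (i.2 : M)) := by
  rw [← hM]
  exact iSup_le fun μ m hm => Submodule.subset_span ⟨⟨μ, m, hm⟩, rfl⟩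

end Weights

/-! ### Weights of modules over a subalgebra containing the Cartan subalgebra. -/

section Cartan

variable {k : Type u} [Field k] {g : Type u} [LieRing g] [LieAlgebra k g] (h b : LieSubalgebra k g)

/-- The intersection `h ∩ b`, as a subalgebra of `b`. -/
abbrev cartanIn : LieSubalgebra k b := h.comap b.incl

variable {h}

/-- Restriction of weights of `h` to `h ∩ b`. -/
def resWeight : Module.Dual k h →ₗ[k] Module.Dual k (cartanIn h b) where
  toFun μ :=
    { toFun := fun H => μ ⟨H.1, H.2⟩
      map_add' := fun H H' => map_add μ ⟨H.1, H.2⟩ ⟨H'.1, H'.2⟩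
      map_smul' := fun c H => map_smul μ c ⟨H.1, H.2⟩ }
  map_add' _ _ := rfl
  map_smul' _ _ := rfl

lemma resWeight_apply (μ : Module.Dual k h) (H : cartanIn h b) :
    resWeight b μ H = μ ⟨H.1, H.2⟩ := rfl

variable {b} (hb : h ≤ b)
include hb

lemma resWeight_bijective : Function.Bijective (resWeight (h := h) b) := by
  refine ⟨fun μ ν e => LinearMap.ext fun H => ?_, fun μ => ⟨?_, ?_⟩⟩
  · have := LinearMap.congr_fun e ⟨⟨H, hb H.2⟩, H.2⟩
    rwa [resWeight_apply, resWeight_apply] at this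
  · exact
      { toFun := fun H => μ ⟨⟨H, hb H.2⟩, H.2⟩
        map_add' := fun H H' => map_add μ ⟨⟨H, hb H.2⟩, H.2⟩ ⟨⟨H', hb H'.2⟩, H'.2⟩
        map_smul' := fun c H => map_smul μ c ⟨⟨H, hb H.2⟩, H.2⟩ }
  · rfl

variable {M : Type u} [AddCommGroup M] [Module k M] [Module (UniversalEnvelopingAlgebra k g) M]
  [IsScalarTower k (UniversalEnvelopingAlgebra k g) M]

lemma weightSpace_cartanIn (μ : Module.Dual k h) :
    weightSpace (cartanIn h b) M (resWeight b μ) = weightSpace h M μ := by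
  ext m
  refine ⟨fun hm H => ?_, fun hm H => ?_⟩
  · have := hm ⟨⟨H, hb H.2⟩, H.2⟩
    rwa [restrict_ι_smul, resWeight_apply] at this
  · rw [restrict_ι_smul, resWeight_apply]
    exact hm ⟨H.1, H.2⟩

lemma isWeightModule_cartanIn : IsWeightModule (cartanIn h b) M ↔ IsWeightModule h M := by
  rw [IsWeightModule, IsWeightModule, ← (resWeight_bijective hb).2.iSup_comp]
  simp only [weightSpace_cartanIn hb]

end Cartan

/-! ### The triangular decomposition. -/

section Borel

variable {k : Type u} [Field k] {g : Type u} [LieRing g] [LieAlgebra k g] {h : LieSubalgebra k g}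

/-- The triangular decomposition `g = n⁻ ⊕ b` defined by a positive system with Dynkin Borel
subalgebra `b`. -/
structure IsTriangular (Φp : Set (Module.Dual k h)) (a b : LieSubalgebra k g) : Prop where
  isRootReductive : IsRootReductive h
  isPositiveSystem : IsPositiveSystem h Φp
  isDynkin : IsDynkin Φp
  left_eq : a.toSubmodule = ⨆ α ∈ Φp, rootSpace h (-α)
  right_eq : b.toSubmodule = borel Φp
  isCompl : IsCompl a.toSubmodule b.toSubmodule

lemma lie_mem_span_of_forall {s : Set g} (hs : ∀ x ∈ s, ∀ y ∈ s, ⁅x, y⁆ ∈ Submodule.span k s)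
    {x y : g} (hx : x ∈ Submodule.span k s) (hy : y ∈ Submodule.span k s) :
    ⁅x, y⁆ ∈ Submodule.span k s := by
  induction hx using Submodule.span_induction with
  | mem x hx =>
    induction hy using Submodule.span_induction with
    | mem y hy => exact hs x hx y hy
    | zero => rw [lie_zero]; exact Submodule.zero_mem _
    | add y z _ _ h1 h2 => rw [lie_add]; exact Submodule.add_mem _ h1 h2
    | smul c y _ h1 => rw [lie_smul]; exact Submodule.smul_mem _ _ h1
  | zero => rw [zero_lie]; exact Submodule.zero_mem _
  | add y z _ _ h1 h2 => rw [add_lie]; exact Submodule.add_mem _ h1 h2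
  | smul c y _ h1 => rw [smul_lie]; exact Submodule.smul_mem _ _ h1

/-- The subalgebra spanned by a set which is closed under the bracket up to linear combinations. -/
def spanSubalgebra (s : Set g) (hs : ∀ x ∈ s, ∀ y ∈ s, ⁅x, y⁆ ∈ Submodule.span k s) :
    LieSubalgebra k g where
  __ := Submodule.span k s
  lie_mem' hx hy := lie_mem_span_of_forall hs hx hy

lemma span_iUnion_rootSpace (S : Set (Module.Dual k h)) :
    Submodule.span k (⋃ α ∈ S, (rootSpace h α : Set g)) = ⨆ α ∈ S, rootSpace h α := by
  simp only [Submodule.span_iUnion, Submodule.span_eq]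

lemma span_union_rootSpace (Φp : Set (Module.Dual k h)) :
    Submodule.span k (h ∪ ⋃ α ∈ Φp, (rootSpace h α : Set g)) = borel Φp := by
  rw [Submodule.span_union, span_iUnion_rootSpace]
  exact congrArg (· ⊔ _) (Submodule.span_eq h.toSubmodule)

/-- Root spaces are the weight spaces of the adjoint module. -/
lemma iSupIndep_rootSpace (h : LieSubalgebra k g) : iSupIndep (rootSpace h) := by
  let := Module.compHom g (UniversalEnvelopingAlgebra.lift k (LieAlgebra.ad k g)).toRingHom
  have hι : ∀ x y : g, ι k x • y = ⁅x, y⁆ := fun x y => by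
    change UniversalEnvelopingAlgebra.lift k (LieAlgebra.ad k g) (ι k x) y = _
    rw [lift_ι_apply, LieAlgebra.ad_apply]
  have : IsScalarTower k (UniversalEnvelopingAlgebra k g) g := ⟨fun c u x => by
    change UniversalEnvelopingAlgebra.lift k (LieAlgebra.ad k g) (c • u) x = _
    rw [map_smul]
    rfl⟩
  have h1 : rootSpace h = weightSpace h g := by
    ext α x
    exact forall_congr' fun H => by rw [hι]
  rw [h1]
  exact iSupIndep_weightSpace h g

lemma IsPositiveSystem.neg {Φp : Set (Module.Dual k h)} (hΦ : IsPositiveSystem h Φp) :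
    IsPositiveSystem h {α | -α ∈ Φp} where
  mem_roots_iff α := by
    rw [hΦ.mem_roots_iff, Set.mem_ofPred_eq, Set.mem_ofPred_eq, neg_neg, or_comm]
  not_both α hα := by
    rw [Set.mem_ofPred_eq, neg_neg]
    exact fun h1 => hΦ.not_both α h1 hα
  add_mem α hα β hβ h1 := by
    rw [Set.mem_ofPred_eq, neg_add]
    refine hΦ.add_mem _ hα _ hβ ?_
    rw [← neg_add, hΦ.mem_roots_iff, neg_neg, or_comm]
    exact (hΦ.mem_roots_iff _).mp h1

lemma IsPositiveSystem.lie_mem {Φp : Set (Module.Dual k h)} (hΦ : IsPositiveSystem h Φp)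
    {α β : Module.Dual k h} (hα : α ∈ Φp) (hβ : β ∈ Φp) {x y : g} (hx : x ∈ rootSpace h α)
    (hy : y ∈ rootSpace h β) : ⁅x, y⁆ ∈ ⨆ α ∈ Φp, rootSpace h α := by
  by_cases h0 : ⁅x, y⁆ = 0
  · rw [h0]; exact Submodule.zero_mem _
  have hxy := lie_mem_rootSpace_add hx hy
  refine Submodule.mem_iSup_of_mem (α + β) (Submodule.mem_iSup_of_mem
    (hΦ.add_mem α hα β hβ ⟨fun e => ?_, fun e => h0 ?_⟩) hxy)
  · exact hΦ.not_both α hα (by rwa [neg_eq_of_add_eq_zero_right e])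
  · rwa [e, Submodule.mem_bot] at hxy

/-- Closure of the positive system makes the two spans subalgebras, together with commutativity of
`h` for the second one. They are complementary by independence of root spaces and the root
decomposition of `g`. -/
lemma exists_isTriangular [CharZero k] [IsAlgClosed k] (hg : IsRootReductive h)
    {Φp : Set (Module.Dual k h)} (hΦ : IsPositiveSystem h Φp) (hD : IsDynkin Φp) :
    ∃ a b : LieSubalgebra k g, IsTriangular Φp a b := by
  let N : Set (Module.Dual k h) := {α | -α ∈ Φp}
  have hneg : ⨆ α ∈ N, rootSpace h α = ⨆ α ∈ Φp, rootSpace h (-α) := by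
    refine le_antisymm (iSup₂_le fun α hα => ?_) (iSup₂_le fun α hα => ?_)
    · exact (neg_neg α).symm ▸ le_iSup₂_of_le (-α) hα le_rfl
    · exact le_iSup₂_of_le (-α) (by rwa [Set.mem_ofPred_eq, neg_neg]) le_rfl
  have h1 : ∀ x ∈ ⋃ α ∈ N, (rootSpace h α : Set g), ∀ y ∈ ⋃ α ∈ N, (rootSpace h α : Set g),
      ⁅x, y⁆ ∈ Submodule.span k (⋃ α ∈ N, (rootSpace h α : Set g)) := by
    intro x hx y hy
    obtain ⟨α, hα, hx⟩ := Set.mem_iUnion₂.mp hx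
    obtain ⟨β, hβ, hy⟩ := Set.mem_iUnion₂.mp hy
    rw [span_iUnion_rootSpace]
    exact hΦ.neg.lie_mem hα hβ hx hy
  have h2 : ∀ x ∈ (h ∪ ⋃ α ∈ Φp, (rootSpace h α : Set g) : Set g),
      ∀ y ∈ (h ∪ ⋃ α ∈ Φp, (rootSpace h α : Set g) : Set g),
      ⁅x, y⁆ ∈ Submodule.span k (h ∪ ⋃ α ∈ Φp, (rootSpace h α : Set g)) := by
    intro x hx y hy
    rw [span_union_rootSpace]
    have hle : ∀ {α}, α ∈ Φp → rootSpace h α ≤ borel Φp := fun hα =>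
      (le_iSup₂ (f := fun α _ => rootSpace h α) _ hα).trans (le_sup_right (a := h.toSubmodule))
    rcases hx with hx | hx
    · rcases hy with hy | hy
      · rw [hg.lie_eq_zero hx hy]
        exact Submodule.zero_mem _
      · obtain ⟨β, hβ, hy⟩ := Set.mem_iUnion₂.mp hy
        rw [hy ⟨x, hx⟩]
        exact Submodule.smul_mem _ _ (hle hβ hy)
    · obtain ⟨α, hα, hx⟩ := Set.mem_iUnion₂.mp hx
      rcases hy with hy | hy
      · rw [← lie_skew, hx ⟨y, hy⟩]
        exact Submodule.neg_mem _ (Submodule.smul_mem _ _ (hle hα hx))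
      · obtain ⟨β, hβ, hy⟩ := Set.mem_iUnion₂.mp hy
        exact Submodule.mem_sup_right (hΦ.lie_mem hα hβ hx hy)
  have ha : (spanSubalgebra _ h1).toSubmodule = ⨆ α ∈ N, rootSpace h α := span_iUnion_rootSpace _
  have hb : (spanSubalgebra _ h2).toSubmodule = borel Φp := span_union_rootSpace _
  refine ⟨spanSubalgebra _ h1, spanSubalgebra _ h2, hg, hΦ, hD, ha.trans hneg, hb, ?_⟩
  rw [ha, hb]
  constructor
  · have h0 : h.toSubmodule ≤ rootSpace h 0 := fun x hx H => by
      rw [hg.lie_eq_zero H.2 hx, LinearMap.zero_apply, zero_smul]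
    -- With `h` inside the root space of 0, disjointness reduces to disjointness of the index sets
    -- `-Φ⁺` and `{0} ∪ Φ⁺`.
    have hle : borel Φp ≤ ⨆ α ∈ insert 0 Φp, rootSpace h α := by
      rw [iSup_insert]
      exact sup_le_sup_right h0 _
    refine ((iSupIndep_rootSpace h).disjoint_biSup_biSup ?_).mono_right hle
    rw [Set.disjoint_left]
    rintro α hα (rfl | hα')
    · exact (hΦ.mem_roots hα).1 neg_zero
    · exact hΦ.not_both α hα' hα
  · rw [codisjoint_iff, eq_top_iff, ← hg.sup_iSup_rootSpace]
    refine sup_le (le_sup_of_le_right le_sup_left) (iSup₂_le fun α hα => ?_)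
    rcases (hΦ.mem_roots_iff α).mp hα with hα | hα
    · exact le_sup_of_le_right (le_sup_of_le_right (le_iSup₂_of_le α hα le_rfl))
    · exact le_sup_of_le_left (le_iSup₂_of_le α hα le_rfl)

end Borel

/-! ### Modules over a subalgebra with prescribed weights. -/

section HasWeightsIn

variable {k : Type u} [Field k] {g : Type u} [LieRing g] [LieAlgebra k g] {h : LieSubalgebra k g}
  (b : LieSubalgebra k g) (S : Set (Module.Dual k h))
variable (V : Type u) [AddCommGroup V] [Module k V] [Module (UniversalEnvelopingAlgebra k b) V]
  [IsScalarTower k (UniversalEnvelopingAlgebra k b) V]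

/-- The `b`-module `V` is semisimple over `h ∩ b`, with all weights in `S`. -/
def HasWeightsIn : Prop :=
  IsWeightModule (cartanIn h b) V ∧ support (cartanIn h b) V ⊆ resWeight b '' S

variable {b S V}
variable {W : Type u} [AddCommGroup W] [Module k W] [Module (UniversalEnvelopingAlgebra k b) W]
  [IsScalarTower k (UniversalEnvelopingAlgebra k b) W]

lemma HasWeightsIn.of_injective (f : V →ₗ[UniversalEnvelopingAlgebra k b] W)
    (hf : Function.Injective f) (hW : HasWeightsIn b S W) : HasWeightsIn b S V :=
  ⟨.of_injective f hf hW.1, (support_subset_of_injective f hf).trans hW.2⟩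

lemma HasWeightsIn.of_surjective (f : V →ₗ[UniversalEnvelopingAlgebra k b] W)
    (hf : Function.Surjective f) (hV : HasWeightsIn b S V) : HasWeightsIn b S W :=
  ⟨.of_surjective f hf hV.1, (support_subset_of_surjective f hf hV.1).trans hV.2⟩

lemma HasWeightsIn.mono {S' : Set (Module.Dual k h)} (hV : HasWeightsIn b S V) (hS : S ⊆ S') :
    HasWeightsIn b S' V := ⟨hV.1, hV.2.trans (Set.image_mono hS)⟩

lemma HasWeightsIn.of_span {I : Type*} {v : I → V} {χ : I → Module.Dual k h}
    (hv : ∀ i, v i ∈ weightSpace (cartanIn h b) V (resWeight b (χ i)))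
    (hs : ⊤ ≤ Submodule.span k (Set.range v)) (hS : ∀ i, χ i ∈ S) : HasWeightsIn b S V := by
  refine ⟨.of_span hv hs, (support_subset_range_of_span hv hs).trans ?_⟩
  rintro _ ⟨i, rfl⟩
  exact ⟨χ i, hS i, rfl⟩

lemma HasWeightsIn.exists_span (hV : HasWeightsIn b S V) :
    ∃ (I : Type u) (v : I → V) (χ : I → Module.Dual k h), (FiniteDimensional k V → Finite I) ∧
      (∀ i, v i ∈ weightSpace (cartanIn h b) V (resWeight b (χ i))) ∧
      ⊤ ≤ Submodule.span k (Set.range v) ∧ ∀ i, χ i ∈ S := by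
  have key : ∃ (I : Type u) (v : I → V) (χ : I → Module.Dual k (cartanIn h b)),
      (FiniteDimensional k V → Finite I) ∧
      (∀ i, v i ∈ weightSpace (cartanIn h b) V (χ i)) ∧ ⊤ ≤ Submodule.span k (Set.range v) := by
    by_cases hfin : FiniteDimensional k V
    · obtain ⟨I, hI, v, χ, hv, hs⟩ := hV.1.exists_finite_span
      exact ⟨I, v, χ, fun _ => hI, hv, hs⟩
    · exact ⟨_, _, fun i => i.1, fun h => absurd h hfin, fun i => i.2.2, hV.1.span_eq_top⟩
  obtain ⟨I, v, χ, hI, hv, hs⟩ := key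
  -- Zero vectors are discarded, since only a nonzero vector forces its weight into the support.
  have h1 : ∀ i : {i // v i ≠ 0}, ∃ μ ∈ S, resWeight b μ = χ i := fun i =>
    hV.2 (mem_support_iff.mpr ⟨v i, hv i, i.2⟩)
  choose μ hμ hμ' using h1
  refine ⟨{i // v i ≠ 0}, fun i => v i, μ, fun h => ?_, fun i => ?_, ?_, hμ⟩
  · have := hI h
    infer_instance
  · rw [hμ']
    exact hv i
  · refine hs.trans (Submodule.span_le.mpr ?_)
    rintro _ ⟨i, rfl⟩
    by_cases h0 : v i = 0
    · rw [h0]; exact Submodule.zero_mem _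
    · exact Submodule.subset_span ⟨⟨i, h0⟩, rfl⟩

lemma hasWeightsIn_iff (hb : h ≤ b) {M : Type u} [AddCommGroup M] [Module k M]
    [Module (UniversalEnvelopingAlgebra k g) M] [IsScalarTower k (UniversalEnvelopingAlgebra k g) M] :
    HasWeightsIn b S M ↔ IsWeightModule h M ∧ support h M ⊆ S := by
  refine and_congr (isWeightModule_cartanIn hb) ⟨fun H μ hμ => ?_, fun H μ hμ => ?_⟩
  · have : resWeight b μ ∈ support (cartanIn h b) M := by
      rwa [support, Set.mem_ofPred_eq, weightSpace_cartanIn hb]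
    obtain ⟨ν, hν, e⟩ := H this
    rwa [← (resWeight_bijective hb).1 e]
  · obtain ⟨μ, rfl⟩ := (resWeight_bijective hb).2 μ
    rw [support, Set.mem_ofPred_eq, weightSpace_cartanIn hb] at hμ
    exact ⟨μ, H hμ, rfl⟩

end HasWeightsIn

/-! ### Products of root vectors, local finiteness, and weights of induced modules. -/

section Words

variable {k : Type u} [Field k] {g : Type u} [LieRing g] [LieAlgebra k g] {h : LieSubalgebra k g}
variable {M : Type u} [AddCommGroup M] [Module k M] [Module (UniversalEnvelopingAlgebra k g) M]
  [IsScalarTower k (UniversalEnvelopingAlgebra k g) M]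

/-- A nonzero element of the root space `g^α`, if `α` is a root. -/
noncomputable def rootVector (α : Module.Dual k h) : g :=
  Classical.epsilon fun x => x ∈ rootSpace h α ∧ x ≠ 0

lemma rootVector_spec {α : Module.Dual k h} (hα : α ∈ roots h) :
    rootVector α ∈ rootSpace h α ∧ rootVector α ≠ 0 :=
  Classical.epsilon_spec ((Submodule.ne_bot_iff _).mp hα.2)

/-- The image of `m` under a product of root vectors. -/
noncomputable def word (l : List (Module.Dual k h)) (m : M) : M :=
  (l.map fun α => ι k (rootVector α)).prod • m

lemma word_nil (m : M) : word (h := h) [] m = m := one_smul _ m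

lemma word_cons (α : Module.Dual k h) (l : List (Module.Dual k h)) (m : M) :
    word (α :: l) m = ι k (rootVector α) • word l m := by
  rw [word, List.map_cons, List.prod_cons, mul_smul, word]

lemma word_mem_weightSpace {l : List (Module.Dual k h)} (hl : ∀ α ∈ l, α ∈ roots h)
    {μ : Module.Dual k h} {m : M} (hm : m ∈ weightSpace h M μ) :
    word l m ∈ weightSpace h M (μ + l.sum) := by
  induction l with
  | nil => simpa [word_nil] using hm
  | cons α l ih =>
    rw [word_cons, List.sum_cons, add_comm α, ← add_assoc]
    exact ι_smul_mem_weightSpace (rootVector_spec (hl α (by simp))).1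
      (ih fun β hβ => hl β (by simp [hβ]))

variable [CharZero k] [IsAlgClosed k]

/-- A subspace which is stable under root vectors is stable under the root spaces. -/
lemma ι_smul_mem_of_rootVector (hg : IsRootReductive h) {p : Submodule k M}
    {f : Module.Dual k h → Module.Dual k h} {S : Set (Module.Dual k h)}
    (hf : ∀ α ∈ S, f α ∈ roots h) (hp : ∀ α ∈ S, ∀ m ∈ p, ι k (rootVector (f α)) • m ∈ p)
    {x : g} (hx : x ∈ ⨆ α ∈ S, rootSpace h (f α)) {m : M} (hm : m ∈ p) : ι k x • m ∈ p := by
  let q : Submodule k g :=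
    { carrier := {x | ∀ m ∈ p, ι k x • m ∈ p}
      add_mem' := fun {x y} hx hy m hm => by
        rw [map_add, add_smul]; exact p.add_mem (hx m hm) (hy m hm)
      zero_mem' := fun m _ => by rw [map_zero, zero_smul]; exact p.zero_mem
      smul_mem' := fun c x hx m hm => by
        rw [map_smul, smul_assoc]; exact p.smul_mem c (hx m hm) }
  have hq : ⨆ α ∈ S, rootSpace h (f α) ≤ q := by
    refine iSup₂_le fun α hα x hx => ?_
    have h1 := rootVector_spec (hf α hα)
    refine (Submodule.span_le (p := q)).mpr ?_
      (hg.mem_span_singleton (hf α hα).1 h1.1 h1.2 hx)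
    rintro _ rfl
    exact hp α hα
  exact hq hx m hm

end Words

namespace IsTriangular

variable {k : Type u} [Field k] [CharZero k] [IsAlgClosed k] {g : Type u} [LieRing g]
  [LieAlgebra k g] {h : LieSubalgebra k g} {Φp : Set (Module.Dual k h)} {a b : LieSubalgebra k g}
  (T : IsTriangular Φp a b)
include T

lemma le : h ≤ b := by
  rw [← LieSubalgebra.toSubmodule_le_toSubmodule, T.right_eq]
  exact le_sup_left

lemma rootSpace_le {α : Module.Dual k h} (hα : α ∈ Φp) : rootSpace h α ≤ b.toSubmodule := by
  rw [T.right_eq]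
  exact (le_iSup₂ (f := fun α _ => rootSpace h α) _ hα).trans (le_sup_right (a := h.toSubmodule))

lemma mem_roots {α : Module.Dual k h} (hα : α ∈ Φp) : α ∈ roots h :=
  T.isPositiveSystem.mem_roots hα

lemma neg_mem_roots {α : Module.Dual k h} (hα : α ∈ Φp) : -α ∈ roots h :=
  T.isPositiveSystem.neg_mem_roots hα

omit T [CharZero k] [IsAlgClosed k] in
lemma exists_list {γ : Module.Dual k h} (hγ : γ ∈ posCone Φp) :
    ∃ l : List (Module.Dual k h), (∀ α ∈ l, α ∈ Φp) ∧ l.sum = γ :=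
  AddSubmonoid.exists_list_of_mem_closure hγ

omit T [CharZero k] [IsAlgClosed k] in
lemma list_sum_mem {l : List (Module.Dual k h)} (hl : ∀ α ∈ l, α ∈ Φp) : l.sum ∈ posCone Φp :=
  AddSubmonoid.list_sum_mem _ fun α hα => AddSubmonoid.subset_closure (hl α hα)

lemma finite_lists (γ : Module.Dual k h) :
    {l : List (Module.Dual k h) | (∀ α ∈ l, α ∈ Φp) ∧ l.sum = γ}.Finite :=
  finite_lists_of_sum_eq T.isRootReductive T.isPositiveSystem T.isDynkin γ

/-- A weight in the interval cuts a list of positive roots with sum `lam - μ` into a prefix and a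
rest. There are finitely many lists, each with finitely many prefixes. -/
lemma finite_interval (μ lam : Module.Dual k h) :
    {ν | WeightLE Φp μ ν ∧ WeightLE Φp ν lam}.Finite := by
  classical
  refine ((T.finite_lists (lam - μ)).biUnion fun l _ =>
    ((l.inits.map fun l => μ + l.sum).toFinset.finite_toSet)).subset ?_
  rintro ν ⟨h1, h2⟩
  obtain ⟨l₁, hl₁, e₁⟩ := exists_list h1
  obtain ⟨l₂, hl₂, e₂⟩ := exists_list h2
  refine Set.mem_biUnion (x := l₁ ++ l₂) ⟨fun α hα => ?_, ?_⟩ ?_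
  · rcases List.mem_append.mp hα with h | h
    exacts [hl₁ α h, hl₂ α h]
  · rw [List.sum_append, e₁, e₂]
    abel
  · simp only [List.coe_toFinset, Set.mem_ofPred_eq, List.mem_map]
    exact ⟨l₁, List.mem_inits _ _ |>.mpr (List.prefix_append _ _), by rw [e₁]; abel⟩

variable {M : Type u} [AddCommGroup M] [Module k M] [Module (UniversalEnvelopingAlgebra k g) M]
  [IsScalarTower k (UniversalEnvelopingAlgebra k g) M]

/-- The `b`-module generated by a weight vector is spanned by products of positive root vectors
applied to it. Only finitely many weights above it occur, and each is reached by finitely many lists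
of roots. -/
lemma isLocallyFinite (hM : IsWeightModule h M)
    (hfin : ∀ μ ∈ support h M, {ν | ν ∈ support h M ∧ WeightLE Φp μ ν}.Finite) :
    IsLocallyFinite M (borel Φp) := by
  have h1 : ∀ μ, ∀ m ∈ weightSpace h M μ, ∃ N : Submodule k M, FiniteDimensional k N ∧ m ∈ N ∧
      ∀ x ∈ borel Φp, ∀ v ∈ N, ι k x • v ∈ N := by
    intro μ m hm
    by_cases hm0 : m = 0
    · exact ⟨⊥, inferInstance, hm0, fun x _ v hv => by
        rw [(Submodule.mem_bot _).mp hv, smul_zero]; exact Submodule.zero_mem _⟩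
    let L : Set (List (Module.Dual k h)) := {l | ∀ α ∈ l, α ∈ Φp}
    let N := Submodule.span k ((word · m) '' L)
    have hL : ∀ l ∈ L, word l m ∈ weightSpace h M (μ + l.sum) := fun l hl =>
      word_mem_weightSpace (fun α hα => T.mem_roots (hl α hα)) hm
    refine ⟨N, ?_, Submodule.subset_span ⟨[], by simp [L], word_nil m⟩, fun x hx v hv => ?_⟩
    · have hF := hfin μ (mem_support_iff.mpr ⟨m, hm, hm0⟩)
      let U : Set M := ⋃ ν ∈ {ν | ν ∈ support h M ∧ WeightLE Φp μ ν},
        (word · m) '' {l | (∀ α ∈ l, α ∈ Φp) ∧ l.sum = ν - μ}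
      have hU : U.Finite := hF.biUnion fun ν _ => (T.finite_lists (ν - μ)).image _
      have := FiniteDimensional.span_of_finite k hU
      refine Submodule.finiteDimensional_of_le (Submodule.span_le.mpr ?_ : N ≤ Submodule.span k U)
      rintro _ ⟨l, hl, rfl⟩
      by_cases h0 : word l m = 0
      · change word l m ∈ _
        rw [h0]; exact Submodule.zero_mem _
      · refine Submodule.subset_span (Set.mem_biUnion (x := μ + l.sum)
          ⟨mem_support_iff.mpr ⟨_, hL l hl, h0⟩, ?_⟩ ⟨l, ⟨hl, by abel⟩, rfl⟩)
        rw [WeightLE, add_sub_cancel_left]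
        exact list_sum_mem hl
    · obtain ⟨H, hH, y, hy, rfl⟩ := Submodule.mem_sup.mp hx
      rw [map_add, add_smul]
      refine Submodule.add_mem _ ?_ ?_
      · induction hv using Submodule.span_induction with
        | mem v hv =>
          obtain ⟨l, hl, rfl⟩ := hv
          have := hL l hl ⟨H, hH⟩
          refine this ▸ Submodule.smul_mem _ _ (Submodule.subset_span ⟨l, hl, rfl⟩)
        | zero => rw [smul_zero]; exact Submodule.zero_mem _
        | add v w _ _ h1 h2 => rw [smul_add]; exact Submodule.add_mem _ h1 h2
        | smul c v _ h1 => rw [smul_comm]; exact Submodule.smul_mem _ _ h1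
      · refine ι_smul_mem_of_rootVector T.isRootReductive (f := id)
          (fun α hα => T.mem_roots hα) (fun α hα v hv => ?_) hy hv
        induction hv using Submodule.span_induction with
        | mem v hv =>
          obtain ⟨l, hl, rfl⟩ := hv
          refine Submodule.subset_span ⟨α :: l, ?_, word_cons _ _ _⟩
          intro β hβ
          rcases List.mem_cons.mp hβ with rfl | hβ
          exacts [hα, hl β hβ]
        | zero => rw [smul_zero]; exact Submodule.zero_mem _
        | add v w _ _ h1 h2 => rw [smul_add]; exact Submodule.add_mem _ h1 h2
        | smul c v _ h1 => rw [smul_comm]; exact Submodule.smul_mem _ _ h1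
  choose! N hN hmN hNb using h1
  intro m
  obtain ⟨s, v, hv, rfl⟩ := hM.exists_sum m
  refine ⟨⨆ μ : s, N μ (v μ), ?_, ?_, fun x hx => ?_⟩
  · have : ∀ μ : s, FiniteDimensional k (N μ (v μ)) := fun μ => hN _ _ (hv _)
    exact Submodule.finite_iSup _
  · exact Submodule.sum_mem _ fun μ hμ =>
      Submodule.mem_iSup_of_mem (⟨μ, hμ⟩ : s) (hmN _ _ (hv _))
  · intro w hw
    induction hw using Submodule.iSup_induction' with
    | mem μ w hw => exact Submodule.mem_iSup_of_mem μ (hNb _ _ (hv _) x hx w hw)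
    | zero => rw [smul_zero]; exact Submodule.zero_mem _
    | add v w _ _ h1 h2 => rw [smul_add]; exact Submodule.add_mem _ h1 h2

section Ind

variable {V : Type u} [AddCommGroup V] [Module k V] [Module (UniversalEnvelopingAlgebra k b) V]
  [IsScalarTower k (UniversalEnvelopingAlgebra k b) V]

lemma word_unit_mem_weightSpace {μ : Module.Dual k h} {v : V}
    (hv : v ∈ weightSpace (cartanIn h b) V (resWeight b μ)) {l : List (Module.Dual k h)}
    (hl : ∀ α ∈ l, α ∈ Φp) : word (l.map Neg.neg) (Ind.unit T.isCompl V v) ∈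
      weightSpace h (Ind T.isCompl V) (μ - l.sum) := by
  have h1 : Ind.unit T.isCompl V v ∈ weightSpace h (Ind T.isCompl V) μ := by
    rw [← weightSpace_cartanIn T.le]
    exact map_mem_weightSpace _ hv
  have h2 : (l.map Neg.neg).sum = -l.sum := by
    induction l with
    | nil => simp
    | cons a l ih =>
      rw [List.map_cons, List.sum_cons, List.sum_cons, ih fun b hb => hl b (by simp [hb]), neg_add]
  rw [sub_eq_add_neg, ← h2]
  refine word_mem_weightSpace (fun α hα => ?_) h1
  obtain ⟨β, hβ, rfl⟩ := List.mem_map.mp hα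
  exact T.neg_mem_roots (hl β hβ)

/-- The vectors in the induced module obtained from the vectors `v i` by applying products of
negative root vectors. -/
noncomputable def indFamily {I : Type u} (v : I → V)
    (i : {l : List (Module.Dual k h) // ∀ α ∈ l, α ∈ Φp} × I) : Ind T.isCompl V :=
  word (i.1.1.map Neg.neg) (Ind.unit T.isCompl V (v i.2))

omit T [CharZero k] [IsAlgClosed k] in
variable (Φp) in
/-- The weights of the vectors `indFamily`. -/
def indWeight {I : Type u} (χ : I → Module.Dual k h)
    (i : {l : List (Module.Dual k h) // ∀ α ∈ l, α ∈ Φp} × I) : Module.Dual k h :=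
  χ i.2 - i.1.1.sum

omit T [CharZero k] [IsAlgClosed k] in
lemma weightLE_indWeight {I : Type u} (χ : I → Module.Dual k h)
    (i : {l : List (Module.Dual k h) // ∀ α ∈ l, α ∈ Φp} × I) :
    WeightLE Φp (indWeight Φp χ i) (χ i.2) := by
  rw [WeightLE, indWeight, sub_sub_cancel]
  exact list_sum_mem i.1.2

lemma indFamily_mem {I : Type u} {v : I → V} {χ : I → Module.Dual k h}
    (hv : ∀ i, v i ∈ weightSpace (cartanIn h b) V (resWeight b (χ i))) (i) :
    T.indFamily v i ∈ weightSpace h (Ind T.isCompl V) (indWeight Φp χ i) :=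
  T.word_unit_mem_weightSpace (hv i.2) i.1.2

lemma span_indFamily {I : Type u} {v : I → V} (hs : ⊤ ≤ Submodule.span k (Set.range v)) :
    ⊤ ≤ Submodule.span k (Set.range (T.indFamily v)) := by
  rintro w -
  refine Ind.mem_of_forall (fun u => ?_) (fun y hy w hw => ?_) w
  · have hu : u ∈ Submodule.span k (Set.range v) := hs trivial
    induction hu using Submodule.span_induction with
    | mem u hu =>
      obtain ⟨i, rfl⟩ := hu
      exact Submodule.subset_span ⟨⟨⟨[], by simp⟩, i⟩, word_nil _⟩
    | zero => rw [map_zero]; exact Submodule.zero_mem _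
    | add v w _ _ h1 h2 => rw [map_add]; exact Submodule.add_mem _ h1 h2
    | smul c v _ h1 =>
      rw [← LinearMap.restrictScalars_apply k, map_smul]
      exact Submodule.smul_mem _ _ h1
  · have hy' : y ∈ ⨆ α ∈ Φp, rootSpace h (-α) := by rwa [← T.left_eq]
    refine ι_smul_mem_of_rootVector T.isRootReductive (f := Neg.neg)
      (fun α hα => T.neg_mem_roots hα) (fun α hα w hw => ?_) hy' hw
    induction hw using Submodule.span_induction with
    | mem w hw =>
      obtain ⟨⟨⟨l, hl⟩, i⟩, rfl⟩ := hw
      refine Submodule.subset_span ⟨⟨⟨α :: l, ?_⟩, i⟩, word_cons _ _ _⟩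
      intro β hβ
      rcases List.mem_cons.mp hβ with rfl | hβ
      exacts [hα, hl β hβ]
    | zero => rw [smul_zero]; exact Submodule.zero_mem _
    | add v w _ _ h1 h2 => rw [smul_add]; exact Submodule.add_mem _ h1 h2
    | smul c v _ h1 => rw [smul_comm]; exact Submodule.smul_mem _ _ h1

variable {S : Set (Module.Dual k h)}

lemma isWeightModule_ind (hV : HasWeightsIn b S V) : IsWeightModule h (Ind T.isCompl V) := by
  obtain ⟨I, v, χ, -, hv, hs, -⟩ := hV.exists_span
  exact .of_span (T.indFamily_mem hv) (T.span_indFamily hs)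

lemma support_ind_subset (hS : IsWeightIdeal Φp S) (hV : HasWeightsIn b S V) :
    support h (Ind T.isCompl V) ⊆ S := by
  obtain ⟨I, v, χ, -, hv, hs, hχ⟩ := hV.exists_span
  refine (support_subset_range_of_span (T.indFamily_mem hv) (T.span_indFamily hs)).trans ?_
  rintro _ ⟨i, rfl⟩
  exact hS _ (hχ i.2) _ (weightLE_indWeight χ i)

/-- A fixed weight is reached from each of the finitely many spanning weight vectors of `V` by
finitely many products of negative root vectors. -/
lemma hasFiniteWeightSpaces_ind [FiniteDimensional k V] (hV : HasWeightsIn b S V) :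
    HasFiniteWeightSpaces h (Ind T.isCompl V) := by
  obtain ⟨I, v, χ, hI, hv, hs, -⟩ := hV.exists_span
  have := hI inferInstance
  refine .of_span (T.indFamily_mem hv) (T.span_indFamily hs) fun ν => ?_
  have h1 : (⋃ i : I, {l : List (Module.Dual k h) | (∀ α ∈ l, α ∈ Φp) ∧ l.sum = χ i - ν}).Finite :=
    Set.finite_iUnion fun i => T.finite_lists _
  refine ((h1.preimage Subtype.val_injective.injOn).prod (Set.finite_univ (α := I))).subset ?_
  rintro ⟨⟨l, hl⟩, i⟩ rfl
  exact ⟨Set.mem_iUnion.mpr ⟨i, hl, by simp [indWeight]⟩, trivial⟩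

/-- All weights lie below one of finitely many weights of `V`, so finiteness of intervals bounds the
weights above a given one. -/
lemma isLocallyFinite_ind_of_finiteDimensional [FiniteDimensional k V] (hV : HasWeightsIn b S V) :
    IsLocallyFinite (Ind T.isCompl V) (borel Φp) := by
  obtain ⟨I, v, χ, hI, hv, hs, -⟩ := hV.exists_span
  have := hI inferInstance
  refine T.isLocallyFinite (T.isWeightModule_ind hV) fun μ _ => ?_
  refine (Set.finite_iUnion fun i => T.finite_interval μ (χ i)).subset ?_
  rintro ν ⟨hν, hle⟩
  obtain ⟨i, rfl⟩ := support_subset_range_of_span (T.indFamily_mem hv) (T.span_indFamily hs) hν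
  exact Set.mem_iUnion.mpr ⟨i.2, hle, weightLE_indWeight χ i⟩

end Ind

end IsTriangular

/-! ### Locally finite modules and weight parts of modules over the Borel subalgebra. -/

section LocallyFinite

variable {k : Type u} [Field k] {g : Type u} [LieRing g] [LieAlgebra k g]
variable {M : Type u} [AddCommGroup M] [Module k M] [Module (UniversalEnvelopingAlgebra k g) M]
  [IsScalarTower k (UniversalEnvelopingAlgebra k g) M]
variable {N : Type u} [AddCommGroup N] [Module k N] [Module (UniversalEnvelopingAlgebra k g) N]
  [IsScalarTower k (UniversalEnvelopingAlgebra k g) N]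

lemma IsLocallyFinite.of_forall_span {c : Submodule k g} {s : Set M} (hs : ⊤ ≤ Submodule.span k s)
    (H : ∀ m ∈ s, ∃ N : Submodule k M, FiniteDimensional k N ∧ m ∈ N ∧
      ∀ x ∈ c, ∀ v ∈ N, ι k x • v ∈ N) : IsLocallyFinite M c := by
  intro m
  have hm : m ∈ Submodule.span k s := hs trivial
  induction hm using Submodule.span_induction with
  | mem m hm => exact H m hm
  | zero => exact ⟨⊥, inferInstance, Submodule.zero_mem _, fun x _ v hv => by
      rw [(Submodule.mem_bot _).mp hv, smul_zero]; exact Submodule.zero_mem _⟩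
  | add m m' _ _ h1 h2 =>
    obtain ⟨N, hN, hm, hx⟩ := h1
    obtain ⟨N', hN', hm', hx'⟩ := h2
    refine ⟨N ⊔ N', inferInstance, Submodule.add_mem_sup hm hm', fun x hxc v hv => ?_⟩
    obtain ⟨y, hy, z, hz, rfl⟩ := Submodule.mem_sup.mp hv
    rw [smul_add]
    exact Submodule.add_mem_sup (hx x hxc y hy) (hx' x hxc z hz)
  | smul c m _ h1 =>
    obtain ⟨N, hN, hm, hx⟩ := h1
    exact ⟨N, hN, N.smul_mem c hm, hx⟩

/-- A finite set of vectors in a locally finite module lies in a finite dimensional submodule. -/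
lemma IsLocallyFinite.exists_submodule (hM : IsLocallyFinite M (⊤ : Submodule k g)) {I : Type*}
    [Finite I] (v : I → M) : ∃ F : Submodule (UniversalEnvelopingAlgebra k g) M,
      FiniteDimensional k F ∧ ∀ i, v i ∈ F := by
  choose N hN hm hx using hM
  have : ∀ i, FiniteDimensional k (N (v i)) := fun i => hN _
  let F : Submodule k M := ⨆ i, N (v i)
  have hF : ∀ (x : g), ∀ m ∈ F, ι k x • m ∈ F := by
    intro x m hmF
    induction hmF using Submodule.iSup_induction' with
    | mem i w hw => exact Submodule.mem_iSup_of_mem i (hx _ x trivial w hw)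
    | zero => rw [smul_zero]; exact Submodule.zero_mem _
    | add v w _ _ h1 h2 => rw [smul_add]; exact Submodule.add_mem _ h1 h2
  refine ⟨submoduleOfForall F hF, ?_, fun i => ?_⟩
  · exact Module.Finite.equiv (LinearEquiv.refl k F)
  · exact Submodule.mem_iSup_of_mem i (hm _)

lemma IsLocallyFinite.exists_surjective (hM : IsLocallyFinite M (⊤ : Submodule k g))
    (f : M →ₗ[UniversalEnvelopingAlgebra k g] N) (hf : Function.Surjective f)
    [FiniteDimensional k N] : ∃ F : Submodule (UniversalEnvelopingAlgebra k g) M,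
      FiniteDimensional k F ∧ Function.Surjective (f ∘ₗ F.subtype) := by
  obtain ⟨t, ht⟩ := (inferInstance : Module.Finite k N).fg_top
  choose v hv using hf
  obtain ⟨F, hF, hvF⟩ := hM.exists_submodule fun n : t => v n
  refine ⟨F, hF, fun n => ?_⟩
  have hn : n ∈ Submodule.span k (t : Set N) := by rw [ht]; trivial
  have hle : Submodule.span k (t : Set N) ≤
      (LinearMap.range (f ∘ₗ F.subtype)).restrictScalars k := by
    refine Submodule.span_le.mpr fun n hn => ?_
    exact ⟨⟨v n, hvF ⟨n, hn⟩⟩, hv n⟩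
  exact hle hn

lemma IsLocallyFinite.of_finiteDimensional [FiniteDimensional k M] (c : Submodule k g) :
    IsLocallyFinite M c := fun _ => ⟨⊤, inferInstance, trivial, fun _ _ _ _ => trivial⟩

lemma isLocallyFinite_restrict (b : LieSubalgebra k g) :
    IsLocallyFinite M (⊤ : Submodule k b) ↔ IsLocallyFinite M b.toSubmodule := by
  refine forall_congr' fun m => exists_congr fun N => and_congr_right fun _ => and_congr_right
    fun _ => ⟨fun H x hx v hv => ?_, fun H x _ v hv => ?_⟩
  · have := H ⟨x, hx⟩ trivial v hv
    rwa [restrict_ι_smul] at this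
  · rw [restrict_ι_smul]
    exact H x x.2 v hv

end LocallyFinite

namespace IsTriangular

variable {k : Type u} [Field k] [CharZero k] [IsAlgClosed k] {g : Type u} [LieRing g]
  [LieAlgebra k g] {h : LieSubalgebra k g} {Φp : Set (Module.Dual k h)} {a b : LieSubalgebra k g}
  (T : IsTriangular Φp a b)
include T

variable {V : Type u} [AddCommGroup V] [Module k V] [Module (UniversalEnvelopingAlgebra k b) V]
  [IsScalarTower k (UniversalEnvelopingAlgebra k b) V] {S : Set (Module.Dual k h)}

/-- Every vector lies in the image of a module induced from a finite dimensional submodule of `V`.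
This gives local finiteness without a bound on the weights, as needed for all of `catO`. -/
lemma isLocallyFinite_ind (hV : HasWeightsIn b S V)
    (hV' : IsLocallyFinite V (⊤ : Submodule k b)) :
    IsLocallyFinite (Ind T.isCompl V) (borel Φp) := by
  let s : Set (Ind T.isCompl V) := {w | ∃ F : Submodule (UniversalEnvelopingAlgebra k b) V,
    FiniteDimensional k F ∧ ∃ w', Ind.map T.isCompl F.subtype w' = w}
  refine .of_forall_span (s := s) ?_ ?_
  · rintro w -
    refine Ind.mem_of_forall (fun v => ?_) (fun y hy w hw => ?_) w
    · obtain ⟨F, hF, hv⟩ := hV'.exists_submodule fun _ : Unit => v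
      exact Submodule.subset_span ⟨F, hF, _, Ind.map_unit F.subtype ⟨v, hv ()⟩⟩
    · induction hw using Submodule.span_induction with
      | mem w hw =>
        obtain ⟨F, hF, w, rfl⟩ := hw
        exact Submodule.subset_span ⟨F, hF, ι k y • w, map_smul _ _ _⟩
      | zero => rw [smul_zero]; exact Submodule.zero_mem _
      | add v w _ _ h1 h2 => rw [smul_add]; exact Submodule.add_mem _ h1 h2
      | smul c v _ h1 => rw [smul_comm]; exact Submodule.smul_mem _ _ h1
  · rintro _ ⟨F, hF, w, rfl⟩
    have hw : HasWeightsIn b S F := hV.of_injective F.subtype Subtype.val_injective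
    obtain ⟨N, hN, hm, hx⟩ := T.isLocallyFinite_ind_of_finiteDimensional hw w
    refine ⟨N.map ((Ind.map T.isCompl F.subtype).restrictScalars k), inferInstance,
      ⟨w, hm, rfl⟩, ?_⟩
    rintro x hxb _ ⟨v, hv, rfl⟩
    exact ⟨_, hx x hxb v hv, map_smul (Ind.map T.isCompl F.subtype) _ _⟩

/-- The Borel subalgebra moves weights only by zero or by positive roots. -/
lemma ι_smul_mem_iSup_weightSpace (hS : ∀ μ ∈ S, ∀ α ∈ Φp, μ + α ∈ S) (x : b) {m : V}
    (hm : m ∈ ⨆ μ ∈ S, weightSpace (cartanIn h b) V (resWeight b μ)) :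
    ι k x • m ∈ ⨆ μ ∈ S, weightSpace (cartanIn h b) V (resWeight b μ) := by
  set P := ⨆ μ ∈ S, weightSpace (cartanIn h b) V (resWeight b μ)
  suffices hP : P ≤ P.comap (Algebra.lsmul k k V (ι k x)) from hP hm
  refine iSup₂_le fun μ hμ m hm => ?_
  let q : Submodule k b :=
    { carrier := {x | ι k x • m ∈ P}
      add_mem' := fun {x y} hx hy => by
        rw [Set.mem_ofPred_eq, map_add, add_smul]
        exact P.add_mem hx hy
      zero_mem' := by
        rw [Set.mem_ofPred_eq, map_zero, zero_smul]
        exact P.zero_mem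
      smul_mem' := fun c x hx => by
        rw [Set.mem_ofPred_eq, map_smul, smul_assoc]
        exact P.smul_mem c hx }
  have hq : borel Φp ≤ q.map b.toSubmodule.subtype := by
    refine sup_le (fun H hH => ⟨⟨H, T.le hH⟩, ?_, rfl⟩) (iSup₂_le fun α hα y hy =>
      ⟨⟨y, T.rootSpace_le hα hy⟩, ?_, rfl⟩)
    · have := hm ⟨⟨H, T.le hH⟩, hH⟩
      change ι k (⟨H, T.le hH⟩ : b) • m ∈ P
      exact this.symm ▸ Submodule.mem_iSup_of_mem μ
        (Submodule.mem_iSup_of_mem hμ (Submodule.smul_mem _ _ hm))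
    · refine Submodule.mem_iSup_of_mem (μ + α) (Submodule.mem_iSup_of_mem (hS μ hμ α hα) ?_)
      rw [map_add]
      exact ι_smul_mem_weightSpace (fun H => Subtype.ext (hy ⟨H.1, H.2⟩)) hm
  have hx : (x : g) ∈ borel Φp := T.right_eq ▸ x.2
  obtain ⟨y, hy, e⟩ := hq hx
  rwa [← Subtype.ext e]

/-- The sum of the weight spaces with weights in a set which is stable under adding positive
roots. -/
def weightPart (hS : ∀ μ ∈ S, ∀ α ∈ Φp, μ + α ∈ S) (V : Type u)
    [AddCommGroup V] [Module k V] [Module (UniversalEnvelopingAlgebra k b) V]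
    [IsScalarTower k (UniversalEnvelopingAlgebra k b) V] :
    Submodule (UniversalEnvelopingAlgebra k b) V :=
  submoduleOfForall _ fun x _ hm => T.ι_smul_mem_iSup_weightSpace hS x hm

variable (hS : ∀ μ ∈ S, ∀ α ∈ Φp, μ + α ∈ S)

lemma mem_weightPart {μ : Module.Dual k h} (hμ : μ ∈ S) {m : V}
    (hm : m ∈ weightSpace (cartanIn h b) V (resWeight b μ)) : m ∈ T.weightPart hS V :=
  Submodule.mem_iSup_of_mem μ (Submodule.mem_iSup_of_mem hμ hm)

lemma weightPart_le {p : Submodule k V}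
    (hp : ∀ μ ∈ S, weightSpace (cartanIn h b) V (resWeight b μ) ≤ p) {m : V}
    (hm : m ∈ T.weightPart hS V) : m ∈ p :=
  (iSup₂_le hp : ⨆ μ ∈ S, weightSpace (cartanIn h b) V (resWeight b μ) ≤ p) hm

lemma hasWeightsIn_weightPart : HasWeightsIn b S (T.weightPart hS V) := by
  let I := Σ μ : S, weightSpace (cartanIn h b) V (resWeight b μ.1)
  let v : I → T.weightPart hS V := fun i => ⟨i.2, T.mem_weightPart hS i.1.2 i.2.2⟩
  refine .of_span (v := v) (χ := fun i : I => i.1) (fun i => ?_) ?_ fun i => i.1.2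
  · exact mem_weightSpace_of_map (T.weightPart hS V).subtype Subtype.val_injective i.2.2
  · rintro ⟨m, hm⟩ -
    have hm' : m ∈ (Submodule.span k (Set.range v)).map
        ((T.weightPart hS V).subtype.restrictScalars k) := by
      refine T.weightPart_le hS (fun μ hμ m hm => ?_) hm
      exact ⟨_, Submodule.subset_span ⟨⟨⟨μ, hμ⟩, m, hm⟩, rfl⟩, rfl⟩
    obtain ⟨m', hm', e⟩ := hm'
    rwa [← (Subtype.ext e : m' = ⟨m, hm⟩)]

lemma hasWeightsIn_quotient {S' : Set (Module.Dual k h)} (hV : HasWeightsIn b S' V) :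
    HasWeightsIn b (S' \ S) (V ⧸ T.weightPart hS V) := by
  have hV' := hV.of_surjective _ (T.weightPart hS V).mkQ_surjective
  refine ⟨hV'.1, fun χ hχ => ?_⟩
  obtain ⟨μ, hμ, rfl⟩ := hV'.2 hχ
  refine ⟨μ, ⟨hμ, fun hμS => ?_⟩, rfl⟩
  obtain ⟨m, hm, h0⟩ := mem_support_iff.mp hχ
  obtain ⟨m, hm', rfl⟩ := exists_weight_lift _ (T.weightPart hS V).mkQ_surjective hV.1 hm
  exact h0 ((Submodule.Quotient.mk_eq_zero _).mpr (T.mem_weightPart hS hμS hm'))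

variable {W : Type u} [AddCommGroup W] [Module k W] [Module (UniversalEnvelopingAlgebra k b) W]
  [IsScalarTower k (UniversalEnvelopingAlgebra k b) W]

/-- Weight vectors lift to weight vectors of the same weight, so the part of `V` with weights in `S`
suffices. -/
lemma surjective_weightPart (f : V →ₗ[UniversalEnvelopingAlgebra k b] W)
    (hf : Function.Surjective f) {S' : Set (Module.Dual k h)} (hV : HasWeightsIn b S' V)
    (hW : HasWeightsIn b S W) : Function.Surjective (f ∘ₗ (T.weightPart hS V).subtype) := by
  intro w
  obtain ⟨I, v, χ, -, hv, hs, hχ⟩ := hW.exists_span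
  have hle : Submodule.span k (Set.range v) ≤
      (LinearMap.range (f ∘ₗ (T.weightPart hS V).subtype)).restrictScalars k := by
    refine Submodule.span_le.mpr ?_
    rintro _ ⟨i, rfl⟩
    obtain ⟨m, hm, e⟩ := exists_weight_lift f hf hV.1 (hv i)
    exact ⟨⟨m, T.mem_weightPart hS (hχ i) hm⟩, e⟩
  exact hle (hs trivial)

end IsTriangular

/-- Homomorphisms between modules with disjoint sets of weights are zero. -/
lemma HasWeightsIn.hom_eq_zero {k : Type u} [Field k] {g : Type u} [LieRing g] [LieAlgebra k g]
    {h b : LieSubalgebra k g} (hb : h ≤ b) {S S' : Set (Module.Dual k h)} (hSS' : Disjoint S S')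
    {V W : Type u} [AddCommGroup V] [Module k V] [Module (UniversalEnvelopingAlgebra k b) V]
    [IsScalarTower k (UniversalEnvelopingAlgebra k b) V]
    [AddCommGroup W] [Module k W] [Module (UniversalEnvelopingAlgebra k b) W]
    [IsScalarTower k (UniversalEnvelopingAlgebra k b) W] (hV : HasWeightsIn b S V)
    (hW : HasWeightsIn b S' W) (f : V →ₗ[UniversalEnvelopingAlgebra k b] W) : f = 0 := by
  obtain ⟨I, v, χ, -, hv, hs, hχ⟩ := hV.exists_span
  have hle : Submodule.span k (Set.range v) ≤ (LinearMap.ker f).restrictScalars k := by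
    refine Submodule.span_le.mpr ?_
    rintro _ ⟨i, rfl⟩
    by_contra h0
    obtain ⟨μ, hμ, e⟩ := hW.2 (mem_support_iff.mpr ⟨_, map_mem_weightSpace f (hv i), h0⟩)
    rw [(resWeight_bijective hb).1 e] at hμ
    exact Set.disjoint_left.mp hSS' (hχ i) hμ
  exact LinearMap.ext fun m => hle (hs trivial)

/-! ### Exact sequences in full subcategories of modules. -/

section FullSubcategories

variable {R : Type u} [Ring R] {P : ObjectProperty (ModuleCat.{u} R)}

/-- The morphism in a full subcategory of modules defined by a linear map. -/
def homOfLinearMap {X Y : P.FullSubcategory} (f : X.obj →ₗ[R] Y.obj) : X ⟶ Y :=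
  ObjectProperty.homMk (ModuleCat.ofHom f)

lemma linearMap_ext {X Y : P.FullSubcategory} {f g : X ⟶ Y} (h : f.hom.hom = g.hom.hom) : f = g :=
  ObjectProperty.hom_ext _ (ModuleCat.hom_ext h)

variable [P.ContainsZero] [P.IsClosedUnderKernels] [P.IsClosedUnderCokernels]
  [P.IsClosedUnderFiniteProducts]

lemma exists_shortExact {X₁ X₂ X₃ : P.FullSubcategory} (f : X₁.obj →ₗ[R] X₂.obj)
    (g : X₂.obj →ₗ[R] X₃.obj) (hf : Function.Injective f) (hg : Function.Surjective g)
    (hfg : Function.Exact f g) :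
    ∃ w, (ShortComplex.mk (homOfLinearMap f) (homOfLinearMap g) w).ShortExact := by
  have w : homOfLinearMap f ≫ homOfLinearMap g = 0 :=
    linearMap_ext hfg.linearMap_comp_eq_zero
  refine ⟨w, ?_⟩
  have h1 : ((ShortComplex.mk (homOfLinearMap f) (homOfLinearMap g) w).map P.ι).Exact := by
    rw [ShortComplex.ShortExact.moduleCat_exact_iff_function_exact]
    exact hfg
  exact
    { exact := (ShortComplex.exact_map_iff_of_faithful _ P.ι).mp h1
      mono_f := P.ι.mono_of_mono_map ((ModuleCat.mono_iff_injective _).mpr hf)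
      epi_g := P.ι.epi_of_epi_map ((ModuleCat.epi_iff_surjective _).mpr hg) }

lemma surjective_of_epi {X Y : P.FullSubcategory} (q : X ⟶ Y) [Epi q] :
    Function.Surjective q.hom.hom :=
  (ModuleCat.epi_iff_surjective _).mp (inferInstanceAs (Epi (P.ι.map q)))

lemma injective_of_mono {X Y : P.FullSubcategory} (q : X ⟶ Y) [Mono q] :
    Function.Injective q.hom.hom :=
  (ModuleCat.mono_iff_injective _).mp (inferInstanceAs (Mono (P.ι.map q)))

lemma epi_of_surjective {X Y : P.FullSubcategory} (q : X ⟶ Y) (hq : Function.Surjective q.hom.hom) :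
    Epi q := P.ι.epi_of_epi_map ((ModuleCat.epi_iff_surjective _).mpr hq)

end FullSubcategories

/-! ### Dominating surjections onto induced modules. -/

section Cover

variable {k : Type u} [Field k] {g : Type u} [LieRing g] [LieAlgebra k g] {h : LieSubalgebra k g}
  {a b : LieSubalgebra k g} {hab : IsCompl a.toSubmodule b.toSubmodule}
variable {A : Type u} [AddCommGroup A] [Module k A] [Module (UniversalEnvelopingAlgebra k g) A]
  [IsScalarTower k (UniversalEnvelopingAlgebra k g) A]
variable {V : Type u} [AddCommGroup V] [Module k V] [Module (UniversalEnvelopingAlgebra k b) V]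
  [IsScalarTower k (UniversalEnvelopingAlgebra k b) V]

/-- The fibre product of `A` and `V` over the induced module. -/
noncomputable def Ind.fibre (q : A →ₗ[UniversalEnvelopingAlgebra k g] Ind hab V) :
    Submodule (UniversalEnvelopingAlgebra k b) (A × V) :=
  LinearMap.eqLocus (restrictHom b q ∘ₗ LinearMap.fst _ A V) (Ind.unit hab V ∘ₗ LinearMap.snd _ A V)

variable (q : A →ₗ[UniversalEnvelopingAlgebra k g] Ind hab V)

/-- The first projection of the fibre product. -/
noncomputable def Ind.fibreFst : Ind.fibre q →ₗ[UniversalEnvelopingAlgebra k b] A :=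
  LinearMap.fst _ A V ∘ₗ (Ind.fibre q).subtype

/-- The second projection of the fibre product. -/
noncomputable def Ind.fibreSnd : Ind.fibre q →ₗ[UniversalEnvelopingAlgebra k b] V :=
  LinearMap.snd _ A V ∘ₗ (Ind.fibre q).subtype

lemma Ind.fibreSnd_surjective (hq : Function.Surjective q) :
    Function.Surjective (Ind.fibreSnd q) := by
  intro v
  obtain ⟨x, hx⟩ := hq (Ind.unit hab V v)
  exact ⟨⟨⟨x, v⟩, hx⟩, rfl⟩

lemma Ind.comp_lift_fibreFst {W : Type u} [AddCommGroup W] [Module k W]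
    [Module (UniversalEnvelopingAlgebra k b) W] [IsScalarTower k (UniversalEnvelopingAlgebra k b) W]
    (f : W →ₗ[UniversalEnvelopingAlgebra k b] Ind.fibre q) :
    q ∘ₗ Ind.lift hab (Ind.fibreFst q ∘ₗ f) = Ind.map hab (Ind.fibreSnd q ∘ₗ f) := by
  refine Ind.hom_ext fun w => ?_
  rw [LinearMap.comp_apply, Ind.lift_unit, Ind.map_unit]
  exact (f w).2

lemma Ind.hasWeightsIn_fibre {S S' : Set (Module.Dual k h)} (hA : HasWeightsIn b S A)
    (hV : HasWeightsIn b S' V) : HasWeightsIn b (S ∪ S') (Ind.fibre q) := by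
  refine .of_injective (Ind.fibre q).subtype Subtype.val_injective
    ⟨.of_add (LinearMap.inl _ A V) (LinearMap.inr _ A V)
      (fun p => ⟨p.1, p.2, by simp⟩) hA.1 hV.1, ?_⟩
  rw [Set.image_union]
  exact (support_subset_of_jointly_injective (LinearMap.fst _ A V) (LinearMap.snd _ A V)
    fun p h1 h2 => Prod.ext h1 h2).trans (Set.union_subset_union hA.2 hV.2)

lemma Ind.isLocallyFinite_fibre (hA : IsLocallyFinite A (⊤ : Submodule k b))
    (hV : IsLocallyFinite V (⊤ : Submodule k b)) :
    IsLocallyFinite (Ind.fibre q) (⊤ : Submodule k b) :=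
  .of_injective (Ind.fibre q).subtype Subtype.val_injective
    (.of_add (LinearMap.inl _ A V) (LinearMap.inr _ A V) (fun p => ⟨p.1, p.2, by simp⟩) hA hV)

/-- Homomorphisms to the fibre product dominate `q` by homomorphisms of induced modules. -/
lemma Ind.exists_comp_eq_map {W : Type u} [AddCommGroup W] [Module k W]
    [Module (UniversalEnvelopingAlgebra k b) W] [IsScalarTower k (UniversalEnvelopingAlgebra k b) W]
    (f : W →ₗ[UniversalEnvelopingAlgebra k b] Ind.fibre q) :
    ∃ l : Ind hab W →ₗ[UniversalEnvelopingAlgebra k g] A,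
      ∀ w, q (l w) = Ind.map hab (Ind.fibreSnd q ∘ₗ f) w :=
  ⟨_, LinearMap.congr_fun (Ind.comp_lift_fibreFst q f)⟩

end Cover

section WeightCover

variable {k : Type u} [Field k] [CharZero k] [IsAlgClosed k] {g : Type u} [LieRing g]
  [LieAlgebra k g] {h : LieSubalgebra k g} {Φp : Set (Module.Dual k h)} {a b : LieSubalgebra k g}
variable {A : Type u} [AddCommGroup A] [Module k A] [Module (UniversalEnvelopingAlgebra k g) A]
  [IsScalarTower k (UniversalEnvelopingAlgebra k g) A]
variable {V : Type u} [AddCommGroup V] [Module k V] [Module (UniversalEnvelopingAlgebra k b) V]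
  [IsScalarTower k (UniversalEnvelopingAlgebra k b) V]

lemma IsTriangular.exists_injective_comp_surjective (T : IsTriangular Φp a b) {S S' : Set (Module.Dual k h)}
    (hS : ∀ μ ∈ S, ∀ α ∈ Φp, μ + α ∈ S) {W : Type u} [AddCommGroup W] [Module k W]
    [Module (UniversalEnvelopingAlgebra k b) W] [IsScalarTower k (UniversalEnvelopingAlgebra k b) W]
    (f : W →ₗ[UniversalEnvelopingAlgebra k b] V) (hf : Function.Surjective f)
    (hW : HasWeightsIn b S' W) (hV : HasWeightsIn b S V) :
    ∃ (Y : Type u) (_ : AddCommGroup Y) (_ : Module k Y)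
      (_ : Module (UniversalEnvelopingAlgebra k b) Y)
      (_ : IsScalarTower k (UniversalEnvelopingAlgebra k b) Y)
      (i : Y →ₗ[UniversalEnvelopingAlgebra k b] W), Function.Injective i ∧ HasWeightsIn b S Y ∧
      Function.Surjective (f ∘ₗ i) :=
  ⟨T.weightPart hS W, _, _, _, inferInstance, (T.weightPart hS W).subtype, Subtype.val_injective,
    T.hasWeightsIn_weightPart hS, T.surjective_weightPart hS f hf hW hV⟩

/-- A surjection onto an induced module is dominated by a homomorphism of induced modules, with
the same condition on the weights. -/
lemma IsTriangular.exists_cover (T : IsTriangular Φp a b) {S S' : Set (Module.Dual k h)}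
    (hS : ∀ μ ∈ S, ∀ α ∈ Φp, μ + α ∈ S)
    (q : A →ₗ[UniversalEnvelopingAlgebra k g] Ind T.isCompl V) (hq : Function.Surjective q)
    (hA : HasWeightsIn b S' A) (hV : HasWeightsIn b S V) {p : Prop}
    (hA' : p → IsLocallyFinite A (⊤ : Submodule k b))
    (hV' : p → IsLocallyFinite V (⊤ : Submodule k b)) :
    ∃ (W : Type u) (_ : AddCommGroup W) (_ : Module k W)
      (_ : Module (UniversalEnvelopingAlgebra k b) W)
      (_ : IsScalarTower k (UniversalEnvelopingAlgebra k b) W)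
      (r : W →ₗ[UniversalEnvelopingAlgebra k b] V)
      (l : Ind T.isCompl W →ₗ[UniversalEnvelopingAlgebra k g] A), Function.Surjective r ∧
      HasWeightsIn b S W ∧ (p → IsLocallyFinite W (⊤ : Submodule k b)) ∧
      ∀ w, q (l w) = Ind.map T.isCompl r w := by
  obtain ⟨Y, _, _, _, _, i, hi, hY, hs⟩ := T.exists_injective_comp_surjective hS (Ind.fibreSnd q)
    (Ind.fibreSnd_surjective q hq) (Ind.hasWeightsIn_fibre q hA hV) hV
  obtain ⟨l, hl⟩ := Ind.exists_comp_eq_map q i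
  exact ⟨Y, _, _, _, inferInstance, _, l, hs, hY,
    fun hp => .of_injective i hi (Ind.isLocallyFinite_fibre q (hA' hp) (hV' hp)), hl⟩

end WeightCover

/-! ### Vanishing of extensions from induced modules. -/

section ExtensionFull

open scoped ModuleCat

variable {k : Type u} [Field k] [CharZero k] [IsAlgClosed k] {g : Type u} [LieRing g]
  [LieAlgebra k g] {h : LieSubalgebra k g} {Φp : Set (Module.Dual k h)} {a b : LieSubalgebra k g}
  (T : IsTriangular Φp a b)
variable {Q : ObjectProperty (ModuleCat.{u} (UniversalEnvelopingAlgebra k g))}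
  {p : Prop} (hQ : ∀ M, Q M ↔ IsWeightModule h M ∧ (p → IsLocallyFinite M (borel Φp)))

section
variable {V : Type u} [AddCommGroup V] [Module k V] [Module (UniversalEnvelopingAlgebra k b) V]
  [IsScalarTower k (UniversalEnvelopingAlgebra k b) V] {S : Set (Module.Dual k h)}

-- The proposition `p` switches local finiteness on or off, so that `catO` and `catC` are treated
-- together. Working up to isomorphism allows the scalar structure on `N` to be the one restricted
-- from the enveloping algebra instead of the given one on the induced module.
include hQ in
lemma prop_of_equiv {N : ModuleCat.{u} (UniversalEnvelopingAlgebra k g)}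
    (e : N ≃ₗ[UniversalEnvelopingAlgebra k g] Ind T.isCompl V)
    (hV : HasWeightsIn b S V) (hV' : p → IsLocallyFinite V (⊤ : Submodule k b)) : Q N :=
  (hQ _).mpr ⟨.of_injective e.toLinearMap e.injective (T.isWeightModule_ind hV), fun hp =>
    .of_injective e.toLinearMap e.injective (T.isLocallyFinite_ind hV (hV' hp))⟩

include hQ in
lemma prop_ind (hV : HasWeightsIn b S V) (hV' : p → IsLocallyFinite V (⊤ : Submodule k b)) :
    Q (ModuleCat.of (UniversalEnvelopingAlgebra k g) (Ind T.isCompl V)) :=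
  prop_of_equiv T hQ (N := ModuleCat.of (UniversalEnvelopingAlgebra k g) (Ind T.isCompl V))
    (LinearEquiv.refl _ _) hV hV'

end

/-- `M` is isomorphic to a module induced from a `b`-module with weights in `S`. -/
def IsInduced (p : Prop) (S : Set (Module.Dual k h)) (M : Type u) [AddCommGroup M]
    [Module (UniversalEnvelopingAlgebra k g) M] : Prop :=
  ∃ (V : Type u) (_ : AddCommGroup V) (_ : Module k V) (_ : Module (UniversalEnvelopingAlgebra k b) V)
    (_ : IsScalarTower k (UniversalEnvelopingAlgebra k b) V), HasWeightsIn b S V ∧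
    (p → IsLocallyFinite V (⊤ : Submodule k b)) ∧
    Nonempty (M ≃ₗ[UniversalEnvelopingAlgebra k g] Ind T.isCompl V)

variable [Q.ContainsZero] [Q.IsClosedUnderKernels] [Q.IsClosedUnderCokernels]
  [Q.IsClosedUnderFiniteProducts]

open Abelian

include T hQ in
lemma isLocallyFinite_top {M : ModuleCat.{u} (UniversalEnvelopingAlgebra k g)} (hM : Q M) (hp : p) :
    IsLocallyFinite M (⊤ : Submodule k b) := by
  rw [isLocallyFinite_restrict, T.right_eq]
  exact ((hQ _).mp hM).2 hp

include T hQ in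
lemma hasWeightsIn_univ {M : ModuleCat.{u} (UniversalEnvelopingAlgebra k g)} (hM : Q M) :
    HasWeightsIn b (Set.univ : Set (Module.Dual k h)) M :=
  (hasWeightsIn_iff T.le).mpr ⟨((hQ _).mp hM).1, Set.subset_univ _⟩

include hQ in
/-- A surjection of `b`-modules induces a short exact sequence of induced modules. -/
lemma exists_shortExact_ind {V W : Type u} [AddCommGroup V] [Module k V]
    [Module (UniversalEnvelopingAlgebra k b) V] [IsScalarTower k (UniversalEnvelopingAlgebra k b) V]
    [AddCommGroup W] [Module k W] [Module (UniversalEnvelopingAlgebra k b) W]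
    [IsScalarTower k (UniversalEnvelopingAlgebra k b) W] {S : Set (Module.Dual k h)}
    {X : Q.FullSubcategory} (e : X.obj ≃ₗ[UniversalEnvelopingAlgebra k g] Ind T.isCompl V)
    (r : W →ₗ[UniversalEnvelopingAlgebra k b] V) (hr : Function.Surjective r)
    (hW : HasWeightsIn b S W) (hW' : p → IsLocallyFinite W (⊤ : Submodule k b)) :
    ∃ (X₁ : Q.FullSubcategory)
      (f : X₁ ⟶ (⟨_, prop_ind T hQ hW hW'⟩ : Q.FullSubcategory)) (w : f ≫ (homOfLinearMap
        (e.symm.toLinearMap ∘ₗ Ind.map T.isCompl r) : _ ⟶ X) = 0),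
      (ShortComplex.mk _ _ w).ShortExact ∧ IsInduced T p S X₁.obj := by
  have hZ : HasWeightsIn b S (LinearMap.ker r) :=
    hW.of_injective (LinearMap.ker r).subtype Subtype.val_injective
  have hZ' : p → IsLocallyFinite (LinearMap.ker r) (⊤ : Submodule k b) := fun hp =>
    .of_injective (LinearMap.ker r).subtype Subtype.val_injective (hW' hp)
  obtain ⟨w, hw⟩ := exists_shortExact (X₁ := (⟨_, prop_ind T hQ hZ hZ'⟩ : Q.FullSubcategory))
    (X₂ := ⟨_, prop_ind T hQ hW hW'⟩) (X₃ := X)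
    (Ind.map T.isCompl (LinearMap.ker r).subtype) (e.symm.toLinearMap ∘ₗ Ind.map T.isCompl r)
    (Ind.map_injective Subtype.val_injective)
    (e.symm.surjective.comp (Ind.map_surjective hr)) (fun w => by
      rw [← Ind.map_exact (LinearMap.exact_subtype_ker_map r) hr w]
      exact e.symm.map_eq_zero_iff)
  exact ⟨_, _, w, hw, _, _, _, _, _, hZ, hZ', ⟨LinearEquiv.refl _ _⟩⟩

include T hQ in
/-- There are no extensions between modules induced from `b`-modules with weights outside an ideal
and modules with weights in the ideal. -/
lemma ext_eq_zero_of_isInduced [HasExt.{u + 1} Q.FullSubcategory] {K : Set (Module.Dual k h)}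
    (hK : IsWeightIdeal Φp K)
    {X N : Q.FullSubcategory} (hX : IsInduced T p Kᶜ X.obj) (hN : support h N.obj ⊆ K) (n : ℕ)
    (x : Ext X N n) : x = 0 := by
  -- The complement of an ideal is closed upwards, so weight parts outside `K` are `b`-submodules.
  have hS : ∀ μ ∈ Kᶜ, ∀ α ∈ Φp, μ + α ∈ Kᶜ := fun μ hμ α hα hK' => hμ (hK _ hK' _ (by
    rw [WeightLE, add_sub_cancel_left]
    exact AddSubmonoid.subset_closure hα))
  refine Ext.eq_zero_of_dominated (fun X => IsInduced T p Kᶜ X.obj) N ?_ ?_ n X hX x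
  · rintro X ⟨V, _, _, _, _, hV, hV', ⟨e⟩⟩ f
    have hN' : HasWeightsIn b K N.obj := (hasWeightsIn_iff T.le).mpr ⟨((hQ _).mp N.2).1, hN⟩
    -- Frobenius reciprocity: the homomorphism is determined on the generators, where it is a
    -- `b`-map between modules with disjoint weights.
    have h0 : f.hom.hom ∘ₗ e.symm.toLinearMap = 0 := Ind.hom_ext fun v => by
      have := HasWeightsIn.hom_eq_zero T.le disjoint_compl_left hV hN'
        (restrictHom b (f.hom.hom ∘ₗ e.symm.toLinearMap) ∘ₗ Ind.unit T.isCompl V)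
      exact LinearMap.congr_fun this v
    refine linearMap_ext (LinearMap.ext fun x => ?_)
    have := LinearMap.congr_fun h0 (e x)
    rwa [LinearMap.comp_apply, LinearEquiv.coe_coe, e.symm_apply_apply] at this
  · rintro X ⟨V, _, _, _, _, hV, hV', ⟨e⟩⟩ A q _
    obtain ⟨W, _, _, _, _, r, l, hr, hW, hW', hl⟩ := T.exists_cover hS
      (e.toLinearMap ∘ₗ q.hom.hom) (e.surjective.comp (surjective_of_epi q))
      (hasWeightsIn_univ T hQ A.2) hV (isLocallyFinite_top T hQ A.2) hV'
    obtain ⟨X₁, f, w, hw, hX₁⟩ := exists_shortExact_ind T hQ e r hr hW hW'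
    refine ⟨_, hw, rfl, homOfLinearMap (X := ⟨_, prop_ind T hQ hW hW'⟩) l, hX₁, ?_⟩
    exact linearMap_ext (LinearMap.ext fun w => e.symm_apply_eq.mpr (hl w).symm)

end ExtensionFull

/-! ### Extension fullness of the truncated category. -/

section Truncation

open scoped ModuleCat

variable {k : Type u} [Field k] [CharZero k] [IsAlgClosed k] {g : Type u} [LieRing g]
  [LieAlgebra k g] {h : LieSubalgebra k g} {Φp : Set (Module.Dual k h)} {a b : LieSubalgebra k g}
  (T : IsTriangular Φp a b)
include T

section

variable {V : Type u} [AddCommGroup V] [Module k V] [Module (UniversalEnvelopingAlgebra k b) V]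
  [IsScalarTower k (UniversalEnvelopingAlgebra k b) V]

/-- The quotient of a `b`-module by the part with weights in `S`. -/
lemma IsTriangular.exists_exact {S S' : Set (Module.Dual k h)}
    (hS : ∀ μ ∈ S, ∀ α ∈ Φp, μ + α ∈ S) (hV : HasWeightsIn b S' V) :
    ∃ (Y : Type u) (_ : AddCommGroup Y) (_ : Module k Y)
      (_ : Module (UniversalEnvelopingAlgebra k b) Y)
      (_ : IsScalarTower k (UniversalEnvelopingAlgebra k b) Y)
      (Z : Type u) (_ : AddCommGroup Z) (_ : Module k Z)
      (_ : Module (UniversalEnvelopingAlgebra k b) Z)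
      (_ : IsScalarTower k (UniversalEnvelopingAlgebra k b) Z)
      (i : Y →ₗ[UniversalEnvelopingAlgebra k b] V) (r : V →ₗ[UniversalEnvelopingAlgebra k b] Z),
      Function.Injective i ∧ Function.Surjective r ∧ Function.Exact i r ∧ HasWeightsIn b S Y ∧
      HasWeightsIn b (S' \ S) Z ∧
      ∀ (W : Type u) [AddCommGroup W] [Module k W] [Module (UniversalEnvelopingAlgebra k b) W]
        [IsScalarTower k (UniversalEnvelopingAlgebra k b) W], HasWeightsIn b Sᶜ W →
        ∀ f : V →ₗ[UniversalEnvelopingAlgebra k b] W,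
          ∃ f' : Z →ₗ[UniversalEnvelopingAlgebra k b] W, ∀ v, f' (r v) = f v := by
  refine ⟨T.weightPart hS V, _, _, _, inferInstance, V ⧸ T.weightPart hS V, _, _, _, inferInstance,
    (T.weightPart hS V).subtype, (T.weightPart hS V).mkQ, Subtype.val_injective,
    (T.weightPart hS V).mkQ_surjective, LinearMap.exact_subtype_mkQ _,
    T.hasWeightsIn_weightPart hS, T.hasWeightsIn_quotient hS hV, ?_⟩
  intro W _ _ _ _ hW f
  have h0 := HasWeightsIn.hom_eq_zero T.le disjoint_compl_right (T.hasWeightsIn_weightPart hS) hW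
    (f ∘ₗ (T.weightPart hS V).subtype)
  exact ⟨(T.weightPart hS V).liftQ f fun v hv => LinearMap.congr_fun h0 ⟨v, hv⟩,
    fun v => rfl⟩

/-- Induction only lowers weights, so they stay in the ideal `K`; upper finiteness then gives local
finiteness for every such `V`, even of infinite dimension. -/
lemma catKO_of_equiv {K : Set (Module.Dual k h)} (hK : IsWeightIdeal Φp K)
    (hK' : IsUpperFinite Φp K) {N : ModuleCat.{u} (UniversalEnvelopingAlgebra k g)}
    (e : N ≃ₗ[UniversalEnvelopingAlgebra k g] Ind T.isCompl V) (hV : HasWeightsIn b K V) :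
    catKO Φp K N := by
  have h1 := T.isWeightModule_ind hV
  have h2 := T.support_ind_subset hK hV
  exact ⟨⟨.of_injective e.toLinearMap e.injective h1, .of_injective e.toLinearMap e.injective
      (T.isLocallyFinite h1 fun μ hμ => (hK' μ (h2 hμ)).subset fun ν hν => ⟨h2 hν.1, hν.2⟩)⟩,
    (support_subset_of_injective e.toLinearMap e.injective).trans h2⟩

end

variable {Q : ObjectProperty (ModuleCat.{u} (UniversalEnvelopingAlgebra k g))}
  {p : Prop} (hQ : ∀ M, Q M ↔ IsWeightModule h M ∧ (p → IsLocallyFinite M (borel Φp)))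
variable [Q.ContainsZero] [Q.IsClosedUnderKernels] [Q.IsClosedUnderCokernels]
  [Q.IsClosedUnderFiniteProducts]

open Abelian

include hQ in
/-- Extension classes of modules in the truncated category can be effaced in the truncated
category. -/
lemma exists_epi_map_comp_eq_zero [HasExt.{u + 1} Q.FullSubcategory] {K : Set (Module.Dual k h)}
    (hK : IsWeightIdeal Φp K) (hK' : IsUpperFinite Φp K) (hKQ : catKO Φp K ≤ Q)
    (X : (catKO Φp K).FullSubcategory) {N : Q.FullSubcategory} (hN : support h N.obj ⊆ K) (n : ℕ)
    (x : Ext ((ObjectProperty.ιOfLE hKQ).obj X) N (n + 1)) :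
    ∃ (P : (catKO Φp K).FullSubcategory) (f : P ⟶ X), Epi f ∧
      (Ext.mk₀ ((ObjectProperty.ιOfLE hKQ).map f)).comp x (zero_add _) = 0 := by
  have hS : ∀ μ ∈ Kᶜ, ∀ α ∈ Φp, μ + α ∈ Kᶜ := fun μ hμ α hα hK' => hμ (hK _ hK' _ (by
    rw [WeightLE, add_sub_cancel_left]
    exact AddSubmonoid.subset_closure hα))
  obtain ⟨A, q, _, hx⟩ := Ext.exists_epi_comp_eq_zero x
  have hA := hasWeightsIn_univ T hQ A.2
  have hA' := isLocallyFinite_top T hQ A.2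
  -- Only as a `b`-module does `A` have a quotient `Z` by the part `Y` with weights outside `K`; in
  -- general `Y` is not stable under `g`. The map to `X` factors through `Z` since the weights of
  -- `X` lie in `K`.
  obtain ⟨Y, _, _, _, _, Z, _, _, _, _, i, r, hi, hr, hir, hY, hZ, hf⟩ := T.exists_exact hS hA
  replace hZ : HasWeightsIn b K Z := hZ.mono fun μ hμ => not_not.mp hμ.2
  have hX : HasWeightsIn b Kᶜᶜ X.obj := by
    rw [compl_compl, hasWeightsIn_iff T.le]
    exact ⟨X.2.1.1, X.2.2⟩
  obtain ⟨f, hf⟩ := hf X.obj hX (restrictHom b q.hom.hom)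
  have hY' : p → IsLocallyFinite Y (⊤ : Submodule k b) := fun hp => .of_injective i hi (hA' hp)
  let P : (catKO Φp K).FullSubcategory :=
    ⟨ModuleCat.of (UniversalEnvelopingAlgebra k g) (Ind T.isCompl Z),
      catKO_of_equiv T hK hK' (LinearEquiv.refl _ _) hZ⟩
  let pr : P ⟶ X := homOfLinearMap (X := P) (Ind.lift T.isCompl f)
  refine ⟨P, pr, epi_of_surjective _ fun y => ?_, ?_⟩
  · obtain ⟨y, rfl⟩ := surjective_of_epi q y
    exact ⟨Ind.unit T.isCompl Z (r y), (Ind.lift_unit f _).trans (hf y)⟩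
  · let X₁ : Q.FullSubcategory := ⟨_, prop_ind T hQ hY hY'⟩
    let X₂ : Q.FullSubcategory := ⟨_, prop_ind T hQ hA hA'⟩
    obtain ⟨w, hw⟩ := exists_shortExact (X₁ := X₁) (X₂ := X₂)
      (X₃ := (ObjectProperty.ιOfLE hKQ).obj P) (Ind.map T.isCompl i) (Ind.map T.isCompl r)
      (Ind.map_injective hi) (Ind.map_surjective hr) (Ind.map_exact hir hr)
    let l : X₂ ⟶ A := homOfLinearMap (X := X₂) (Ind.lift T.isCompl LinearMap.id)
    -- On `Ind A`, the map to `X` through `Ind Z` equals the counit `Ind A ⟶ A` followed by `q`, and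
    -- therefore kills `x`.
    have hl : homOfLinearMap (X := X₂) (Y := (ObjectProperty.ιOfLE hKQ).obj P)
        (Ind.map T.isCompl r) ≫ (ObjectProperty.ιOfLE hKQ).map pr = l ≫ q := by
      refine linearMap_ext (Ind.hom_ext fun v => ?_)
      change Ind.lift T.isCompl f (Ind.map T.isCompl r (Ind.unit T.isCompl A.obj v)) =
        q.hom.hom (Ind.lift T.isCompl LinearMap.id (Ind.unit T.isCompl A.obj v))
      rw [Ind.map_unit, Ind.lift_unit, Ind.lift_unit]
      exact hf v
    have h0 : (Ext.mk₀ (homOfLinearMap (X := X₂) (Y := (ObjectProperty.ιOfLE hKQ).obj P)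
        (Ind.map T.isCompl r))).comp ((Ext.mk₀ ((ObjectProperty.ιOfLE hKQ).map pr)).comp x
          (zero_add _)) (zero_add _) = 0 := by
      rw [Ext.mk₀_comp_mk₀_assoc, hl, ← Ext.mk₀_comp_mk₀_assoc, hx, Ext.comp_zero]
    obtain ⟨y, hy⟩ := Ext.contravariant_sequence_exact₃ hw _ _ h0 (add_comm 1 n)
    -- The pullback of `x` to `Ind Z` comes from a class `y` on `Ind Y`, and there are no such
    -- nonzero classes.
    rw [← hy, ext_eq_zero_of_isInduced T hQ hK (X := X₁)
      ⟨_, _, _, _, inferInstance, hY, hY', ⟨LinearEquiv.refl _ _⟩⟩ hN n y, Ext.comp_zero]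

include hQ in
theorem isExtensionFull_of_le {K : Set (Module.Dual k h)}
    (hK : IsWeightIdeal Φp K) (hK' : IsUpperFinite Φp K) (hKQ : catKO Φp K ≤ Q) :
    IsExtensionFull (ObjectProperty.ιOfLE hKQ) := by
  intro X Y n
  let _ := HasExt.standard (catKO Φp K).FullSubcategory
  let _ := HasExt.standard Q.FullSubcategory
  exact Ext.mapExtAddHom_bijective_of_forall_effaceable _ Y
    (fun X n x => exists_epi_map_comp_eq_zero T hQ hK hK' hKQ X Y.2.2 n x) n X

end Truncation

/-! ### Induction along finite filtrations. -/

section Flags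

variable {k : Type u} [Field k] {g : Type u} [LieRing g] [LieAlgebra k g]
variable {P : ObjectProperty (ModuleCat.{u} (UniversalEnvelopingAlgebra k g))}
  [P.ContainsZero] [P.IsClosedUnderSubobjects] [P.IsClosedUnderQuotients]
  [P.IsClosedUnderFiniteProducts]

/-- A class of modules which is closed under extensions and contains `0` and all `X i` contains all
modules with a flag with subquotients `X i`. -/
lemma HasFlag.induction {ι : Type u} {X : ι → Type u} [∀ i, AddCommGroup (X i)]
    [∀ i, Module (UniversalEnvelopingAlgebra k g) (X i)] (Z : P.FullSubcategory → Prop)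
    (h0 : ∀ Y, Subsingleton Y.obj → Z Y)
    (hext : ∀ S : ShortComplex P.FullSubcategory, S.ShortExact → Z S.X₁ → Z S.X₃ → Z S.X₂)
    (hX : ∀ Y i, Nonempty (Y.obj ≃ₗ[UniversalEnvelopingAlgebra k g] X i) → Z Y)
    {M : P.FullSubcategory} (hM : HasFlag (k := k) (g := g) X M.obj) : Z M := by
  obtain ⟨n, F, hF0, hFn, hF⟩ := hM
  have hsub (L : Submodule (UniversalEnvelopingAlgebra k g) M.obj) :
      P (ModuleCat.of (UniversalEnvelopingAlgebra k g) L) := by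
    have : Mono (ModuleCat.ofHom L.subtype) :=
      (ModuleCat.mono_iff_injective _).mpr Subtype.val_injective
    exact P.prop_of_mono (ModuleCat.ofHom L.subtype) M.2
  -- Induct on the number `j` of remaining steps, starting from the zero submodule `F n`. All
  -- isomorphic copies are included, so that `M` itself can stand for `F 0`.
  have key : ∀ j i, i + j = n → ∀ Y : P.FullSubcategory,
      Nonempty (Y.obj ≃ₗ[UniversalEnvelopingAlgebra k g] F i) → Z Y := by
    intro j
    induction j with
    | zero =>
      rintro i rfl Y ⟨e⟩
      refine h0 Y ?_
      rw [add_zero] at hFn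
      rw [hFn] at e
      exact e.toEquiv.subsingleton
    | succ j ih =>
      rintro i hi Y ⟨e⟩
      obtain ⟨hle, μ, ⟨e'⟩⟩ := hF i (by omega)
      let L := (F (i + 1)).submoduleOf (F i)
      have hq : P (ModuleCat.of (UniversalEnvelopingAlgebra k g) (F i ⧸ L)) := by
        have : Epi (ModuleCat.ofHom L.mkQ) := (ModuleCat.epi_iff_surjective _).mpr L.mkQ_surjective
        exact P.prop_of_epi (ModuleCat.ofHom L.mkQ) (hsub (F i))
      obtain ⟨w, hw⟩ := exists_shortExact (X₁ := (⟨_, hsub (F (i + 1))⟩ : P.FullSubcategory))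
        (X₂ := Y) (X₃ := ⟨_, hq⟩) (e.symm.toLinearMap ∘ₗ Submodule.inclusion hle)
        (L.mkQ ∘ₗ e.toLinearMap) (e.symm.injective.comp (Submodule.inclusion_injective hle))
        (L.mkQ_surjective.comp e.surjective) (fun y => by
          change L.mkQ (e y) = 0 ↔ _
          rw [Submodule.mkQ_apply, Submodule.Quotient.mk_eq_zero]
          refine ⟨fun hy => ⟨⟨e y, hy⟩, e.symm_apply_apply y⟩, ?_⟩
          rintro ⟨z, rfl⟩
          change (e (e.symm _) : M.obj) ∈ F (i + 1)
          rw [e.apply_symm_apply]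
          exact z.2)
      exact hext _ hw (ih (i + 1) (by omega) _ ⟨LinearEquiv.refl _ _⟩) (hX _ μ ⟨e'⟩)
  refine key n 0 (zero_add n) M ?_
  rw [hF0]
  exact ⟨Submodule.topEquiv.symm⟩

end Flags

/-! ### Verma modules as induced modules. -/

section Verma

variable {k : Type u} [Field k] [CharZero k] [IsAlgClosed k] {g : Type u} [LieRing g]
  [LieAlgebra k g] {h : LieSubalgebra k g} {Φp : Set (Module.Dual k h)} {a b : LieSubalgebra k g}
  (T : IsTriangular Φp a b)
include T

variable (Φp) in
omit [CharZero k] [IsAlgClosed k] T in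
lemma ι_smul_mk_one (lam : Module.Dual k h) {x : g} (hx : x ∈ nPos Φp) :
    ι k x • (Submodule.Quotient.mk 1 : Verma Φp lam) = 0 := by
  rw [← Submodule.Quotient.mk_smul, Submodule.Quotient.mk_eq_zero, smul_eq_mul, mul_one]
  exact Submodule.subset_span (Or.inl ⟨x, hx, rfl⟩)

variable (Φp) in
omit [CharZero k] [IsAlgClosed k] T in
lemma ι_smul_mk_one_of_cartan (lam : Module.Dual k h) (H : h) :
    ι k (H : g) • (Submodule.Quotient.mk 1 : Verma Φp lam) = lam H • Submodule.Quotient.mk 1 := by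
  rw [← Submodule.Quotient.mk_smul, ← Submodule.Quotient.mk_smul, Submodule.Quotient.eq,
    smul_eq_mul, mul_one, ← Algebra.algebraMap_eq_smul_one]
  exact Submodule.subset_span (Or.inr ⟨H, rfl⟩)

/-- Verma modules are induced from finite dimensional `b`-submodules. -/
lemma IsTriangular.exists_verma_equiv (lam : Module.Dual k h) :
    ∃ V : Submodule (UniversalEnvelopingAlgebra k b) (Verma Φp lam), FiniteDimensional k V ∧
      HasWeightsIn b {lam} V ∧ Nonempty (Verma Φp lam ≃ₗ[UniversalEnvelopingAlgebra k g] Ind T.isCompl V) := by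
  let v : Verma Φp lam := Submodule.Quotient.mk 1
  have hv : ∀ x : b, ι k x • v ∈ Submodule.span k {v} := by
    rintro ⟨x, hx⟩
    rw [restrict_ι_smul]
    have hx' : x ∈ borel Φp := T.right_eq ▸ hx
    obtain ⟨H, hH, y, hy, rfl⟩ := Submodule.mem_sup.mp hx'
    refine Submodule.mem_span_singleton.mpr ⟨lam ⟨H, hH⟩, ?_⟩
    rw [map_add, add_smul, ι_smul_mk_one Φp lam hy, add_zero]
    exact (ι_smul_mk_one_of_cartan Φp lam ⟨H, hH⟩).symm
  -- The line spanned by the canonical generator. The argument does not need to know that the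
  -- generator is nonzero.
  let V : Submodule (UniversalEnvelopingAlgebra k b) (Verma Φp lam) :=
    submoduleOfForall (Submodule.span k {v}) fun x m hm => by
      obtain ⟨c, rfl⟩ := Submodule.mem_span_singleton.mp hm
      rw [smul_comm]
      exact Submodule.smul_mem _ _ (hv x)
  have hvV : v ∈ V := Submodule.mem_span_singleton_self v
  have hVfin : FiniteDimensional k V :=
    inferInstanceAs (FiniteDimensional k (Submodule.span k {v}))
  let v' : V := ⟨v, hvV⟩
  let φ : Ind T.isCompl V →ₗ[UniversalEnvelopingAlgebra k g] Verma Φp lam :=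
    Ind.lift T.isCompl V.subtype
  have hunit : ∀ x (hx : x ∈ b), ι k x • Ind.unit T.isCompl V v' =
      Ind.unit T.isCompl V (ι k (⟨x, hx⟩ : b) • v') := fun x hx => by
    rw [map_smul, restrict_ι_smul]
  -- The vector `1 ⊗ v` satisfies the defining relations of the Verma module; the resulting map is
  -- inverse to `φ` since both match the generators.
  let ψ : Verma Φp lam →ₗ[UniversalEnvelopingAlgebra k g] Ind T.isCompl V :=
    (vermaIdeal Φp lam).liftQ (LinearMap.toSpanSingleton _ _ (Ind.unit T.isCompl V v')) (by
      refine Submodule.span_le.mpr ?_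
      rintro _ (⟨x, hx, rfl⟩ | ⟨H, rfl⟩)
      · have hxb : x ∈ b := by
          change x ∈ b.toSubmodule
          rw [T.right_eq]
          exact le_sup_right (a := h.toSubmodule) hx
        change ι k x • Ind.unit T.isCompl V v' = 0
        have : ι k (⟨x, hxb⟩ : b) • v' = 0 := Subtype.ext (by
          change ι k (⟨x, hxb⟩ : b) • v = 0
          rw [restrict_ι_smul]
          exact ι_smul_mk_one Φp lam hx)
        rw [hunit x hxb, this, map_zero]
      · change (ι k (H : g) - algebraMap k _ (lam H)) • Ind.unit T.isCompl V v' = 0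
        have : ι k (⟨H, T.le H.2⟩ : b) • v' = lam H • v' := Subtype.ext (by
          change ι k (⟨H, T.le H.2⟩ : b) • v = lam H • v
          rw [restrict_ι_smul]
          exact ι_smul_mk_one_of_cartan Φp lam H)
        rw [sub_smul, hunit H (T.le H.2), this, algebraMap_smul,
          ← LinearMap.restrictScalars_apply k, map_smul]
        exact sub_self _)
  have hψ : ψ v = Ind.unit T.isCompl V v' :=
    one_smul (UniversalEnvelopingAlgebra k g) (Ind.unit T.isCompl V v')
  have hVw : HasWeightsIn b {lam} V := by
    refine .of_span (v := fun _ : Unit => v') (χ := fun _ => lam) (fun _ => ?_) ?_ fun _ => rfl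
    · refine fun H => Subtype.ext ?_
      change ι k (H : b) • v = resWeight b lam H • v
      rw [restrict_ι_smul, resWeight_apply]
      exact ι_smul_mk_one_of_cartan Φp lam (⟨H.1, H.2⟩ : h)
    · rintro ⟨m, hm⟩ -
      obtain ⟨c, rfl⟩ := Submodule.mem_span_singleton.mp hm
      have h1 : v' ∈ Submodule.span k (Set.range fun _ : Unit => v') :=
        Submodule.subset_span ⟨(), rfl⟩
      exact (Submodule.span k (Set.range fun _ : Unit => v')).smul_mem c h1
  refine ⟨V, hVfin, hVw, ⟨LinearEquiv.ofLinearMap ψ φ ?_ ?_⟩⟩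
  · refine Ind.hom_ext ?_
    rintro ⟨m, hm⟩
    obtain ⟨c, rfl⟩ := Submodule.mem_span_singleton.mp hm
    change ψ (φ (Ind.unit T.isCompl V (c • v'))) = Ind.unit T.isCompl V (c • v')
    have h1 : φ (Ind.unit T.isCompl V (c • v')) = c • v := Ind.lift_unit _ _
    have h2 : ψ (c • v) = c • ψ v := map_smul (ψ.restrictScalars k) c v
    have h3 : Ind.unit T.isCompl V (c • v') = c • Ind.unit T.isCompl V v' :=
      map_smul ((Ind.unit T.isCompl V).restrictScalars k) c v'
    rw [h1, h2, h3, hψ]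
  · refine Submodule.linearMap_qext _ (LinearMap.ext_ring ?_)
    change φ (ψ v) = v
    rw [hψ]
    exact Ind.lift_unit _ _

end Verma

lemma HasWeightsIn.of_subsingleton {k : Type u} [Field k] {g : Type u} [LieRing g]
    [LieAlgebra k g] {h b : LieSubalgebra k g} {S : Set (Module.Dual k h)} {V : Type u}
    [AddCommGroup V] [Module k V] [Module (UniversalEnvelopingAlgebra k b) V]
    [IsScalarTower k (UniversalEnvelopingAlgebra k b) V] [Subsingleton V] : HasWeightsIn b S V :=
  ⟨.of_subsingleton, by rw [support_of_subsingleton]; exact Set.empty_subset _⟩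

instance Ind.subsingleton {k : Type u} [Field k] {g : Type u} [LieRing g] [LieAlgebra k g]
    {a b : LieSubalgebra k g} {hab : IsCompl a.toSubmodule b.toSubmodule} {V : Type u}
    [AddCommGroup V] [Module k V] [Module (UniversalEnvelopingAlgebra k b) V]
    [IsScalarTower k (UniversalEnvelopingAlgebra k b) V] [Subsingleton V] :
    Subsingleton (Ind hab V) := by
  have h0 : (LinearMap.id : Ind hab V →ₗ[UniversalEnvelopingAlgebra k g] Ind hab V) = 0 :=
    Ind.hom_ext fun v => by rw [Subsingleton.elim v 0, map_zero, map_zero, map_zero]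
  exact ⟨fun x y => (LinearMap.congr_fun h0 x).trans (LinearMap.congr_fun h0 y).symm⟩

/-! ### Covers by modules induced from finite dimensional modules. -/

section FiniteCover

variable {k : Type u} [Field k] [CharZero k] [IsAlgClosed k] {g : Type u} [LieRing g]
  [LieAlgebra k g] {h : LieSubalgebra k g} {Φp : Set (Module.Dual k h)} {a b : LieSubalgebra k g}

/-- Lifts of a finite spanning set of `V` lie in a finite dimensional submodule of `W`. -/
lemma IsLocallyFinite.exists_finite_cover {c : Type u} [LieRing c] [LieAlgebra k c]
    {V W : Type u} [AddCommGroup V] [Module k V]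
    [Module (UniversalEnvelopingAlgebra k c) V] [IsScalarTower k (UniversalEnvelopingAlgebra k c) V]
    [AddCommGroup W] [Module k W] [Module (UniversalEnvelopingAlgebra k c) W]
    [IsScalarTower k (UniversalEnvelopingAlgebra k c) W] [FiniteDimensional k V]
    (hW : IsLocallyFinite W (⊤ : Submodule k c))
    (f : W →ₗ[UniversalEnvelopingAlgebra k c] V) (hf : Function.Surjective f) :
    ∃ (Y : Type u) (_ : AddCommGroup Y) (_ : Module k Y)
      (_ : Module (UniversalEnvelopingAlgebra k c) Y)
      (_ : IsScalarTower k (UniversalEnvelopingAlgebra k c) Y)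
      (i : Y →ₗ[UniversalEnvelopingAlgebra k c] W), FiniteDimensional k Y ∧ Function.Injective i ∧
      Function.Surjective (f ∘ₗ i) := by
  obtain ⟨F, hF, hs⟩ := hW.exists_surjective f hf
  exact ⟨F, _, _, _, inferInstance, F.subtype, hF, Subtype.val_injective, hs⟩

variable {A : Type u} [AddCommGroup A] [Module k A] [Module (UniversalEnvelopingAlgebra k g) A]
  [IsScalarTower k (UniversalEnvelopingAlgebra k g) A]
variable {V : Type u} [AddCommGroup V] [Module k V] [Module (UniversalEnvelopingAlgebra k b) V]
  [IsScalarTower k (UniversalEnvelopingAlgebra k b) V]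

/-- A surjection from a locally finite module onto the module induced from a finite dimensional
module `V` is dominated by a homomorphism of modules induced from finite dimensional modules. -/
lemma IsTriangular.exists_finite_cover (T : IsTriangular Φp a b) [FiniteDimensional k V]
    {K : Set (Module.Dual k h)}
    (q : A →ₗ[UniversalEnvelopingAlgebra k g] Ind T.isCompl V) (hq : Function.Surjective q)
    (hA : HasWeightsIn b K A) (hA' : IsLocallyFinite A (⊤ : Submodule k b))
    (hV : HasWeightsIn b K V) :
    ∃ (W : Type u) (_ : AddCommGroup W) (_ : Module k W)
      (_ : Module (UniversalEnvelopingAlgebra k b) W)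
      (_ : IsScalarTower k (UniversalEnvelopingAlgebra k b) W)
      (W' : Type u) (_ : AddCommGroup W') (_ : Module k W')
      (_ : Module (UniversalEnvelopingAlgebra k b) W')
      (_ : IsScalarTower k (UniversalEnvelopingAlgebra k b) W')
      (i : W' →ₗ[UniversalEnvelopingAlgebra k b] W)
      (r : W →ₗ[UniversalEnvelopingAlgebra k b] V)
      (l : Ind T.isCompl W →ₗ[UniversalEnvelopingAlgebra k g] A),
      FiniteDimensional k W' ∧ FiniteDimensional k W ∧ HasWeightsIn b K W' ∧ HasWeightsIn b K W ∧
      Function.Injective i ∧ Function.Surjective r ∧ Function.Exact i r ∧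
      ∀ w, q (l w) = Ind.map T.isCompl r w := by
  obtain ⟨W, _, _, _, _, i, hW, hi, hs⟩ :=
    (Ind.isLocallyFinite_fibre q hA' (.of_finiteDimensional _)).exists_finite_cover
      (Ind.fibreSnd q) (Ind.fibreSnd_surjective q hq)
  obtain ⟨l, hl⟩ := Ind.exists_comp_eq_map q i
  have hW' : HasWeightsIn b K W :=
    (Set.union_self K ▸ Ind.hasWeightsIn_fibre q hA hV).of_injective i hi
  let r := Ind.fibreSnd q ∘ₗ i
  refine ⟨W, _, _, _, inferInstance, LinearMap.ker r, _, _, _, inferInstance,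
    (LinearMap.ker r).subtype, r, l, ?_, hW, ?_, hW', Subtype.val_injective, hs,
    LinearMap.exact_subtype_ker_map r, hl⟩
  · exact inferInstanceAs (FiniteDimensional k (LinearMap.ker (r.restrictScalars k)))
  · exact hW'.of_injective (LinearMap.ker r).subtype Subtype.val_injective

end FiniteCover

/-! ### Extensions from modules with a Verma flag. -/

section FinitelyInduced

open scoped ModuleCat

variable {k : Type u} [Field k] [CharZero k] [IsAlgClosed k] {g : Type u} [LieRing g]
  [LieAlgebra k g] {h : LieSubalgebra k g} {Φp : Set (Module.Dual k h)} {a b : LieSubalgebra k g}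
  (T : IsTriangular Φp a b) {K : Set (Module.Dual k h)}

/-- `M` is isomorphic to a module induced from a finite dimensional `b`-module with weights
in `K`. -/
def IsFinitelyInduced (T : IsTriangular Φp a b) (K : Set (Module.Dual k h)) (M : Type u)
    [AddCommGroup M] [Module (UniversalEnvelopingAlgebra k g) M] : Prop :=
  ∃ (V : Type u) (_ : AddCommGroup V) (_ : Module k V) (_ : Module (UniversalEnvelopingAlgebra k b) V)
    (_ : IsScalarTower k (UniversalEnvelopingAlgebra k b) V), FiniteDimensional k V ∧
    HasWeightsIn b K V ∧ Nonempty (M ≃ₗ[UniversalEnvelopingAlgebra k g] Ind T.isCompl V)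

variable (hK : IsWeightIdeal Φp K) (hK' : IsUpperFinite Φp K)
include T hK hK'

section
variable {V : Type u} [AddCommGroup V] [Module k V] [Module (UniversalEnvelopingAlgebra k b) V]
  [IsScalarTower k (UniversalEnvelopingAlgebra k b) V] [FiniteDimensional k V]

lemma catKObar_of_equiv {N : ModuleCat.{u} (UniversalEnvelopingAlgebra k g)}
    (e : N ≃ₗ[UniversalEnvelopingAlgebra k g] Ind T.isCompl V) (hV : HasWeightsIn b K V) :
    catKObar Φp K N :=
  ⟨catKO_of_equiv T hK hK' e hV,
    .of_injective e.toLinearMap e.injective (T.hasFiniteWeightSpaces_ind hV)⟩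

lemma catKObar_ind (hV : HasWeightsIn b K V) :
    catKObar Φp K (ModuleCat.of (UniversalEnvelopingAlgebra k g) (Ind T.isCompl V)) :=
  catKObar_of_equiv T hK hK' (N := ModuleCat.of (UniversalEnvelopingAlgebra k g) _)
    (LinearEquiv.refl _ _) hV

end

/-- Every epimorphism from the larger category onto a finitely induced module is dominated by one of
finitely induced modules with finitely induced kernel. These have finite dimensional weight spaces,
so dimension shifting stays in the smaller category. -/
lemma extMapBijective_of_isFinitelyInduced {M N : (catKObar Φp K).FullSubcategory}
    (hM : IsFinitelyInduced T K M.obj) (n : ℕ) :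
    ExtMapBijective (ObjectProperty.ιOfLE (catKObar_le_catKO Φp K)) M N n := by
  let _ := HasExt.standard (catKO Φp K).FullSubcategory
  let _ := HasExt.standard (catKObar Φp K).FullSubcategory
  refine Abelian.Ext.mapExtAddHom_bijective_of_dominated _
    (fun X : (catKObar Φp K).FullSubcategory => IsFinitelyInduced T K X.obj) ?_ n M N hM
  rintro X ⟨V, _, _, _, _, _, hV, ⟨e⟩⟩ A q _
  have hA : HasWeightsIn b K A.obj := (hasWeightsIn_iff T.le).mpr ⟨A.2.1.1, A.2.2⟩
  have hA' : IsLocallyFinite A.obj (⊤ : Submodule k b) := by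
    rw [isLocallyFinite_restrict, T.right_eq]
    exact A.2.1.2
  obtain ⟨W, _, _, _, _, W', _, _, _, _, i, r, l, _, _, hW', hW, hi, hr, hir, hl⟩ :=
    T.exists_finite_cover (e.toLinearMap ∘ₗ q.hom.hom) (e.surjective.comp (surjective_of_epi q))
      hA hA' hV
  obtain ⟨w, hw⟩ := exists_shortExact
    (X₁ := (⟨_, catKObar_ind T hK hK' hW'⟩ : (catKObar Φp K).FullSubcategory))
    (X₂ := ⟨_, catKObar_ind T hK hK' hW⟩) (X₃ := X)
    (Ind.map T.isCompl i) (e.symm.toLinearMap ∘ₗ Ind.map T.isCompl r)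
    (Ind.map_injective hi) (e.symm.surjective.comp (Ind.map_surjective hr)) (fun w => by
      rw [← Ind.map_exact hir hr w]
      exact e.symm.map_eq_zero_iff)
  refine ⟨_, hw, rfl, homOfLinearMap (X := (ObjectProperty.ιOfLE (catKObar_le_catKO Φp K)).obj
      ⟨_, catKObar_ind T hK hK' hW⟩) l,
    ⟨_, _, _, _, inferInstance, inferInstance, hW', ⟨LinearEquiv.refl _ _⟩⟩,
    ⟨_, _, _, _, inferInstance, inferInstance, hW, ⟨LinearEquiv.refl _ _⟩⟩, ?_⟩
  exact linearMap_ext (LinearMap.ext fun w => e.symm_apply_eq.mpr (hl w).symm)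

/-- Extension groups of modules with a Verma flag agree in the two truncated categories. -/
lemma extMapBijective_of_hasVermaFlag {M N : (catKObar Φp K).FullSubcategory}
    (hM : HasVermaFlag Φp M.obj) (n : ℕ) :
    ExtMapBijective (ObjectProperty.ιOfLE (catKObar_le_catKO Φp K)) M N n := by
  refine HasFlag.induction (fun Y : (catKObar Φp K).FullSubcategory => ∀ n,
    ExtMapBijective (ObjectProperty.ιOfLE (catKObar_le_catKO Φp K)) Y N n) ?_ ?_ ?_ hM n
  · intro Y hY n
    exact extMapBijective_of_isFinitelyInduced T hK hK' ⟨PUnit, inferInstance, inferInstance,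
      inferInstance, inferInstance, inferInstance, .of_subsingleton,
      ⟨0⟩⟩ n
  · intro S hS h1 h3 n
    let _ := HasExt.standard (catKO Φp K).FullSubcategory
    let _ := HasExt.standard (catKObar Φp K).FullSubcategory
    exact Abelian.Ext.mapExtAddHom_bijective_X₂_of_contravariant _ hS N h1 h3 n
  · rintro Y lam ⟨e⟩ n
    obtain ⟨V, hV, -, ⟨e'⟩⟩ := T.exists_verma_equiv lam
    -- The weights lie in `K` because the subquotients of a flag on an object of the category belong
    -- to it.
    have hV' : HasWeightsIn b K (Verma Φp lam) := (hasWeightsIn_iff T.le).mpr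
      ⟨.of_surjective e.toLinearMap e.surjective Y.2.1.1.1,
        (support_subset_of_surjective e.toLinearMap e.surjective Y.2.1.1.1).trans Y.2.1.2⟩
    exact extMapBijective_of_isFinitelyInduced T hK hK' ⟨V, _, _, _, inferInstance, hV,
      hV'.of_injective V.subtype Subtype.val_injective, ⟨e.trans e'⟩⟩ n

end FinitelyInduced

/-! ### Twisted duals and exactness of the contragredient. -/

section TwistedDual

variable {k : Type u} [Field k] {g : Type u} [LieRing g] [LieAlgebra k g] {h : LieSubalgebra k g}
  {τ : TransposeMap h}
variable {M : Type u} [AddCommGroup M] [Module k M] [Module (UniversalEnvelopingAlgebra k g) M]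
  [IsScalarTower k (UniversalEnvelopingAlgebra k g) M]
variable {N : Type u} [AddCommGroup N] [Module k N] [Module (UniversalEnvelopingAlgebra k g) N]
  [IsScalarTower k (UniversalEnvelopingAlgebra k g) N]

namespace TwistedDual

/-- The underlying functional of an element of the twisted dual. -/
def toDual : TwistedDual τ M ≃ₗ[k] Module.Dual k M := LinearEquiv.refl k (Module.Dual k M)

lemma toDual_ι_smul (x : g) (f : TwistedDual τ M) (m : M) :
    toDual (ι k x • f) m = toDual f (ι k (τ.toLinearMap x) • m) :=
  twistedDual_ι_smul τ M x f m

lemma ext {f f' : TwistedDual τ M} (H : ∀ m, toDual f m = toDual f' m) : f = f' :=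
  toDual.injective (LinearMap.ext H)

lemma ext_of_isWeightModule (hM : IsWeightModule h M) {f f' : TwistedDual τ M}
    (H : ∀ μ, ∀ m ∈ weightSpace h M μ, toDual f m = toDual f' m) : f = f' := by
  refine ext fun m => ?_
  obtain ⟨s, v, hv, rfl⟩ := hM.exists_sum m
  rw [map_sum, map_sum]
  exact Finset.sum_congr rfl fun μ _ => H μ _ (hv μ)

/-- As `τ` fixes `h`, its elements are selfadjoint for the pairing, so distinct weights are
orthogonal. -/
lemma toDual_eq_zero {μ ν : Module.Dual k h} (hμν : μ ≠ ν) {f : TwistedDual τ M}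
    (hf : f ∈ weightSpace h (TwistedDual τ M) μ) {m : M} (hm : m ∈ weightSpace h M ν) :
    toDual f m = 0 := by
  obtain ⟨H, hH⟩ : ∃ H, μ H ≠ ν H := by
    by_contra! hcon
    exact hμν (LinearMap.ext hcon)
  have h1 := toDual_ι_smul (H : g) f m
  rw [hf H, τ.map_cartan, hm H, map_smul, map_smul, LinearMap.smul_apply, smul_eq_mul, smul_eq_mul,
    ← sub_eq_zero, ← sub_mul] at h1
  exact (mul_eq_zero.mp h1).resolve_left (sub_ne_zero.mpr hH)

lemma mem_weightSpace_of_forall (hM : IsWeightModule h M) {μ : Module.Dual k h}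
    {f : TwistedDual τ M} (hf : ∀ ν, ν ≠ μ → ∀ m ∈ weightSpace h M ν, toDual f m = 0) :
    f ∈ weightSpace h (TwistedDual τ M) μ := by
  intro H
  refine ext_of_isWeightModule hM fun ν m hm => ?_
  rw [toDual_ι_smul, τ.map_cartan, hm H, map_smul, map_smul, LinearMap.smul_apply]
  by_cases e : ν = μ
  · rw [e]
  · rw [hf ν e m hm, smul_zero, smul_zero]

/-- Every functional can be changed outside of a weight space to give a weight vector. -/
lemma exists_mem_weightSpace (hM : IsWeightModule h M) (μ : Module.Dual k h)
    (f : Module.Dual k M) : ∃ f' ∈ weightSpace h (TwistedDual τ M) μ,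
      ∀ m ∈ weightSpace h M μ, toDual f' m = f m := by
  have hc : IsCompl (weightSpace h M μ) (⨆ ν, ⨆ (_ : ν ≠ μ), weightSpace h M ν) := by
    refine ⟨iSupIndep_weightSpace h M μ, codisjoint_iff.mpr (eq_top_iff.mpr ?_)⟩
    rw [← hM]
    refine iSup_le fun ν => ?_
    by_cases e : ν = μ
    · rw [e]; exact le_sup_left
    · exact (le_iSup₂ (f := fun ν (_ : ν ≠ μ) => weightSpace h M ν) ν e).trans le_sup_right
  let f' : TwistedDual τ M :=
    toDual.symm (LinearMap.ofIsCompl hc (f ∘ₗ (weightSpace h M μ).subtype) 0)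
  refine ⟨f', mem_weightSpace_of_forall hM fun ν hν m hm => ?_, fun m hm => ?_⟩
  · have hm' : m ∈ ⨆ ν, ⨆ (_ : ν ≠ μ), weightSpace h M ν :=
      le_iSup₂ (f := fun ν (_ : ν ≠ μ) => weightSpace h M ν) ν hν hm
    exact LinearMap.ofIsCompl_apply_right hc ⟨m, hm'⟩
  · exact LinearMap.ofIsCompl_apply_left hc ⟨m, hm⟩

/-- The adjoint of a homomorphism to a twisted dual. -/
noncomputable def flip (f : N →ₗ[UniversalEnvelopingAlgebra k g] TwistedDual τ M) :
    M →ₗ[UniversalEnvelopingAlgebra k g] TwistedDual τ N :=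
  homOfForall (toDual.symm.toLinearMap ∘ₗ (toDual.toLinearMap ∘ₗ f.restrictScalars k).flip)
    fun x m => ext fun n => by
      rw [toDual_ι_smul]
      change toDual (f n) (ι k x • m) = toDual (f (ι k (τ.toLinearMap x) • n)) m
      rw [map_smul f, toDual_ι_smul, τ.involutive]

lemma support_subset (hM : IsWeightModule h M) : support h (TwistedDual τ M) ⊆ support h M := by
  intro μ hμ
  obtain ⟨f, hf, h0⟩ := mem_support_iff.mp hμ
  by_contra hμ'
  refine h0 (ext_of_isWeightModule hM fun ν m hm => ?_)
  rw [map_zero, LinearMap.zero_apply]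
  by_cases e : μ = ν
  · subst e
    have : m = 0 := by
      by_contra hm0
      exact hμ' (mem_support_iff.mpr ⟨m, hm, hm0⟩)
    rw [this, map_zero]
  · exact toDual_eq_zero e hf hm

lemma hasFiniteWeightSpaces (hM : IsWeightModule h M) (hM' : HasFiniteWeightSpaces h M) :
    HasFiniteWeightSpaces h (TwistedDual τ M) := by
  intro μ
  have := hM' μ
  let F : weightSpace h (TwistedDual τ M) μ →ₗ[k] Module.Dual k (weightSpace h M μ) :=
    (weightSpace h M μ).subtype.dualMap ∘ₗ toDual.toLinearMap ∘ₗ (weightSpace h _ μ).subtype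
  refine Module.Finite.of_injective F ?_
  rintro ⟨f, hf⟩ ⟨f', hf'⟩ hff
  refine Subtype.ext (ext_of_isWeightModule hM fun ν m hm => ?_)
  by_cases e : μ = ν
  · subst e
    exact LinearMap.congr_fun hff ⟨m, hm⟩
  · exact (toDual_eq_zero e hf hm).trans (toDual_eq_zero e hf' hm).symm

end TwistedDual

open TwistedDual

section RootReductive

variable [CharZero k] [IsAlgClosed k]

lemma ι_smul_mem_iSup_weightSpace (hg : IsRootReductive h) (x : g) {m : M}
    (hm : m ∈ ⨆ μ, weightSpace h M μ) : ι k x • m ∈ ⨆ μ, weightSpace h M μ := by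
  set P := ⨆ μ, weightSpace h M μ
  suffices hP : P ≤ P.comap (Algebra.lsmul k k M (ι k x)) from hP hm
  refine iSup_le fun μ m hm => ?_
  let q : Submodule k g :=
    { carrier := {x | ι k x • m ∈ P}
      add_mem' := fun {x y} hx hy => by
        rw [Set.mem_ofPred_eq, map_add, add_smul]
        exact P.add_mem hx hy
      zero_mem' := by
        rw [Set.mem_ofPred_eq, map_zero, zero_smul]
        exact P.zero_mem
      smul_mem' := fun c x hx => by
        rw [Set.mem_ofPred_eq, map_smul, smul_assoc]
        exact P.smul_mem c hx }
  have hq : ⊤ ≤ q := by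
    rw [← hg.sup_iSup_rootSpace]
    refine sup_le (fun H hH => ?_) (iSup₂_le fun α _ y hy => ?_)
    · change ι k H • m ∈ P
      exact (hm ⟨H, hH⟩).symm ▸ Submodule.mem_iSup_of_mem μ (Submodule.smul_mem _ _ hm)
    · exact Submodule.mem_iSup_of_mem (μ + α) (ι_smul_mem_weightSpace hy hm)
  exact hq (Submodule.mem_top : x ∈ ⊤)

lemma isWeightModule_submoduleOfForall (hg : IsRootReductive h) : IsWeightModule h
    (submoduleOfForall (⨆ μ, weightSpace h M μ) fun x _ => ι_smul_mem_iSup_weightSpace hg x) := by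
  set L := submoduleOfForall (⨆ μ, weightSpace h M μ)
    fun x _ => ι_smul_mem_iSup_weightSpace hg x
  rw [IsWeightModule, eq_top_iff]
  rintro ⟨m, hm⟩ -
  have hle : ⨆ μ, weightSpace h M μ ≤
      (⨆ μ, weightSpace h L μ).map (L.subtype.restrictScalars k) :=
    iSup_le fun μ m hm => ⟨⟨m, Submodule.mem_iSup_of_mem μ hm⟩, Submodule.mem_iSup_of_mem μ
      (mem_weightSpace_of_map L.subtype Subtype.val_injective hm), rfl⟩
  obtain ⟨m', hm', e⟩ := hle hm
  rwa [← (Subtype.ext e : m' = ⟨m, hm⟩)]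

lemma mem_contragredient (hg : IsRootReductive h) {μ : Module.Dual k h} {f : TwistedDual τ M}
    (hf : f ∈ weightSpace h (TwistedDual τ M) μ) : f ∈ contragredient τ M := by
  have h1 := isWeightModule_submoduleOfForall (M := TwistedDual τ M) hg
  refine (le_sSup h1 : _ ≤ contragredient τ M) ?_
  exact Submodule.mem_iSup_of_mem μ hf

/-- The sum of all weight spaces of the twisted dual is stable under `g`, since root vectors shift
weights; it contains every submodule that is a weight module. -/
lemma isWeightModule_contragredient (hg : IsRootReductive h) :
    IsWeightModule h (contragredient τ M) := by
  have h1 := isWeightModule_submoduleOfForall (M := TwistedDual τ M) hg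
  have hle : contragredient τ M ≤ submoduleOfForall (⨆ μ, weightSpace h (TwistedDual τ M) μ)
      fun x _ => ι_smul_mem_iSup_weightSpace hg x := by
    refine sSup_le fun L (hL : IsWeightModule h L) m hm => ?_
    obtain ⟨s, v, hv, hs⟩ := hL.exists_sum ⟨m, hm⟩
    have : m = ∑ μ ∈ s, (v μ : TwistedDual τ M) := by
      rw [← Submodule.coe_sum, hs]
    rw [this]
    exact Submodule.sum_mem _ fun μ _ =>
      Submodule.mem_iSup_of_mem μ (map_mem_weightSpace L.subtype (hv μ))
  exact h1.of_injective (Submodule.inclusion hle) (Submodule.inclusion_injective hle)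

end RootReductive

/-- A homomorphism from a weight module to the twisted dual takes values in the contragredient
module. -/
noncomputable def contragredientLift (hN : IsWeightModule h N)
    (f : N →ₗ[UniversalEnvelopingAlgebra k g] TwistedDual τ M) :
    N →ₗ[UniversalEnvelopingAlgebra k g] contragredient τ M :=
  f.codRestrict _ fun n => by
    have h1 : IsWeightModule h (LinearMap.range f) :=
      .of_surjective f.rangeRestrict f.surjective_rangeRestrict hN
    exact (le_sSup h1 : _ ≤ contragredient τ M) ⟨n, rfl⟩

section Functoriality

variable [CharZero k] [IsAlgClosed k] (hg : IsRootReductive h)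

/-- The homomorphism of contragredient modules induced by a homomorphism. -/
noncomputable def contragredientMap (f : M →ₗ[UniversalEnvelopingAlgebra k g] N) :
    contragredient τ N →ₗ[UniversalEnvelopingAlgebra k g] contragredient τ M :=
  contragredientLift (isWeightModule_contragredient hg)
    -- Two adjunctions turn precomposition with `f` into a homomorphism over the enveloping algebra
    -- without a separate check of linearity.
    (flip (flip (contragredient τ N).subtype ∘ₗ f))

lemma toDual_contragredientMap (f : M →ₗ[UniversalEnvelopingAlgebra k g] N)
    (φ : contragredient τ N) (m : M) :
    toDual (contragredientMap hg f φ : TwistedDual τ M) m = toDual (φ : TwistedDual τ N) (f m) :=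
  rfl

lemma contragredientMap_injective {f : M →ₗ[UniversalEnvelopingAlgebra k g] N}
    (hf : Function.Surjective f) : Function.Injective (contragredientMap (τ := τ) hg f) := by
  intro φ φ' e
  refine Subtype.ext (TwistedDual.ext fun n => ?_)
  obtain ⟨m, rfl⟩ := hf n
  rw [← toDual_contragredientMap hg, e, toDual_contragredientMap]

/-- A functional of weight `μ` on `M` extends linearly to `N`. Changing the extension to zero on the
other weight spaces gives a weight vector with the same restriction. -/
lemma contragredientMap_surjective {f : M →ₗ[UniversalEnvelopingAlgebra k g] N}
    (hf : Function.Injective f) (hN : IsWeightModule h N) :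
    Function.Surjective (contragredientMap (τ := τ) hg f) := by
  have hM : IsWeightModule h M := .of_injective f hf hN
  obtain ⟨r, hr⟩ := (f.restrictScalars k).exists_leftInverse_of_injective
    (LinearMap.ker_eq_bot.mpr hf)
  intro φ
  obtain ⟨s, v, hv, rfl⟩ := (isWeightModule_contragredient hg).exists_sum φ
  refine Submodule.sum_mem (LinearMap.range (contragredientMap (τ := τ) hg f)) fun μ _ => ?_
  have hvμ : (v μ : TwistedDual τ M) ∈ weightSpace h (TwistedDual τ M) μ :=
    map_mem_weightSpace (contragredient τ M).subtype (hv μ)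
  obtain ⟨φ, hφ, e⟩ := exists_mem_weightSpace (τ := τ) hN μ
    (toDual (v μ : TwistedDual τ M) ∘ₗ r)
  refine ⟨⟨φ, mem_contragredient hg hφ⟩,
    Subtype.ext (ext_of_isWeightModule hM fun ν m hm => ?_)⟩
  rw [toDual_contragredientMap]
  by_cases hν : μ = ν
  · subst hν
    refine (e _ (map_mem_weightSpace f hm)).trans ?_
    exact congrArg _ (LinearMap.congr_fun hr m)
  · rw [toDual_eq_zero hν hvμ hm]
    exact toDual_eq_zero hν hφ (map_mem_weightSpace f hm)

variable {P : Type u} [AddCommGroup P] [Module k P] [Module (UniversalEnvelopingAlgebra k g) P]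
  [IsScalarTower k (UniversalEnvelopingAlgebra k g) P]

/-- A functional vanishing on the image of `f` descends along `f'` to `P`. It remains to see that
the descended functional lies in the contragredient. -/
lemma contragredientMap_exact {f : M →ₗ[UniversalEnvelopingAlgebra k g] N}
    {f' : N →ₗ[UniversalEnvelopingAlgebra k g] P} (hff' : Function.Exact f f')
    (hf' : Function.Surjective f') :
    Function.Exact (contragredientMap (τ := τ) hg f') (contragredientMap (τ := τ) hg f) := by
  intro φ
  refine ⟨fun hφ => ?_, ?_⟩
  · let ft : TwistedDual τ P →ₗ[UniversalEnvelopingAlgebra k g] TwistedDual τ N :=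
      flip (flip LinearMap.id ∘ₗ f')
    have hft : ∀ ψ n, toDual (ft ψ) n = toDual ψ (f' n) := fun _ _ => rfl
    have hftinj : Function.Injective ft := fun ψ ψ' e => TwistedDual.ext fun p => by
      obtain ⟨n, rfl⟩ := hf' p
      rw [← hft, e, hft]
    obtain ⟨r, hr⟩ := (f'.restrictScalars k).exists_rightInverse_of_surjective
      (LinearMap.range_eq_top.mpr hf')
    let ψ : TwistedDual τ P := toDual.symm (toDual (φ : TwistedDual τ N) ∘ₗ r)
    have hψ : ft ψ = φ := TwistedDual.ext fun n => by
      change toDual (φ : TwistedDual τ N) (r (f' n)) = _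
      have h1 : f' (r (f' n) - n) = 0 := by
        rw [map_sub, sub_eq_zero]
        exact LinearMap.congr_fun hr (f' n)
      obtain ⟨m, hm⟩ := (hff' _).mp h1
      have h2 : toDual (φ : TwistedDual τ N) (f m) = 0 := by
        rw [← toDual_contragredientMap hg, hφ]
        rfl
      rwa [hm, map_sub, sub_eq_zero] at h2
    let L := (contragredient τ N).comap ft
    -- The pullback of the contragredient of `N` embeds into it, so it is a weight module and lies
    -- in the contragredient of `P`.
    have hL : IsWeightModule h L :=
      .of_injective ((ft ∘ₗ L.subtype).codRestrict (contragredient τ N) fun ψ => ψ.2)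
        (fun ψ ψ' e => Subtype.ext (hftinj (congrArg Subtype.val e)))
        (isWeightModule_contragredient hg)
    have hψL : ψ ∈ L := by
      change ft ψ ∈ contragredient τ N
      rw [hψ]
      exact φ.2
    exact ⟨⟨ψ, (le_sSup hL : L ≤ contragredient τ P) hψL⟩, Subtype.ext hψ⟩
  · rintro ⟨ψ, rfl⟩
    refine Subtype.ext (TwistedDual.ext fun m => ?_)
    rw [toDual_contragredientMap, toDual_contragredientMap, hff'.apply_apply_eq_zero, map_zero]
    rfl

end Functoriality

end TwistedDual

/-! ### Fibre products of weight modules. -/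

section Pullback

variable {k : Type u} [Field k] {g : Type u} [LieRing g] [LieAlgebra k g] {h : LieSubalgebra k g}
variable {M : Type u} [AddCommGroup M] [Module k M] [Module (UniversalEnvelopingAlgebra k g) M]
  [IsScalarTower k (UniversalEnvelopingAlgebra k g) M]
variable {N : Type u} [AddCommGroup N] [Module k N] [Module (UniversalEnvelopingAlgebra k g) N]
  [IsScalarTower k (UniversalEnvelopingAlgebra k g) N]
variable {P : Type u} [AddCommGroup P] [Module k P] [Module (UniversalEnvelopingAlgebra k g) P]
  [IsScalarTower k (UniversalEnvelopingAlgebra k g) P]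

lemma IsWeightModule.exists_pullback (hM : IsWeightModule h M) (hN : IsWeightModule h N)
    (f : M →ₗ[UniversalEnvelopingAlgebra k g] P) (hf : Function.Surjective f)
    (f' : N →ₗ[UniversalEnvelopingAlgebra k g] P) :
    ∃ (A : Type u) (_ : AddCommGroup A) (_ : Module k A)
      (_ : Module (UniversalEnvelopingAlgebra k g) A)
      (_ : IsScalarTower k (UniversalEnvelopingAlgebra k g) A)
      (p : A →ₗ[UniversalEnvelopingAlgebra k g] M) (p' : A →ₗ[UniversalEnvelopingAlgebra k g] N),
      Function.Surjective p' ∧ (∀ x, f (p x) = f' (p' x)) ∧ IsWeightModule h A ∧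
      support h A ⊆ support h M ∪ support h N := by
  let L : Submodule (UniversalEnvelopingAlgebra k g) (M × N) :=
    LinearMap.eqLocus (f ∘ₗ LinearMap.fst _ M N) (f' ∘ₗ LinearMap.snd _ M N)
  refine ⟨L, _, _, _, inferInstance, LinearMap.fst _ M N ∘ₗ L.subtype,
    LinearMap.snd _ M N ∘ₗ L.subtype, fun n => ?_, fun x => x.2, ?_, ?_⟩
  · obtain ⟨m, hm⟩ := hf (f' n)
    exact ⟨⟨⟨m, n⟩, hm⟩, rfl⟩
  · exact .of_injective L.subtype Subtype.val_injective (.of_add (LinearMap.inl _ M N)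
      (LinearMap.inr _ M N) (exists_add_prod M N) hM hN)
  · exact (support_subset_of_injective L.subtype Subtype.val_injective).trans
      (support_subset_of_jointly_injective (LinearMap.fst _ M N) (LinearMap.snd _ M N)
        (jointly_injective_prod M N))

end Pullback

/-! ### Extensions to modules with a dual Verma flag. -/

section Duality

open scoped ModuleCat
open TwistedDual

variable {k : Type u} [Field k] [CharZero k] [IsAlgClosed k] {g : Type u} [LieRing g]
  [LieAlgebra k g] {h : LieSubalgebra k g} {Φp : Set (Module.Dual k h)} {a b : LieSubalgebra k g}
  {τ : TransposeMap h}

section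

variable {M : Type u} [AddCommGroup M] [Module k M] [Module (UniversalEnvelopingAlgebra k g) M]
  [IsScalarTower k (UniversalEnvelopingAlgebra k g) M]
variable {N : Type u} [AddCommGroup N] [Module k N] [Module (UniversalEnvelopingAlgebra k g) N]
  [IsScalarTower k (UniversalEnvelopingAlgebra k g) N]

lemma contragredient_support_subset (hM : IsWeightModule h M) :
    support h (contragredient τ M) ⊆ support h M :=
  (support_subset_of_injective (contragredient τ M).subtype Subtype.val_injective).trans
    (TwistedDual.support_subset hM)

/-- A functional not vanishing at a given weight vector can be cut down to that weight. This
recovers the weights of a Verma module from those of its dual. -/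
lemma support_subset_contragredient (hg : IsRootReductive h) (hM : IsWeightModule h M) :
    support h M ⊆ support h (contragredient τ M) := by
  intro μ hμ
  obtain ⟨m, hm, h0⟩ := mem_support_iff.mp hμ
  obtain ⟨f, hf⟩ : ∃ f : Module.Dual k M, f m ≠ 0 := by
    by_contra! hcon
    exact h0 ((Module.forall_dual_apply_eq_zero_iff k m).mp hcon)
  obtain ⟨φ, hφ, e⟩ := exists_mem_weightSpace (τ := τ) hM μ f
  refine mem_support_iff.mpr ⟨⟨φ, mem_contragredient hg hφ⟩,
    mem_weightSpace_of_map (contragredient τ M).subtype Subtype.val_injective hφ, fun e0 => hf ?_⟩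
  rw [← e m hm]
  exact congrArg (fun ψ : contragredient τ M => toDual (ψ : TwistedDual τ M) m) e0

/-- Isomorphic modules have isomorphic contragredient modules. -/
noncomputable def contragredientEquiv (hg : IsRootReductive h)
    (e : M ≃ₗ[UniversalEnvelopingAlgebra k g] N) :
    contragredient τ N ≃ₗ[UniversalEnvelopingAlgebra k g] contragredient τ M :=
  LinearEquiv.ofLinearMap (contragredientMap hg e.toLinearMap)
    (contragredientMap hg e.symm.toLinearMap)
    (LinearMap.ext fun φ => Subtype.ext (TwistedDual.ext fun m => by
      change toDual (φ : TwistedDual τ M) (e.symm (e m)) = _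
      rw [e.symm_apply_apply]
      rfl))
    (LinearMap.ext fun φ => Subtype.ext (TwistedDual.ext fun m => by
      change toDual (φ : TwistedDual τ N) (e (e.symm m)) = _
      rw [e.apply_symm_apply]
      rfl))

end

variable (T : IsTriangular Φp a b) {K : Set (Module.Dual k h)}

lemma IsTriangular.isLocallyFinite_of_support_subset (T : IsTriangular Φp a b)
    (hK' : IsUpperFinite Φp K) {M : Type u} [AddCommGroup M] [Module k M]
    [Module (UniversalEnvelopingAlgebra k g) M] [IsScalarTower k (UniversalEnvelopingAlgebra k g) M]
    (hM : IsWeightModule h M) (hs : support h M ⊆ K) : IsLocallyFinite M (borel Φp) :=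
  T.isLocallyFinite hM fun μ hμ => (hK' μ (hs hμ)).subset fun _ hν => ⟨hs hν.1, hν.2⟩

variable (hK : IsWeightIdeal Φp K) (hK' : IsUpperFinite Φp K)
include T hK hK'

section
variable {V : Type u} [AddCommGroup V] [Module k V] [Module (UniversalEnvelopingAlgebra k b) V]
  [IsScalarTower k (UniversalEnvelopingAlgebra k b) V] [FiniteDimensional k V]

lemma catKObar_contragredient_ind (hV : HasWeightsIn b K V) : catKObar Φp K
    (ModuleCat.of (UniversalEnvelopingAlgebra k g) (contragredient τ (Ind T.isCompl V))) := by
  -- An abstract isomorphic copy separates the scalar structure of an object of `ModuleCat` from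
  -- that of the contragredient submodule.
  obtain ⟨N, ⟨e⟩⟩ : ∃ N : ModuleCat.{u} (UniversalEnvelopingAlgebra k g),
      Nonempty (N ≃ₗ[UniversalEnvelopingAlgebra k g] contragredient τ (Ind T.isCompl V)) :=
    ⟨ModuleCat.of _ _, ⟨LinearEquiv.refl _ _⟩⟩
  have hI := T.isWeightModule_ind hV
  have hN : IsWeightModule h N :=
    .of_injective e.toLinearMap e.injective (isWeightModule_contragredient T.isRootReductive)
  have hs : support h N ⊆ K := (support_subset_of_injective e.toLinearMap e.injective).trans
    ((contragredient_support_subset hI).trans (T.support_ind_subset hK hV))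
  have hN' : catKObar Φp K N := ⟨⟨⟨hN, T.isLocallyFinite_of_support_subset hK' hN hs⟩, hs⟩,
    .of_injective ((contragredient τ _).subtype ∘ₗ e.toLinearMap)
      (Subtype.val_injective.comp e.injective)
      (hasFiniteWeightSpaces hI (T.hasFiniteWeightSpaces_ind hV))⟩
  exact (catKObar Φp K).prop_of_iso e.toModuleIso hN'

end

/-- Dual to the case of finitely induced modules: a monomorphism into `B` must be dominated by one
into the contragredient of a finitely induced module. Since `B` may have infinite dimensional weight
spaces, double duality is not available; adjoints of maps into twisted duals are used instead. -/
lemma extMapBijective_of_contragredient_ind {M N : (catKObar Φp K).FullSubcategory}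
    {V : Type u} [AddCommGroup V] [Module k V] [Module (UniversalEnvelopingAlgebra k b) V]
    [IsScalarTower k (UniversalEnvelopingAlgebra k b) V] [FiniteDimensional k V]
    (hV : HasWeightsIn b K V)
    (e : N.obj ≃ₗ[UniversalEnvelopingAlgebra k g] contragredient τ (Ind T.isCompl V)) (n : ℕ) :
    ExtMapBijective (ObjectProperty.ιOfLE (catKObar_le_catKO Φp K)) M N n := by
  have hg := T.isRootReductive
  let _ := HasExt.standard (catKO Φp K).FullSubcategory
  let _ := HasExt.standard (catKObar Φp K).FullSubcategory
  let Z : (catKObar Φp K).FullSubcategory → Prop := fun Y =>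
    ∃ (V : Type u) (_ : AddCommGroup V) (_ : Module k V)
      (_ : Module (UniversalEnvelopingAlgebra k b) V)
      (_ : IsScalarTower k (UniversalEnvelopingAlgebra k b) V), FiniteDimensional k V ∧
      HasWeightsIn b K V ∧ Nonempty (Y.obj ≃ₗ[UniversalEnvelopingAlgebra k g]
        contragredient τ (Ind T.isCompl V))
  refine Abelian.Ext.mapExtAddHom_bijective_of_codominated _ Z ?_ n M N
    ⟨V, _, _, _, inferInstance, inferInstance, hV, ⟨e⟩⟩
  clear e hV
  rintro Y ⟨V, _, _, _, _, _, hV, ⟨e⟩⟩ B j _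
  have hI := T.isWeightModule_ind hV
  have hB : IsWeightModule h B.obj := B.2.1.1
  let ev : Ind T.isCompl V →ₗ[UniversalEnvelopingAlgebra k g] contragredient τ Y.obj :=
    contragredientLift hI (flip ((contragredient τ _).subtype ∘ₗ e.toLinearMap))
  -- Dualizing `j` gives a surjection onto the contragredient of `Y`. Its pullback along evaluation
  -- is a surjection onto `Ind V` with weights in `K`, to which the finite covers apply.
  obtain ⟨A, _, _, _, _, p, p', hp', hpp', hA, hA'⟩ :=
    (isWeightModule_contragredient hg).exists_pullback (N := Ind T.isCompl V) hI
      (contragredientMap (τ := τ) hg j.hom.hom)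
      (contragredientMap_surjective hg (injective_of_mono j) hB) ev
  replace hA' : support h A ⊆ K := hA'.trans (Set.union_subset
    ((contragredient_support_subset hB).trans B.2.2) (T.support_ind_subset hK hV))
  have hAl : IsLocallyFinite A (⊤ : Submodule k b) := by
    rw [isLocallyFinite_restrict, T.right_eq]
    exact T.isLocallyFinite_of_support_subset hK' hA hA'
  obtain ⟨W, _, _, _, _, W', _, _, _, _, i, r, l, _, _, hW', hW, hi, hr, hir, hl⟩ :=
    T.exists_finite_cover p' hp' ((hasWeightsIn_iff T.le).mpr ⟨hA, hA'⟩) hAl hV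
  -- The adjoint of the map from `Ind W` through `A` to the contragredient of `B`.
  let ρ : B.obj →ₗ[UniversalEnvelopingAlgebra k g] contragredient τ (Ind T.isCompl W) :=
    contragredientLift hB (flip ((contragredient τ _).subtype ∘ₗ p ∘ₗ l))
  obtain ⟨w, hw⟩ := exists_shortExact (X₁ := Y)
    (X₂ := (⟨_, catKObar_contragredient_ind (τ := τ) T hK hK' hW⟩ :
      (catKObar Φp K).FullSubcategory))
    (X₃ := ⟨_, catKObar_contragredient_ind (τ := τ) T hK hK' hW'⟩)
    (contragredientMap hg (Ind.map T.isCompl r) ∘ₗ e.toLinearMap)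
    (contragredientMap hg (Ind.map T.isCompl i))
    ((contragredientMap_injective hg (Ind.map_surjective hr)).comp e.injective)
    (contragredientMap_surjective hg (Ind.map_injective hi) (T.isWeightModule_ind hW))
    (fun φ => by
      rw [contragredientMap_exact hg (Ind.map_exact hir hr) (Ind.map_surjective hr) φ]
      exact e.surjective.range_comp _ ▸ Iff.rfl)
  refine ⟨_, hw, rfl, homOfLinearMap (Y := (ObjectProperty.ιOfLE (catKObar_le_catKO Φp K)).obj
      ⟨_, catKObar_contragredient_ind (τ := τ) T hK hK' hW⟩) ρ,
    ⟨_, _, _, _, inferInstance, inferInstance, hW, ⟨LinearEquiv.refl _ _⟩⟩,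
    ⟨_, _, _, _, inferInstance, inferInstance, hW', ⟨LinearEquiv.refl _ _⟩⟩, ?_⟩
  -- Evaluated on `Ind W`, both sides pair `y` with the image of `w` in `Ind V`; this is the
  -- commutativity of the pullback square together with that of the cover.
  refine linearMap_ext (LinearMap.ext fun y => Subtype.ext (TwistedDual.ext fun w => ?_))
  change toDual (e y : TwistedDual τ (Ind T.isCompl V)) (Ind.map T.isCompl r w) =
    toDual (contragredientMap (M := Y.obj) hg j.hom.hom (p (l w))).1 y
  rw [hpp', hl]
  rfl

/-- Extension groups of modules with a dual Verma flag agree in the two truncated categories. -/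
lemma extMapBijective_of_hasDualVermaFlag {M N : (catKObar Φp K).FullSubcategory}
    (hN : HasDualVermaFlag τ Φp N.obj) (n : ℕ) :
    ExtMapBijective (ObjectProperty.ιOfLE (catKObar_le_catKO Φp K)) M N n := by
  have hg := T.isRootReductive
  refine HasFlag.induction (fun Y : (catKObar Φp K).FullSubcategory => ∀ n,
    ExtMapBijective (ObjectProperty.ιOfLE (catKObar_le_catKO Φp K)) M Y n) ?_ ?_ ?_ hN n
  · intro Y hY n
    have : Subsingleton (contragredient τ (Ind T.isCompl (PUnit : Type u))) :=
      ⟨fun φ φ' => Subtype.ext (TwistedDual.ext fun m => by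
        rw [Subsingleton.elim m 0, map_zero, map_zero])⟩
    exact extMapBijective_of_contragredient_ind (τ := τ) T hK hK' (V := PUnit) .of_subsingleton
      0 n
  · intro S hS h1 h3 n
    let _ := HasExt.standard (catKO Φp K).FullSubcategory
    let _ := HasExt.standard (catKObar Φp K).FullSubcategory
    exact Abelian.Ext.mapExtAddHom_bijective_X₂_of_covariant _ hS M h1 h3 n
  · rintro Y lam ⟨e⟩ n
    obtain ⟨V, hV, hVw, ⟨e'⟩⟩ := T.exists_verma_equiv lam
    have hw : IsWeightModule h (Verma Φp lam) :=
      .of_injective e'.toLinearMap e'.injective (T.isWeightModule_ind hVw)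
    -- The weights of the Verma module occur in its dual, which is isomorphic to the object `Y` of
    -- the truncated category.
    have hs : support h (Verma Φp lam) ⊆ K := (support_subset_contragredient hg hw).trans
      ((support_subset_of_injective e.symm.toLinearMap e.symm.injective).trans Y.2.1.2)
    exact extMapBijective_of_contragredient_ind T hK hK' (V := V)
      (((hasWeightsIn_iff T.le).mpr ⟨hw, hs⟩).of_injective V.subtype Subtype.val_injective)
      (e.trans (contragredientEquiv hg e'.symm)) n

end Duality

end RootReductive

theorem theorem4 {k : Type u} [Field k] [IsAlgClosed k] [CharZero k]
    {g : Type u} [LieRing g] [LieAlgebra k g] (h : LieSubalgebra k g)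
    (hg : RootReductive.IsRootReductive h)
    (Φp : Set (Module.Dual k h)) (hΦ : RootReductive.IsPositiveSystem h Φp)
    (hD : RootReductive.IsDynkin Φp)
    (K : Set (Module.Dual k h)) (hK : RootReductive.IsWeightIdeal Φp K)
    (hKfin : RootReductive.IsUpperFinite Φp K) :
    RootReductive.IsExtensionFull
        (ObjectProperty.ιOfLE (RootReductive.catKO_le_catO Φp K)) ∧
      RootReductive.IsExtensionFull
        (ObjectProperty.ιOfLE (RootReductive.catKO_le_catC Φp K)) ∧
      (∀ M N : (RootReductive.catKObar Φp K).FullSubcategory,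
        (RootReductive.HasVermaFlag Φp M.obj ∨
          ∃ τ : RootReductive.TransposeMap h, RootReductive.HasDualVermaFlag τ Φp N.obj) →
        ∀ i : ℕ, RootReductive.ExtMapBijective
          (ObjectProperty.ιOfLE (RootReductive.catKObar_le_catKO Φp K)) M N i) := by
  obtain ⟨a, b, T⟩ := RootReductive.exists_isTriangular hg hΦ hD
  -- With `p` true the ambient category is `catO`; with `p` false the local finiteness condition is
  -- void and it is `catC`.
  refine ⟨RootReductive.isExtensionFull_of_le T (p := True) (fun M => ?_) hK hKfin _,
    RootReductive.isExtensionFull_of_le T (p := False) (fun M => ?_) hK hKfin _, ?_⟩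
  · exact and_congr_right fun _ => true_imp_iff.symm
  · exact (and_iff_left False.elim).symm
  · rintro M N (hM | ⟨τ, hN⟩) i
    · exact RootReductive.extMapBijective_of_hasVermaFlag T hK hKfin hM i
    · exact RootReductive.extMapBijective_of_hasDualVermaFlag T hK hKfin hN i
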